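/- Let $X$ be a closed (compact, without boundary) smooth manifold with a smooth positive density $\mu$, let $G$ be a smooth finite-dimensional complex vector bundle over $X$ with a smooth Hermitian metric, and let $E = G\oplus G$ with the orthogonal direct sum metric. Let $\varepsilon$ be the endomorphism $\varepsilon(u,v)=(u,-v)$ of $E$. Let $\widehat P\colon C^\infty(X,E)\to C^\infty(X,E)$ be an elliptic linear differential operator of order $1$ with smooth coefficients which is formally self-adjoint, i.e. $\langle \widehat P u,v\rangle=\langle u,\widehat P v\rangle$ for all smooth sections $u,v$, where $\langle\cdot,\cdot\rangle$ is the $L^2$ inner product defined by $\mu$ and the metric of $E$. Suppose that $\widehat P$ is odd, i.e. has the form $$\widehat P=\begin{pmatrix}0&R'\\ R&0\end{pmatrix}$$ with respect to the decomposition $E=G\oplus G$. Let $H_0(X,E)$ and $H_1(X,E)$ be the Sobolev spaces of sections of $E$ of order $0$ (square-integrable sections) and $1$, i.e. the completions of $C^\infty(X,E)$ in the $L^2$ norm and in the $H_1$ norm defined by a finite family of charts and local trivializations together with a subordinate smooth partition of unity. Then $\widehat P-\varepsilon$ induces an isomorphism $H_1(X,E)\to H_0(X,E)$: there is a bounded complex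 linear bijection $H_1(X,E)\to H_0(X,E)$ with bounded inverse which is equal to $\widehat P-\varepsilon$ on smooth sections. -/

import Mathlib

open Bundle Manifold ContDiff MeasureTheory

set_option linter.unusedSectionVars false

noncomputable section

/-! ### Smooth sections of complex vector bundles over a manifold of dimension `n`

A smooth complex vector bundle is a Mathlib vector bundle which is smooth as a real vector bundle
and whose local trivializations are complex linear on the fibers. -/

section Sections

variable (n : ℕ) {X : Type*} [TopologicalSpace X] [ChartedSpace (EuclideanSpace ℝ (Fin n)) X]
  (F : Type*) [NormedAddCommGroup F] [NormedSpace ℂ F]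
  (E : X → Type*) [TopologicalSpace (TotalSpace F E)] [∀ x, TopologicalSpace (E x)]
  [∀ x, AddCommGroup (E x)] [∀ x, Module ℂ (E x)] [FiberBundle F E]
  [VectorBundle ℝ F E] [VectorBundle ℂ F E]

/-- A section of `E` is smooth. -/
def IsSmoothSection (u : ∀ x, E x) : Prop :=
  ContMDiff (𝓡 n) ((𝓡 n).prod 𝓘(ℝ, F)) ∞ (fun x => TotalSpace.mk' F x (u x))

variable {n F E}

/-- Smoothness of a section in terms of local trivializations. -/
theorem isSmoothSection_iff (u : ∀ x, E x) : IsSmoothSection n F E u ↔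
    ∀ x₀, ContMDiffAt (𝓡 n) 𝓘(ℝ, F) ∞ (fun x => (trivializationAt F E x₀ ⟨x, u x⟩).2) x₀ :=
  forall_congr' fun x₀ => Bundle.contMDiffAt_section x₀

variable (n F E)

/-- The complex vector space `C^∞(X, E)` of smooth sections of `E`. -/
def SmoothSection : Submodule ℂ (∀ x, E x) where
  carrier := {u | IsSmoothSection n F E u}
  zero_mem' := Bundle.contMDiff_zeroSection ℝ E
  add_mem' := by
    intro u v hu hv
    exact ContMDiff.add_section hu hv
  smul_mem' := by
    intro c u hu
    have hu' := (isSmoothSection_iff u).1 hu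
    refine (isSmoothSection_iff (c • u)).2 fun x₀ => ?_
    have h1 : ContMDiffAt (𝓡 n) 𝓘(ℝ, F) ∞
        (fun x => c • (trivializationAt F E x₀ ⟨x, u x⟩).2) x₀ :=
      (contDiff_const_smul c).contMDiff.contMDiffAt.comp x₀ (hu' x₀)
    refine h1.congr_of_eventuallyEq ?_
    filter_upwards [(trivializationAt F E x₀).open_baseSet.mem_nhds
      (FiberBundle.mem_baseSet_trivializationAt' x₀)] with x hx
    exact ((trivializationAt F E x₀).linear ℂ hx).map_smul c (u x)

/-- The part of the coordinate domain of the preferred chart at `x₀` over which the preferred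
local trivialization of `E` at `x₀` is defined. -/
def localDomain (x₀ : X) : Set (EuclideanSpace ℝ (Fin n)) :=
  (chartAt (EuclideanSpace ℝ (Fin n)) x₀).target ∩
    (chartAt (EuclideanSpace ℝ (Fin n)) x₀).symm ⁻¹' (trivializationAt F E x₀).baseSet

/-- The section `u` in the preferred coordinates and trivialization at `x₀`; it is
meaningful on `localDomain n F E x₀`. -/
def localRep (x₀ : X) (u : ∀ x, E x) (y : EuclideanSpace ℝ (Fin n)) : F :=
  (trivializationAt F E x₀ ⟨(chartAt (EuclideanSpace ℝ (Fin n)) x₀).symm y,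
    u ((chartAt (EuclideanSpace ℝ (Fin n)) x₀).symm y)⟩).2

variable {n F E}

theorem isOpen_localDomain (x₀ : X) : IsOpen (localDomain n F E x₀) :=
  (chartAt (EuclideanSpace ℝ (Fin n)) x₀).isOpen_inter_preimage_symm
    (trivializationAt F E x₀).open_baseSet

theorem localRep_add (x₀ : X) (u v : ∀ x, E x) {y : EuclideanSpace ℝ (Fin n)}
    (hy : y ∈ localDomain n F E x₀) :
    localRep n F E x₀ (u + v) y = localRep n F E x₀ u y + localRep n F E x₀ v y :=
  ((trivializationAt F E x₀).linear ℂ hy.2).map_add _ _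

theorem localRep_smul (x₀ : X) (c : ℂ) (u : ∀ x, E x) {y : EuclideanSpace ℝ (Fin n)}
    (hy : y ∈ localDomain n F E x₀) :
    localRep n F E x₀ (c • u) y = c • localRep n F E x₀ u y :=
  ((trivializationAt F E x₀).linear ℂ hy.2).map_smul _ _

theorem contDiffOn_localRep [IsManifold (𝓡 n) ∞ X] [ContMDiffVectorBundle ∞ F E (𝓡 n)]
    (x₀ : X) (u : SmoothSection n F E) :
    ContDiffOn ℝ ∞ (localRep n F E x₀ u) (localDomain n F E x₀) := by
  rw [← contMDiffOn_iff_contDiffOn]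
  have h1 : ContMDiffOn (𝓡 n) 𝓘(ℝ, F) ∞
      (fun x => (trivializationAt F E x₀ ⟨x, (u : ∀ x, E x) x⟩).2)
      (trivializationAt F E x₀).baseSet :=
    ((trivializationAt F E x₀).contMDiffOn_section_baseSet_iff (IB := 𝓡 n)).1
      (ContMDiff.contMDiffOn u.2)
  exact h1.comp ((contMDiffOn_chart_symm (I := 𝓡 n) (x := x₀)).mono Set.inter_subset_left)
    (fun y hy => hy.2)

end Sections

/-! ### Differential operators of order one -/

section Operators

variable {n : ℕ} {X : Type*} [TopologicalSpace X] [ChartedSpace (EuclideanSpace ℝ (Fin n)) X]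
  {F : Type*} [NormedAddCommGroup F] [NormedSpace ℂ F]
  {E : X → Type*} [TopologicalSpace (TotalSpace F E)] [∀ x, TopologicalSpace (E x)]
  [∀ x, AddCommGroup (E x)] [∀ x, Module ℂ (E x)] [FiberBundle F E]
  [VectorBundle ℝ F E] [VectorBundle ℂ F E]

/-- Near `x₀`, the operator `P` has the form `P u = ∑ j, a j * ∂u/∂y_j + b * u` with smooth
matrix-valued coefficients. -/
structure IsLocalForm (P : SmoothSection n F E →ₗ[ℂ] SmoothSection n F E) (x₀ : X)
    (a : Fin n → EuclideanSpace ℝ (Fin n) → (F →L[ℂ] F))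
    (b : EuclideanSpace ℝ (Fin n) → (F →L[ℂ] F)) : Prop where
  smooth_coeff : ∀ j, ContDiffOn ℝ ∞ (a j) (localDomain n F E x₀)
  smooth_zeroth : ContDiffOn ℝ ∞ b (localDomain n F E x₀)
  eq : ∀ u : SmoothSection n F E, ∀ y ∈ localDomain n F E x₀,
    localRep n F E x₀ (P u) y =
      ∑ j, a j y (fderiv ℝ (localRep n F E x₀ u) y (EuclideanSpace.single j 1)) +
        b y (localRep n F E x₀ u y)

/-- `P` is a linear differential operator of order (at most) `1` with smooth coefficients. -/
def IsFirstOrderDifferentialOperator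
    (P : SmoothSection n F E →ₗ[ℂ] SmoothSection n F E) : Prop :=
  ∀ x₀, ∃ a b, IsLocalForm P x₀ a b

/-- The principal symbol `i * ∑ j, ξ_j * a_j(y)` of `∑ j, a j * ∂/∂y_j + b`. -/
def principalSymbol (a : Fin n → EuclideanSpace ℝ (Fin n) → (F →L[ℂ] F))
    (y ξ : EuclideanSpace ℝ (Fin n)) : F →L[ℂ] F :=
  Complex.I • ∑ j, (ξ j : ℂ) • a j y

/-- A first-order differential operator is elliptic if its principal symbol is invertible at
every point and every nonzero covector. -/
def IsElliptic (P : SmoothSection n F E →ₗ[ℂ] SmoothSection n F E) : Prop :=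
  ∀ x₀ a b, IsLocalForm P x₀ a b →
    ∀ y ∈ localDomain n F E x₀, ∀ ξ : EuclideanSpace ℝ (Fin n), ξ ≠ 0 →
      IsUnit (principalSymbol a y ξ)

end Operators

/-! ### Hermitian metrics, densities, formal self-adjointness, and the space `H₀` -/

/-- `μ` is given by a smooth positive density. -/
class IsSmoothDensity (n : ℕ) {X : Type*} [TopologicalSpace X]
    [ChartedSpace (EuclideanSpace ℝ (Fin n)) X] [MeasurableSpace X]
    (μ : Measure X) : Prop where
  exists_density : ∀ x₀ : X, ∃ ρ : EuclideanSpace ℝ (Fin n) → ℝ,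
    ContDiffOn ℝ ∞ ρ (chartAt (EuclideanSpace ℝ (Fin n)) x₀).target ∧
    (∀ y ∈ (chartAt (EuclideanSpace ℝ (Fin n)) x₀).target, 0 < ρ y) ∧
    (μ.restrict (chartAt (EuclideanSpace ℝ (Fin n)) x₀).source).map
        (chartAt (EuclideanSpace ℝ (Fin n)) x₀) =
      (volume.restrict (chartAt (EuclideanSpace ℝ (Fin n)) x₀).target).withDensity
        (fun y => ENNReal.ofReal (ρ y))

theorem IsSmoothDensity.isFiniteMeasure (n : ℕ) {X : Type*} [TopologicalSpace X]
    [ChartedSpace (EuclideanSpace ℝ (Fin n)) X] [CompactSpace X] [MeasurableSpace X]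
    [BorelSpace X] (μ : Measure X) [IsSmoothDensity n μ] : IsFiniteMeasure μ := by
  have : IsLocallyFiniteMeasure μ := by
    refine ⟨fun x => ?_⟩
    obtain ⟨ρ, hρ, -, h⟩ := IsSmoothDensity.exists_density (n := n) (μ := μ) x
    set φ := chartAt (EuclideanSpace ℝ (Fin n)) x with hφ
    have hx : x ∈ φ.source := mem_chart_source _ x
    obtain ⟨K, hK, hKn, hKt⟩ : ∃ K : Set (EuclideanSpace ℝ (Fin n)),
        IsCompact K ∧ K ∈ nhds (φ x) ∧ K ⊆ φ.target := by
      obtain ⟨K, h1, h2, h3⟩ := local_compact_nhds (φ.open_target.mem_nhds (φ.map_source hx))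
      exact ⟨K, h3, h1, h2⟩
    refine ⟨φ.source ∩ φ ⁻¹' K, Filter.inter_mem (φ.open_source.mem_nhds hx)
      ((φ.continuousAt hx).preimage_mem_nhds hKn), ?_⟩
    have hm : AEMeasurable φ (μ.restrict φ.source) :=
      φ.continuousOn.aemeasurable φ.open_source.measurableSet
    have hKm := hK.isClosed.measurableSet
    have e1 : μ (φ.source ∩ φ ⁻¹' K) = (μ.restrict φ.source).map φ K := by
      rw [Measure.map_apply_of_aemeasurable hm hKm,
        Measure.restrict_apply' φ.open_source.measurableSet, Set.inter_comm]
    rw [e1, h, withDensity_apply _ hKm, Measure.restrict_restrict hKm,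
      Set.inter_eq_left.2 hKt]
    obtain ⟨C, hC⟩ := hK.bddAbove_image (hρ.continuousOn.mono hKt)
    calc ∫⁻ y in K, ENNReal.ofReal (ρ y) ≤ ∫⁻ y in K, ENNReal.ofReal C :=
          setLIntegral_mono' hKm fun y hy =>
            ENNReal.ofReal_le_ofReal (hC (Set.mem_image_of_mem _ hy))
      _ = ENNReal.ofReal C * volume K := by simp
      _ < ⊤ := ENNReal.mul_lt_top ENNReal.ofReal_lt_top hK.measure_lt_top
  infer_instance

section Metric

variable (n : ℕ) {X : Type*} [TopologicalSpace X] [ChartedSpace (EuclideanSpace ℝ (Fin n)) X]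
  (F : Type*) [NormedAddCommGroup F] [NormedSpace ℂ F]
  (E : X → Type*) [TopologicalSpace (TotalSpace F E)] [∀ x, TopologicalSpace (E x)]
  [∀ x, AddCommGroup (E x)] [∀ x, Module ℂ (E x)] [FiberBundle F E]
  [VectorBundle ℝ F E] [VectorBundle ℂ F E]

/-- A smooth Hermitian metric on the complex vector bundle `E`: a Hermitian inner product on
every fiber (conjugate linear in the first argument) such that the inner products of smooth
sections are smooth functions. -/
structure HermitianMetric where
  form : ∀ x, E x →ₗ⋆[ℂ] E x →ₗ[ℂ] ℂ
  conj_symm : ∀ x v w, starRingEnd ℂ (form x v w) = form x w v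
  pos : ∀ x v, v ≠ 0 → 0 < (form x v v).re
  smooth : ∀ u v : SmoothSection n F E,
    ContMDiff (𝓡 n) 𝓘(ℝ, ℂ) ∞ (fun x => form x ((u : ∀ x, E x) x) ((v : ∀ x, E x) x))

variable {n F E} [CompactSpace X] [MeasurableSpace X] [BorelSpace X]

/-- The `L²` inner product of smooth sections. -/
def l2Inner (h : HermitianMetric n F E) (μ : Measure X) (u v : SmoothSection n F E) : ℂ :=
  ∫ x, h.form x ((u : ∀ x, E x) x) ((v : ∀ x, E x) x) ∂μ

/-- `P` is formally self-adjoint: `⟨P u, v⟩ = ⟨u, P v⟩` for all smooth sections `u`, `v`. -/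
def IsFormallySelfAdjoint (h : HermitianMetric n F E) (μ : Measure X)
    (P : SmoothSection n F E →ₗ[ℂ] SmoothSection n F E) : Prop :=
  ∀ u v, l2Inner h μ (P u) v = l2Inner h μ u (P v)

theorem integrable_form (h : HermitianMetric n F E) (μ : Measure X) [IsSmoothDensity n μ]
    (u v : SmoothSection n F E) :
    Integrable (fun x => h.form x ((u : ∀ x, E x) x) ((v : ∀ x, E x) x)) μ := by
  have := IsSmoothDensity.isFiniteMeasure n μ
  exact (h.smooth u v).continuous.integrable_of_hasCompactSupport (HasCompactSupport.of_compactSpace _)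

theorem re_l2Inner_self_nonneg (h : HermitianMetric n F E) (μ : Measure X) [IsSmoothDensity n μ]
    (u : SmoothSection n F E) : 0 ≤ (l2Inner h μ u u).re := by
  have e := integral_re (𝕜 := ℂ) (integrable_form h μ u u)
  change 0 ≤ RCLike.re (l2Inner h μ u u)
  unfold l2Inner
  rw [← e]
  refine integral_nonneg fun x => ?_
  by_cases hx : (u : ∀ x, E x) x = 0
  · simp [hx]
  · exact (h.pos x _ hx).le

/-- Smooth sections of `E`, to be equipped with the `L²` norm. -/
def L2SmoothSection (_h : HermitianMetric n F E) (_μ : Measure X) : Type _ :=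
  SmoothSection n F E

variable (h : HermitianMetric n F E) (μ : Measure X)

instance : AddCommGroup (L2SmoothSection h μ) := inferInstanceAs (AddCommGroup (SmoothSection n F E))

instance : Module ℂ (L2SmoothSection h μ) := inferInstanceAs (Module ℂ (SmoothSection n F E))

instance L2SmoothSection.core [IsSmoothDensity n μ] :
    PreInnerProductSpace.Core ℂ (L2SmoothSection h μ) where
  inner u v := l2Inner h μ u v
  conj_inner_symm u v := by
    change starRingEnd ℂ (l2Inner h μ v u) = l2Inner h μ u v
    unfold l2Inner
    rw [← integral_conj]
    simp_rw [h.conj_symm]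
  re_inner_nonneg u := re_l2Inner_self_nonneg h μ u
  add_left u v w := by
    change l2Inner h μ (u + v) w = l2Inner h μ u w + l2Inner h μ v w
    unfold l2Inner
    rw [← integral_add (integrable_form h μ u w) (integrable_form h μ v w)]
    congr 1 with x
    exact LinearMap.map_add₂ _ _ _ _
  smul_left u v c := by
    change l2Inner h μ (c • u) v = starRingEnd ℂ c * l2Inner h μ u v
    unfold l2Inner
    rw [← integral_const_mul]
    congr 1 with x
    exact LinearMap.map_smulₛₗ₂ _ _ _ _

instance [IsSmoothDensity n μ] : SeminormedAddCommGroup (L2SmoothSection h μ) :=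
  InnerProductSpace.Core.toSeminormedAddCommGroup (𝕜 := ℂ)

instance [IsSmoothDensity n μ] : InnerProductSpace ℂ (L2SmoothSection h μ) :=
  InnerProductSpace.ofCore (L2SmoothSection.core h μ)

/-- The space `H₀(X, E)` of square-integrable sections: the completion of the space of smooth
sections in the `L²` norm. -/
abbrev SobolevH0 [IsSmoothDensity n μ] : Type _ :=
  UniformSpace.Completion (L2SmoothSection h μ)

/-- A smooth section as an element of `H₀(X, E)`. -/
def SobolevH0.ofSmooth [IsSmoothDensity n μ] (u : SmoothSection n F E) : SobolevH0 h μ :=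
  ((show L2SmoothSection h μ from u : L2SmoothSection h μ) : UniformSpace.Completion _)

end Metric

/-! ### The Sobolev space `H₁` -/

section Sobolev

variable (n : ℕ) {X : Type*} [TopologicalSpace X] [ChartedSpace (EuclideanSpace ℝ (Fin n)) X]
  (F : Type*) [NormedAddCommGroup F] [NormedSpace ℂ F]
  (E : X → Type*) [TopologicalSpace (TotalSpace F E)] [∀ x, TopologicalSpace (E x)]
  [∀ x, AddCommGroup (E x)] [∀ x, Module ℂ (E x)] [FiberBundle F E]
  [VectorBundle ℝ F E] [VectorBundle ℂ F E]

/-- Finitely many preferred charts of `X` and trivializations of `E`, with a smooth partition of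
unity subordinate to their domains. -/
structure SobolevAtlas where
  size : ℕ
  center : Fin size → X
  weight : Fin size → X → ℝ
  weight_smooth : ∀ i, ContMDiff (𝓡 n) 𝓘(ℝ, ℝ) ∞ (weight i)
  weight_nonneg : ∀ i x, 0 ≤ weight i x
  tsupport_subset : ∀ i, tsupport (weight i) ⊆
    (chartAt (EuclideanSpace ℝ (Fin n)) (center i)).source ∩
      (trivializationAt F E (center i)).baseSet
  sum_weight : ∀ x, ∑ i, weight i x = 1

/-- Such data exist on every compact Hausdorff smooth manifold. -/
theorem SobolevAtlas.nonempty [IsManifold (𝓡 n) ∞ X] [CompactSpace X] [T2Space X] :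
    Nonempty (SobolevAtlas n F E) := by
  obtain ⟨f, hf⟩ := SmoothPartitionOfUnity.exists_isSubordinate (𝓡 n) (isClosed_univ (X := X))
    (fun x : X => (chartAt (EuclideanSpace ℝ (Fin n)) x).source ∩
      (trivializationAt F E x).baseSet)
    (fun x => (chartAt _ x).open_source.inter (trivializationAt F E x).open_baseSet)
    (fun x _ => Set.mem_iUnion_of_mem x
      ⟨mem_chart_source _ x, FiberBundle.mem_baseSet_trivializationAt' x⟩)
  have hfin : {i | (Function.support (f i)).Nonempty}.Finite :=
    f.locallyFinite.finite_nonempty_of_compact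
  set e := hfin.toFinset.equivFin
  refine ⟨⟨hfin.toFinset.card, fun i => (e.symm i : X), fun i => f (e.symm i : X),
    fun i => (f _).contMDiff, fun i x => f.nonneg _ x, fun i => hf _, fun x => ?_⟩⟩
  rw [← f.sum_eq_one (Set.mem_univ x), e.symm.sum_comp (fun i => f (i : X) x),
    Finset.sum_coe_sort hfin.toFinset (fun i => f i x)]
  refine (finsum_eq_sum_of_support_subset _ fun i hi => ?_).symm
  exact hfin.mem_toFinset.2 ⟨x, hi⟩

variable {n F E} (𝒜 : SobolevAtlas n F E)

/-- The compactly supported function on `ℝⁿ` which represents the section `weight i * u`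
in the `i`-th chart and trivialization, extended by zero. -/
def SobolevAtlas.piece (i : Fin 𝒜.size) (u : ∀ x, E x) : EuclideanSpace ℝ (Fin n) → F :=
  (localDomain n F E (𝒜.center i)).indicator fun y =>
    𝒜.weight i ((chartAt (EuclideanSpace ℝ (Fin n)) (𝒜.center i)).symm y) •
      localRep n F E (𝒜.center i) u y

theorem SobolevAtlas.piece_add (i : Fin 𝒜.size) (u v : ∀ x, E x) :
    𝒜.piece i (u + v) = 𝒜.piece i u + 𝒜.piece i v := by
  ext y
  by_cases hy : y ∈ localDomain n F E (𝒜.center i)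
  · simp [SobolevAtlas.piece, hy, localRep_add _ _ _ hy]
  · simp [SobolevAtlas.piece, hy]

theorem SobolevAtlas.piece_smul (i : Fin 𝒜.size) (c : ℂ) (u : ∀ x, E x) :
    𝒜.piece i (c • u) = c • 𝒜.piece i u := by
  ext y
  by_cases hy : y ∈ localDomain n F E (𝒜.center i)
  · simp [SobolevAtlas.piece, hy, localRep_smul _ _ _ hy, smul_comm c]
  · simp [SobolevAtlas.piece, hy]

variable [CompactSpace X]

/-- The image in the `i`-th chart of the support of the `i`-th weight. -/
def SobolevAtlas.core (i : Fin 𝒜.size) : Set (EuclideanSpace ℝ (Fin n)) :=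
  chartAt (EuclideanSpace ℝ (Fin n)) (𝒜.center i) '' tsupport (𝒜.weight i)

theorem SobolevAtlas.isCompact_core (i : Fin 𝒜.size) : IsCompact (𝒜.core i) :=
  (isClosed_tsupport _).isCompact.image_of_continuousOn
    ((chartAt _ (𝒜.center i)).continuousOn.mono
      ((𝒜.tsupport_subset i).trans Set.inter_subset_left))

theorem SobolevAtlas.core_subset (i : Fin 𝒜.size) :
    𝒜.core i ⊆ localDomain n F E (𝒜.center i) := by
  rintro _ ⟨x, hx, rfl⟩
  have h := 𝒜.tsupport_subset i hx
  refine ⟨(chartAt _ (𝒜.center i)).map_source h.1, ?_⟩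
  rw [Set.mem_preimage, (chartAt _ (𝒜.center i)).left_inv h.1]
  exact h.2

theorem SobolevAtlas.piece_eq_zero (i : Fin 𝒜.size) (u : ∀ x, E x)
    {y : EuclideanSpace ℝ (Fin n)} (hy : y ∉ 𝒜.core i) : 𝒜.piece i u y = 0 := by
  by_cases hd : y ∈ localDomain n F E (𝒜.center i)
  · have : 𝒜.weight i ((chartAt (EuclideanSpace ℝ (Fin n)) (𝒜.center i)).symm y) = 0 := by
      by_contra h0
      exact hy ⟨_, subset_tsupport _ h0, (chartAt _ (𝒜.center i)).right_inv hd.1⟩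
    simp [SobolevAtlas.piece, hd, this]
  · simp [SobolevAtlas.piece, hd]

theorem SobolevAtlas.hasCompactSupport_piece (i : Fin 𝒜.size) (u : ∀ x, E x) :
    HasCompactSupport (𝒜.piece i u) :=
  HasCompactSupport.intro (𝒜.isCompact_core i) fun _ hy => 𝒜.piece_eq_zero i u hy

variable [IsManifold (𝓡 n) ∞ X] [ContMDiffVectorBundle ∞ F E (𝓡 n)]

theorem SobolevAtlas.contDiff_piece (i : Fin 𝒜.size) (u : SmoothSection n F E) :
    ContDiff ℝ ∞ (𝒜.piece i u) := by
  rw [contDiff_iff_contDiffAt]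
  intro y
  by_cases hy : y ∈ 𝒜.core i
  · have hd := (isOpen_localDomain (𝒜.center i)).mem_nhds (𝒜.core_subset i hy)
    have h1 : ContDiffOn ℝ ∞
        (fun y => 𝒜.weight i ((chartAt (EuclideanSpace ℝ (Fin n)) (𝒜.center i)).symm y))
        (localDomain n F E (𝒜.center i)) := by
      rw [← contMDiffOn_iff_contDiffOn]
      exact (𝒜.weight_smooth i).comp_contMDiffOn
        ((contMDiffOn_chart_symm (I := 𝓡 n) (x := 𝒜.center i)).mono Set.inter_subset_left)
    refine ((h1.smul (contDiffOn_localRep (𝒜.center i) u)).contDiffAt hd).congr_of_eventuallyEq ?_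
    filter_upwards [hd] with z hz
    simp [SobolevAtlas.piece, hz]
  · refine (contDiffAt_const (c := (0 : F))).congr_of_eventuallyEq ?_
    filter_upwards [(𝒜.isCompact_core i).isClosed.isOpen_compl.mem_nhds hy] with z hz
    exact 𝒜.piece_eq_zero i u hz

theorem SobolevAtlas.memLp_piece (i : Fin 𝒜.size) (u : SmoothSection n F E) :
    MemLp (𝒜.piece i u) 2 volume :=
  (𝒜.contDiff_piece i u).continuous.memLp_of_hasCompactSupport (𝒜.hasCompactSupport_piece i u)

theorem SobolevAtlas.memLp_fderiv_piece (i : Fin 𝒜.size) (u : SmoothSection n F E) :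
    MemLp (fderiv ℝ (𝒜.piece i u)) 2 volume :=
  ((𝒜.contDiff_piece i u).continuous_fderiv (by simp)).memLp_of_hasCompactSupport
    ((𝒜.hasCompactSupport_piece i u).fderiv (𝕜 := ℝ))

/-- The Sobolev `H₁` norm of a smooth section `u`: the sum of the `H₁(ℝⁿ)` norms of the functions
representing the sections `weight i * u` in the charts. -/
def SobolevAtlas.sobolevNorm : Seminorm ℂ (SmoothSection n F E) :=
  Seminorm.of
    (fun u => ∑ i, ((eLpNorm (𝒜.piece i u) 2 volume).toReal +
      (eLpNorm (fderiv ℝ (𝒜.piece i u)) 2 volume).toReal))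
    (by
      intro u v
      rw [← Finset.sum_add_distrib]
      refine Finset.sum_le_sum fun i _ => ?_
      have e1 : 𝒜.piece i ((u + v : SmoothSection n F E) : ∀ x, E x) =
        𝒜.piece i u + 𝒜.piece i v := 𝒜.piece_add i u v
      have e2 : fderiv ℝ (𝒜.piece i u + 𝒜.piece i v) =
          fderiv ℝ (𝒜.piece i u) + fderiv ℝ (𝒜.piece i v) := by
        ext1 y
        exact fderiv_add ((𝒜.contDiff_piece i u).differentiable (by simp) y)
          ((𝒜.contDiff_piece i v).differentiable (by simp) y)
      have key : ∀ {V : Type _} [NormedAddCommGroup V] {f g : EuclideanSpace ℝ (Fin n) → V},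
          MemLp f 2 volume → MemLp g 2 volume → (eLpNorm (f + g) 2 volume).toReal ≤
            (eLpNorm f 2 volume).toReal + (eLpNorm g 2 volume).toReal := by
        intro V _ f g hf hg
        rw [← ENNReal.toReal_add hf.2.ne hg.2.ne]
        exact ENNReal.toReal_mono (ENNReal.add_ne_top.2 ⟨hf.2.ne, hg.2.ne⟩)
          (eLpNorm_add_le hf.1 hg.1 (by norm_num))
      have k1 := key (𝒜.memLp_piece i u) (𝒜.memLp_piece i v)
      have k2 := key (𝒜.memLp_fderiv_piece i u) (𝒜.memLp_fderiv_piece i v)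
      rw [e1, e2]
      linarith)
    (by
      intro c u
      rw [Finset.mul_sum]
      refine Finset.sum_congr rfl fun i _ => ?_
      have e1 : 𝒜.piece i ((c • u : SmoothSection n F E) : ∀ x, E x) =
        c • 𝒜.piece i u := 𝒜.piece_smul i c u
      have e2 : fderiv ℝ (c • 𝒜.piece i u) = c • fderiv ℝ (𝒜.piece i u) := by
        ext1 y
        exact fderiv_const_smul ((𝒜.contDiff_piece i u).differentiable (by simp) y) c
      have e3 := eLpNorm_const_smul (p := 2) (μ := volume) c (𝒜.piece i u)
      have e4 := eLpNorm_const_smul (p := 2) (μ := volume) c (fderiv ℝ (𝒜.piece i u))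
      rw [e1, e2, e3, e4]
      simp [mul_add])

/-- Smooth sections of `E`, to be equipped with the Sobolev `H₁` norm. -/
def H1SmoothSection (_𝒜 : SobolevAtlas n F E) : Type _ := SmoothSection n F E

instance : AddCommGroup (H1SmoothSection 𝒜) := inferInstanceAs (AddCommGroup (SmoothSection n F E))

instance : Module ℂ (H1SmoothSection 𝒜) := inferInstanceAs (Module ℂ (SmoothSection n F E))

instance : SeminormedAddCommGroup (H1SmoothSection 𝒜) :=
  AddGroupSeminorm.toSeminormedAddCommGroup (E := H1SmoothSection 𝒜)
    𝒜.sobolevNorm.toAddGroupSeminorm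

instance : NormedSpace ℂ (H1SmoothSection 𝒜) where
  norm_smul_le c u := (map_smul_eq_mul 𝒜.sobolevNorm c (u : SmoothSection n F E)).le

/-- The Sobolev space `H₁(X, E)`: the completion of the space of smooth sections in the
`H₁` norm. -/
abbrev SobolevH1 : Type _ := UniformSpace.Completion (H1SmoothSection 𝒜)

/-- A smooth section as an element of `H₁(X, E)`. -/
def SobolevH1.ofSmooth (u : SmoothSection n F E) : SobolevH1 𝒜 :=
  ((show H1SmoothSection 𝒜 from u : H1SmoothSection 𝒜) : UniformSpace.Completion _)

end Sobolev

/-! ### The direct sum `G ⊕ G` -/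

section DirectSum

variable {n : ℕ} {X : Type*} [TopologicalSpace X] [ChartedSpace (EuclideanSpace ℝ (Fin n)) X]
  {F : Type*} [NormedAddCommGroup F] [NormedSpace ℂ F]
  {G : X → Type*} [TopologicalSpace (TotalSpace F G)] [∀ x, TopologicalSpace (G x)]
  [∀ x, AddCommGroup (G x)] [∀ x, Module ℂ (G x)] [FiberBundle F G]
  [VectorBundle ℝ F G] [VectorBundle ℂ F G]

theorem isSmoothSection_prod_iff (u : ∀ x, (G ×ᵇ G) x) :
    IsSmoothSection n (F × F) (G ×ᵇ G) u ↔
      IsSmoothSection n F G (fun x => (u x).1) ∧ IsSmoothSection n F G (fun x => (u x).2) := by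
  rw [isSmoothSection_iff, isSmoothSection_iff, isSmoothSection_iff, ← forall_and]
  exact forall_congr' fun x₀ => contMDiffAt_prod_module_iff _

/-- The first component of a section of `G ⊕ G`. -/
def SmoothSection.fst (u : SmoothSection n (F × F) (G ×ᵇ G)) : SmoothSection n F G :=
  ⟨fun x => ((u : ∀ x, (G ×ᵇ G) x) x).1, ((isSmoothSection_prod_iff _).1 u.2).1⟩

/-- The second component of a section of `G ⊕ G`. -/
def SmoothSection.snd (u : SmoothSection n (F × F) (G ×ᵇ G)) : SmoothSection n F G :=
  ⟨fun x => ((u : ∀ x, (G ×ᵇ G) x) x).2, ((isSmoothSection_prod_iff _).1 u.2).2⟩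

/-- The section `(u, v)` of `G ⊕ G`. -/
def SmoothSection.pair (u v : SmoothSection n F G) : SmoothSection n (F × F) (G ×ᵇ G) :=
  ⟨fun x => ((u : ∀ x, G x) x, (v : ∀ x, G x) x), (isSmoothSection_prod_iff _).2 ⟨u.2, v.2⟩⟩

/-- The endomorphism `ε (u, v) = (u, -v)` of `G ⊕ G`. -/
def gradingOperator :
    SmoothSection n (F × F) (G ×ᵇ G) →ₗ[ℂ] SmoothSection n (F × F) (G ×ᵇ G) where
  toFun u := SmoothSection.pair (SmoothSection.fst u) (-SmoothSection.snd u)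
  map_add' u v := by
    ext x
    · rfl
    · exact neg_add _ _
  map_smul' c u := by
    ext x
    · rfl
    · exact (smul_neg _ _).symm

/-- `P` is odd with respect to the decomposition `G ⊕ G`: it maps sections of either summand to
sections of the other one. -/
def IsOdd (P : SmoothSection n (F × F) (G ×ᵇ G) →ₗ[ℂ] SmoothSection n (F × F) (G ×ᵇ G)) : Prop :=
  ∀ u : SmoothSection n F G, SmoothSection.fst (P (SmoothSection.pair u 0)) = 0 ∧
    SmoothSection.snd (P (SmoothSection.pair 0 u)) = 0

/-- The Hermitian metric on `G ⊕ G` for which the two summands are orthogonal and carry the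
given metric of `G`. -/
def HermitianMetric.directSum (h : HermitianMetric n F G) :
    HermitianMetric n (F × F) (G ×ᵇ G) where
  form x := LinearMap.mk₂'ₛₗ (starRingEnd ℂ) (RingHom.id ℂ)
    (fun v w => h.form x v.1 w.1 + h.form x v.2 w.2)
    (fun v v' w => by simp; ring)
    (fun c v w => by simp; ring)
    (fun v w w' => by simp; ring)
    (fun c v w => by simp; ring)
  conj_symm x v w := by simp [h.conj_symm]
  pos x v hv := by
    have hnn : ∀ w : G x, 0 ≤ (h.form x w w).re := fun w => by
      by_cases hw : w = 0
      · simp [hw]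
      · exact (h.pos x w hw).le
    change 0 < (h.form x v.1 v.1 + h.form x v.2 v.2).re
    rw [Complex.add_re]
    by_cases h1 : v.1 = 0
    · have h2 : v.2 ≠ 0 := fun h2 => hv (Prod.ext h1 h2)
      exact add_pos_of_nonneg_of_pos (hnn _) (h.pos x _ h2)
    · exact add_pos_of_pos_of_nonneg (h.pos x _ h1) (hnn _)
  smooth u v := (h.smooth (SmoothSection.fst u) (SmoothSection.fst v)).add
    (h.smooth (SmoothSection.snd u) (SmoothSection.snd v))

end DirectSum

end

/-! Write A = P - ε. Since P is odd, ε anticommutes with P. Both operators are symmetric, so ⟨Pu,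
εu⟩ equals minus its own conjugate and has real part zero. Hence ‖Au‖² = ‖Pu‖² + ‖u‖², and in
particular ‖u‖ ≤ ‖Au‖ (`sectionNorm_le_sub_gradingOperator`). Moreover A is again symmetric of first
order, with the same principal symbol as P. Nothing else about P is used: a symmetric elliptic
first-order operator that is bounded below by one induces an isomorphism from H₁ to H₀
(`exists_equiv_of_sectionNorm_le`).

Injectivity and closed range come from the elliptic estimate ‖u‖_{H₁} ≤ C(‖Au‖ + ‖u‖) ≤ 2C‖Au‖
(`SobolevAtlas.exists_sobolevNorm_le`). In a chart it is proved for constant coefficients by the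
Plancherel theorem and the invertibility of the symbol on the unit sphere
(`exists_l2_fderiv_le_of_constant`). Freezing the coefficients in a small ball
(`exists_l2_fderiv_le_near`) and a partition of unity (`exists_l2_fderiv_le`) give the variable
case; the commutators with cutoffs have order zero.

Density of the range needs neither ellipticity nor regularity theory. An element v of H₀ orthogonal
to the range is a weak solution of Av = 0. Let J be the operator that mollifies the pieces of a
section in the charts. By Friedrichs' lemma the commutator AJ - JA is bounded in L², uniformly in
the mollification radius (`exists_l2_commutator_le`,
`SobolevAtlas.IsMargin.exists_sectionNorm_commutator_le`), and it tends to zero strongly. For smooth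
w close to v and fixed J, the weak equation makes JAw small; here the adjoint of J has to preserve
smooth sections (`SobolevAtlas.IsMargin.exists_l2Inner_smoothing_eq`). Then AJw = (AJ - JA)w + JAw
is small, so Jw is small by the lower bound, while Jw is close to w and w to v. Therefore v = 0
(`eq_zero_of_forall_inner_eq_zero`). -/

noncomputable section

/-! ### The `L²` norm of functions -/

section L2Norm

variable {α : Type*} [MeasureSpace α] {V W : Type*} [NormedAddCommGroup V] [NormedAddCommGroup W]

/-- The `L²` norm as a real number. -/
def l2 (f : α → V) : ℝ := (eLpNorm f 2 volume).toReal

theorem l2_nonneg (f : α → V) : 0 ≤ l2 f := ENNReal.toReal_nonneg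

theorem l2_zero : l2 (0 : α → V) = 0 := by simp [l2]

theorem l2_sq {f : α → V} (hf : MemLp f 2 volume) : l2 f ^ 2 = ∫ x, ‖f x‖ ^ 2 := by
  have h := hf.eLpNorm_eq_integral_rpow_norm (by norm_num) (by norm_num)
  have hn : 0 ≤ ∫ x, ‖f x‖ ^ (2 : ℝ) := integral_nonneg fun x => by positivity
  simp only [ENNReal.toReal_ofNat] at h
  rw [l2, h, ENNReal.toReal_ofReal (by positivity), ← Real.rpow_natCast, ← Real.rpow_mul hn]
  simp

theorem eLpNorm_two_eq (f : α → V) :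
    eLpNorm f 2 volume = (∫⁻ x, ‖f x‖ₑ ^ 2) ^ (1 / 2 : ℝ) := by
  rw [eLpNorm_eq_lintegral_rpow_enorm_toReal (by norm_num) (by norm_num)]
  simp

theorem l2_add_le {f g : α → V} (hf : MemLp f 2 volume) (hg : MemLp g 2 volume) :
    l2 (f + g) ≤ l2 f + l2 g := by
  unfold l2
  rw [← ENNReal.toReal_add hf.2.ne hg.2.ne]
  exact ENNReal.toReal_mono (ENNReal.add_ne_top.2 ⟨hf.2.ne, hg.2.ne⟩)
    (eLpNorm_add_le hf.1 hg.1 (by norm_num))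

theorem l2_sum_le {ι : Type*} (s : Finset ι) {f : ι → α → V}
    (hf : ∀ i ∈ s, MemLp (f i) 2 volume) : l2 (∑ i ∈ s, f i) ≤ ∑ i ∈ s, l2 (f i) := by
  unfold l2
  rw [← ENNReal.toReal_sum fun i hi => (hf i hi).2.ne]
  exact ENNReal.toReal_mono (ENNReal.sum_ne_top.2 fun i hi => (hf i hi).2.ne)
    (eLpNorm_sum_le (fun i hi => (hf i hi).1) (by norm_num))

theorem memLp_sum {ι : Type*} (s : Finset ι) {f : ι → α → V}
    (hf : ∀ i ∈ s, MemLp (f i) 2 volume) : MemLp (∑ i ∈ s, f i) 2 volume :=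
  memLp_finsetSum' s hf

theorem l2_le_of_norm_le {f : α → V} {g : α → W} (hg : MemLp g 2 volume) {c : ℝ} (hc : 0 ≤ c)
    (h : ∀ x, ‖f x‖ ≤ c * ‖g x‖) : l2 f ≤ c * l2 g := by
  have h1 := eLpNorm_le_mul_eLpNorm_of_ae_le_mul (μ := (volume : Measure α))
    (Filter.Eventually.of_forall h) 2
  unfold l2
  rw [← ENNReal.toReal_ofReal hc, ← ENNReal.toReal_mul]
  exact ENNReal.toReal_mono (ENNReal.mul_ne_top ENNReal.ofReal_ne_top hg.2.ne) h1

theorem l2_norm (f : α → V) : l2 (fun x => ‖f x‖) = l2 f := by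
  simp [l2, eLpNorm_norm]

theorem l2_const_smul {𝕜 : Type*} [NormedField 𝕜] [NormedSpace 𝕜 V] (c : 𝕜) (f : α → V) :
    l2 (c • f) = ‖c‖ * l2 f := by
  simp [l2, eLpNorm_const_smul]

/-- A pointwise bound by a linear combination of two norms gives the bound of the `L²` norms. -/
theorem l2_le_of_norm_le_add {V' : Type*} [NormedAddCommGroup V'] {f : α → V} {g : α → W}
    {g' : α → V'} (hg : MemLp g 2 volume) (hg' : MemLp g' 2 volume) {c c' : ℝ} (hc : 0 ≤ c)
    (hc' : 0 ≤ c') (h : ∀ x, ‖f x‖ ≤ c * ‖g x‖ + c' * ‖g' x‖) :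
    l2 f ≤ c * l2 g + c' * l2 g' := by
  have m1 : MemLp (c • fun x => ‖g x‖) 2 volume := hg.norm.const_smul c
  have m2 : MemLp (c' • fun x => ‖g' x‖) 2 volume := hg'.norm.const_smul c'
  have h1 : l2 f ≤ 1 * l2 ((c • fun x => ‖g x‖) + (c' • fun x => ‖g' x‖)) :=
    l2_le_of_norm_le (m1.add m2) zero_le_one fun x => by
      have := h x
      simp only [Pi.add_apply, Pi.smul_apply, smul_eq_mul, one_mul]
      exact this.trans (le_abs_self _)
  have h2 := l2_add_le m1 m2
  rw [l2_const_smul, l2_const_smul, l2_norm, l2_norm, Real.norm_of_nonneg hc,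
    Real.norm_of_nonneg hc'] at h2
  linarith

end L2Norm

/-! ### Young's inequality -/

section Young

variable {D : Type*} [NormedAddCommGroup D] [MeasureSpace D] [BorelSpace D]
  [SecondCountableTopology D]
  [(volume : Measure D).IsAddHaarMeasure] [(volume : Measure D).IsNegInvariant] [SFinite (volume : Measure D)]
  {V W : Type*} [NormedAddCommGroup V] [NormedAddCommGroup W]

/-- Cauchy–Schwarz for the product of `k ^ (1/2)` and `k ^ (1/2) * u`. -/
theorem lintegral_sq_mul_le (k u : D → ENNReal) (hk : Measurable k) (hu : Measurable u) :
    (∫⁻ y, k y * u y) ^ 2 ≤ (∫⁻ y, k y) * ∫⁻ y, k y * u y ^ 2 := by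
  have h := ENNReal.lintegral_mul_le_Lp_mul_Lq (volume : Measure D)
    (Real.HolderConjugate.two_two) (f := fun y => k y ^ (1 / 2 : ℝ))
    (g := fun y => k y ^ (1 / 2 : ℝ) * u y) (hk.pow_const _).aemeasurable
    ((hk.pow_const _).mul hu).aemeasurable
  have e1 : ∀ t : ENNReal, t ^ (1 / 2 : ℝ) * t ^ (1 / 2 : ℝ) = t := fun t => by
    rw [← ENNReal.rpow_add_of_nonneg _ _ (by norm_num) (by norm_num)]; norm_num
  have e2 : ∀ t : ENNReal, (t ^ (1 / 2 : ℝ)) ^ (2 : ℝ) = t := fun t => by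
    rw [← ENNReal.rpow_mul]; norm_num
  have e3 : ∀ t : ENNReal, (t ^ (1 / 2 : ℝ)) ^ 2 = t := fun t => by
    rw [sq, e1]
  simp only [Pi.mul_apply, ← mul_assoc, e1, e2, ENNReal.mul_rpow_of_nonneg _ _ zero_le_two,
    ENNReal.rpow_two] at h
  calc (∫⁻ y, k y * u y) ^ 2
      ≤ ((∫⁻ y, k y) ^ (1 / 2 : ℝ) * (∫⁻ y, k y * u y ^ 2) ^ (1 / 2 : ℝ)) ^ 2 := by gcongr
    _ = _ := by rw [mul_pow, e3, e3]

/-- The weighted Cauchy–Schwarz inequality is applied for each `x`; Tonelli and the invariance of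
the measure under translation and reflection then turn both remaining integrals of `k` into its
total mass. Values in `ENNReal` avoid all integrability questions. -/
theorem lintegral_convolution_sq_le (k u : D → ENNReal) (hk : Measurable k) (hu : Measurable u) :
    ∫⁻ x, (∫⁻ y, k (x - y) * u y) ^ 2 ≤ (∫⁻ y, k y) ^ 2 * ∫⁻ y, u y ^ 2 := by
  have hm : Measurable fun p : D × D => k (p.1 - p.2) * u p.2 ^ 2 :=
    (hk.comp measurable_sub).mul ((hu.comp measurable_snd).pow_const 2)
  calc ∫⁻ x, (∫⁻ y, k (x - y) * u y) ^ 2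
      ≤ ∫⁻ x, (∫⁻ y, k (x - y)) * ∫⁻ y, k (x - y) * u y ^ 2 :=
        lintegral_mono fun x => lintegral_sq_mul_le _ _
          (hk.comp (measurable_const.sub measurable_id)) hu
    _ = ∫⁻ x, (∫⁻ y, k y) * ∫⁻ y, k (x - y) * u y ^ 2 := by
        refine lintegral_congr fun x => ?_
        rw [lintegral_sub_left_eq_self k x]
    _ = (∫⁻ y, k y) * ∫⁻ x, ∫⁻ y, k (x - y) * u y ^ 2 := by
        rw [lintegral_const_mul _ hm.lintegral_prod_right']
    _ = (∫⁻ y, k y) * ∫⁻ y, ∫⁻ x, k (x - y) * u y ^ 2 := by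
        rw [lintegral_lintegral_swap hm.aemeasurable]
    _ = (∫⁻ y, k y) * ∫⁻ y, (∫⁻ x, k x) * u y ^ 2 := by
        congr 1
        refine lintegral_congr fun y => ?_
        have hky : Measurable fun x => k (x - y) := hk.comp (measurable_id.sub_const y)
        rw [lintegral_mul_const _ hky, lintegral_sub_right_eq_self k]
    _ = _ := by rw [lintegral_const_mul _ (hu.pow_const 2), ← mul_assoc, sq]

/-- A function dominated by the convolution of a nonnegative integrable kernel with the norm of
a square integrable function is bounded in the `L²` norm. -/
theorem l2_le_of_norm_le_convolution {f : D → V} {g : D → W} {k : D → ℝ}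
    (hg : MemLp g 2 volume) (hgc : Continuous g) (hk : Continuous k) (hk0 : ∀ x, 0 ≤ k x)
    (hki : Integrable k) (h : ∀ x, ‖f x‖ ≤ ∫ y, k (x - y) * ‖g y‖) :
    l2 f ≤ (∫ y, k y) * l2 g := by
  have key := lintegral_convolution_sq_le (fun x => ENNReal.ofReal (k x)) (fun y => ‖g y‖ₑ)
    hk.measurable.ennreal_ofReal hgc.enorm.measurable
  have e1 : ∫⁻ y, ENNReal.ofReal (k y) = ENNReal.ofReal (∫ y, k y) :=
    (ofReal_integral_eq_lintegral_ofReal hki (Filter.Eventually.of_forall hk0)).symm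
  have e3 : ∀ x, ‖f x‖ₑ ≤ ∫⁻ y, ENNReal.ofReal (k (x - y)) * ‖g y‖ₑ := by
    intro x
    rw [← ofReal_norm]
    refine (ENNReal.ofReal_le_ofReal (h x)).trans ?_
    -- If the integrand is not integrable, the Bochner integral is zero by convention, so the
    -- hypothesis forces `f x = 0`.
    by_cases hi : Integrable fun y => k (x - y) * ‖g y‖
    · rw [ofReal_integral_eq_lintegral_ofReal hi
        (Filter.Eventually.of_forall fun y => mul_nonneg (hk0 _) (norm_nonneg _))]
      refine le_of_eq (lintegral_congr fun y => ?_)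
      rw [ENNReal.ofReal_mul (hk0 _), ofReal_norm]
    · simp [integral_undef hi]
  have hb : eLpNorm f 2 volume ≤ ENNReal.ofReal (∫ y, k y) * eLpNorm g 2 volume := by
    rw [eLpNorm_two_eq, eLpNorm_two_eq]
    calc (∫⁻ x, ‖f x‖ₑ ^ 2) ^ (1 / 2 : ℝ)
        ≤ (∫⁻ x, (∫⁻ y, ENNReal.ofReal (k (x - y)) * ‖g y‖ₑ) ^ 2) ^ (1 / 2 : ℝ) := by
          gcongr with x; exact e3 x
      _ ≤ ((∫⁻ y, ENNReal.ofReal (k y)) ^ 2 * ∫⁻ y, ‖g y‖ₑ ^ 2) ^ (1 / 2 : ℝ) := by gcongr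
      _ = _ := by
          rw [ENNReal.mul_rpow_of_nonneg _ _ (by norm_num), e1, ← ENNReal.rpow_two,
            ← ENNReal.rpow_mul]
          norm_num
  have hi0 : 0 ≤ ∫ y, k y := integral_nonneg hk0
  unfold l2
  rw [← ENNReal.toReal_ofReal hi0, ← ENNReal.toReal_mul]
  exact ENNReal.toReal_mono (ENNReal.mul_ne_top ENNReal.ofReal_ne_top hg.2.ne) hb

end Young

/-! ### Elliptic operators with constant coefficients on `ℝⁿ` -/

section ConstantCoefficients

open SchwartzMap FourierTransform LineDeriv

variable {n : ℕ} {F : Type*} [NormedAddCommGroup F] [NormedSpace ℂ F] [FiniteDimensional ℂ F]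

/-- The inverse of the symbol depends continuously on `ξ` and is therefore bounded on the compact
unit sphere; homogeneity of degree one extends the bound to all `ξ`. -/
theorem exists_symbol_lower_bound (a : Fin n → (F →L[ℂ] F))
    (h : ∀ ξ : EuclideanSpace ℝ (Fin n), ξ ≠ 0 → IsUnit (Complex.I • ∑ j, (ξ j : ℂ) • a j)) :
    ∃ c, 0 ≤ c ∧ ∀ (ξ : EuclideanSpace ℝ (Fin n)) (w : F),
      ‖ξ‖ * ‖w‖ ≤ c * ‖∑ j, (ξ j : ℂ) • a j w‖ := by
  have : CompleteSpace F := FiniteDimensional.complete ℂ F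
  set σ : EuclideanSpace ℝ (Fin n) → (F →L[ℂ] F) := fun ξ => Complex.I • ∑ j, (ξ j : ℂ) • a j
    with hσ
  have hσc : Continuous σ := by
    have hj : ∀ j, Continuous fun ξ : EuclideanSpace ℝ (Fin n) => (ξ j : ℂ) • a j := fun j =>
      (Complex.continuous_ofReal.comp (EuclideanSpace.proj (𝕜 := ℝ) j).continuous).smul
        continuous_const
    exact (continuous_finsetSum Finset.univ fun j _ => hj j).const_smul Complex.I
  have hinv : ContinuousOn (fun ξ => Ring.inverse (σ ξ))
      (Metric.sphere (0 : EuclideanSpace ℝ (Fin n)) 1) := by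
    intro ξ hξ
    obtain ⟨s, hs⟩ := h ξ (ne_zero_of_mem_unit_sphere ⟨ξ, hξ⟩)
    have h1 := NormedRing.inverse_continuousAt s
    rw [hs] at h1
    exact (ContinuousAt.comp (f := σ) h1 hσc.continuousAt).continuousWithinAt
  obtain ⟨c, hc⟩ := (isCompact_sphere _ _).exists_bound_of_continuousOn hinv
  -- For `n = 0` the sphere is empty and `c` is an arbitrary real number, hence the maximum with
  -- zero.
  refine ⟨max c 0, le_max_right _ _, fun ξ w => ?_⟩
  by_cases h0 : ξ = 0
  · subst h0
    simp
  have hpos : 0 < ‖ξ‖ := norm_pos_iff.2 h0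
  set η := ‖ξ‖⁻¹ • ξ with hη
  have hη1 : η ∈ Metric.sphere (0 : EuclideanSpace ℝ (Fin n)) 1 := by
    simp [hη, norm_smul, hpos.ne']
  have hu := h η (ne_zero_of_mem_unit_sphere ⟨η, hη1⟩)
  have e1 : w = Ring.inverse (σ η) (σ η w) := by
    have := Ring.inverse_mul_cancel _ hu
    exact (DFunLike.congr_fun this w).symm
  have e2 : σ η w = (Complex.I * (‖ξ‖⁻¹ : ℝ)) • ∑ j, (ξ j : ℂ) • a j w := by
    simp only [hσ, hη, smul_apply, sum_apply,
      PiLp.smul_apply, smul_eq_mul, Complex.ofReal_mul, mul_smul, Finset.smul_sum]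
  have e3 : ‖σ η w‖ = ‖ξ‖⁻¹ * ‖∑ j, (ξ j : ℂ) • a j w‖ := by
    rw [e2, norm_smul]
    simp
  have e4 : ‖w‖ ≤ max c 0 * ‖σ η w‖ := by
    conv_lhs => rw [e1]
    exact (ContinuousLinearMap.le_opNorm _ _).trans
      (mul_le_mul_of_nonneg_right ((hc _ hη1).trans (le_max_left _ _)) (norm_nonneg _))
  rw [e3] at e4
  calc ‖ξ‖ * ‖w‖ ≤ ‖ξ‖ * (max c 0 * (‖ξ‖⁻¹ * ‖∑ j, (ξ j : ℂ) • a j w‖)) := by gcongr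
    _ = _ := by field_simp

/-- The Fourier transform is bounded above and below in the `L²` norm. -/
theorem exists_l2_fourier_bound (n : ℕ) (F : Type*) [NormedAddCommGroup F] [NormedSpace ℂ F]
    [FiniteDimensional ℂ F] :
    ∃ C, 0 ≤ C ∧ ∀ f : 𝓢(EuclideanSpace ℝ (Fin n), F),
      l2 f ≤ C * l2 (𝓕 f : 𝓢(EuclideanSpace ℝ (Fin n), F)) ∧
        l2 (𝓕 f : 𝓢(EuclideanSpace ℝ (Fin n), F)) ≤ C * l2 f := by
  have : CompleteSpace F := FiniteDimensional.complete ℂ F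
  -- Plancherel requires an inner product, while the norm of `F` is arbitrary. The inner product is
  -- pulled back along a linear isomorphism `Φ` with a Euclidean space; the price is the constant `B
  -- * A`, the product of the norms of the inverse and of `Φ`.
  let Φ : F ≃L[ℂ] EuclideanSpace ℂ (Fin (Module.finrank ℂ F)) :=
    ContinuousLinearEquiv.ofFinrankEq (by simp)
  let M : F →L⋆[ℂ] F →L[ℂ] ℂ :=
    ((innerSL ℂ).comp (Φ : F →L[ℂ] EuclideanSpace ℂ (Fin (Module.finrank ℂ F)))).flip.comp
      (Φ : F →L[ℂ] EuclideanSpace ℂ (Fin (Module.finrank ℂ F))) |>.flip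
  have hM : ∀ v, M v v = ((‖Φ v‖ ^ 2 : ℝ) : ℂ) := fun v => by
    have := inner_self_eq_norm_sq_to_K (𝕜 := ℂ) (Φ v)
    push_cast
    exact this
  have key : ∀ f : 𝓢(EuclideanSpace ℝ (Fin n), F), l2 (fun x => Φ (𝓕 f x)) =
      l2 (fun x => Φ (f x)) := by
    intro f
    have m : ∀ f : 𝓢(EuclideanSpace ℝ (Fin n), F), MemLp (fun x => Φ (f x)) 2 volume :=
      fun f => (Φ : F →L[ℂ] EuclideanSpace ℂ (Fin (Module.finrank ℂ F))).comp_memLp' (f.memLp 2)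
    have h := integral_sesq_fourier_fourier f f M
    simp_rw [hM] at h
    rw [integral_complex_ofReal, integral_complex_ofReal] at h
    have h' := Complex.ofReal_injective h
    rw [← l2_sq (m _), ← l2_sq (m _)] at h'
    exact (sq_eq_sq₀ (l2_nonneg _) (l2_nonneg _)).1 h'
  set A := ‖(Φ : F →L[ℂ] EuclideanSpace ℂ (Fin (Module.finrank ℂ F)))‖
  set B := ‖(Φ.symm : EuclideanSpace ℂ (Fin (Module.finrank ℂ F)) →L[ℂ] F)‖
  have m : ∀ f : 𝓢(EuclideanSpace ℝ (Fin n), F), MemLp (fun x => Φ (f x)) 2 volume :=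
    fun f => (Φ : F →L[ℂ] EuclideanSpace ℂ (Fin (Module.finrank ℂ F))).comp_memLp' (f.memLp 2)
  have b1 : ∀ f : 𝓢(EuclideanSpace ℝ (Fin n), F), l2 (fun x => Φ (f x)) ≤ A * l2 f :=
    fun f => l2_le_of_norm_le (f.memLp 2) (norm_nonneg _) fun x =>
      (Φ : F →L[ℂ] EuclideanSpace ℂ (Fin (Module.finrank ℂ F))).le_opNorm _
  have b2 : ∀ f : 𝓢(EuclideanSpace ℝ (Fin n), F), l2 f ≤ B * l2 (fun x => Φ (f x)) :=
    fun f => l2_le_of_norm_le (m f) (norm_nonneg _) fun x => by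
      have := (Φ.symm : EuclideanSpace ℂ (Fin (Module.finrank ℂ F)) →L[ℂ] F).le_opNorm (Φ (f x))
      simpa using this
  have hB : 0 ≤ B := norm_nonneg _
  refine ⟨B * A, mul_nonneg hB (norm_nonneg _), fun f => ⟨?_, ?_⟩⟩
  · calc l2 f ≤ B * l2 (fun x => Φ (f x)) := b2 f
      _ = B * l2 (fun x => Φ (𝓕 f x)) := by rw [key]
      _ ≤ B * (A * l2 (𝓕 f : 𝓢(EuclideanSpace ℝ (Fin n), F))) := by gcongr; exact b1 _
      _ = _ := by ring
  · calc l2 (𝓕 f : 𝓢(EuclideanSpace ℝ (Fin n), F)) ≤ B * l2 (fun x => Φ (𝓕 f x)) := b2 _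
      _ = B * l2 (fun x => Φ (f x)) := by rw [key]
      _ ≤ B * (A * l2 f) := by gcongr; exact b1 _
      _ = _ := by ring

theorem fourier_postcompCLM (a : F →L[ℂ] F) (f : 𝓢(EuclideanSpace ℝ (Fin n), F))
    (ξ : EuclideanSpace ℝ (Fin n)) : 𝓕 (postcompCLM a f) ξ = a (𝓕 f ξ) := by
  have : CompleteSpace F := FiniteDimensional.complete ℂ F
  rw [fourier_coe, fourier_coe, Real.fourier_eq, Real.fourier_eq,
    ← ContinuousLinearMap.integral_comp_comm]
  · congr 1 with v
    simp [Circle.smul_def]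
  · exact (Real.fourierIntegral_convergent_iff ξ).2 f.integrable

theorem norm_le_sum_norm_apply_single {W : Type*} [NormedAddCommGroup W] [NormedSpace ℝ W]
    (T : EuclideanSpace ℝ (Fin n) →L[ℝ] W) : ‖T‖ ≤ ∑ j, ‖T (EuclideanSpace.single j 1)‖ := by
  refine T.opNorm_le_bound (Finset.sum_nonneg fun _ _ => norm_nonneg _) fun y => ?_
  have hy : y = ∑ j, y j • EuclideanSpace.single j (1 : ℝ) := by
    ext i
    simp [Pi.single_apply]
  calc ‖T y‖ = ‖∑ j, y j • T (EuclideanSpace.single j (1 : ℝ))‖ := by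
        conv_lhs => rw [hy]
        simp
    _ ≤ ∑ j, ‖T (EuclideanSpace.single j (1 : ℝ))‖ * ‖y‖ := by
        refine (norm_sum_le _ _).trans (Finset.sum_le_sum fun j _ => ?_)
        rw [norm_smul, mul_comm]
        gcongr
        exact PiLp.norm_apply_le y j
    _ = _ := by rw [Finset.sum_mul]

theorem memLp_fderiv {W : Type*} [NormedAddCommGroup W] [NormedSpace ℝ W]
    {g : EuclideanSpace ℝ (Fin n) → W} (hg : ContDiff ℝ ∞ g)
    (hc : HasCompactSupport g) : MemLp (fderiv ℝ g) 2 volume :=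
  (hg.continuous_fderiv (by simp)).memLp_of_hasCompactSupport (hc.fderiv (𝕜 := ℝ))

theorem memLp_fderiv_apply {W : Type*} [NormedAddCommGroup W] [NormedSpace ℝ W]
    {g : EuclideanSpace ℝ (Fin n) → W} (hg : ContDiff ℝ ∞ g)
    (hc : HasCompactSupport g) (v : EuclideanSpace ℝ (Fin n)) :
    MemLp (fun y => fderiv ℝ g y v) 2 volume :=
  ((hg.continuous_fderiv (by simp)).clm_apply continuous_const).memLp_of_hasCompactSupport
    (hc.fderiv_apply (𝕜 := ℝ) v)

theorem l2_fderiv_le_sum {W : Type*} [NormedAddCommGroup W] [NormedSpace ℝ W]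
    {g : EuclideanSpace ℝ (Fin n) → W} (hg : ContDiff ℝ ∞ g) (hc : HasCompactSupport g) :
    l2 (fderiv ℝ g) ≤ ∑ j, l2 (fun y => fderiv ℝ g y (EuclideanSpace.single j 1)) := by
  let G : Fin n → EuclideanSpace ℝ (Fin n) → ℝ :=
    fun j y => ‖fderiv ℝ g y (EuclideanSpace.single j 1)‖
  have m : ∀ j ∈ Finset.univ, MemLp (G j) 2 volume :=
    fun j _ => (memLp_fderiv_apply hg hc _).norm
  have hG : ∀ j, l2 (G j) = l2 (fun y => fderiv ℝ g y (EuclideanSpace.single j 1)) :=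
    fun j => l2_norm _
  have h := l2_sum_le Finset.univ m
  have h' : l2 (fderiv ℝ g) ≤ 1 * l2 (∑ j, G j) := by
    refine l2_le_of_norm_le (memLp_sum Finset.univ m) zero_le_one fun y => ?_
    rw [one_mul, Finset.sum_apply]
    exact (norm_le_sum_norm_apply_single _).trans (le_abs_self _)
  rw [one_mul] at h'
  exact (h'.trans h).trans (le_of_eq (Finset.sum_congr rfl fun j _ => hG j))

/-- The elliptic estimate for first-order operators with constant coefficients. -/
theorem exists_l2_fderiv_le_of_constant (a : Fin n → (F →L[ℂ] F))
    (h : ∀ ξ : EuclideanSpace ℝ (Fin n), ξ ≠ 0 → IsUnit (Complex.I • ∑ j, (ξ j : ℂ) • a j)) :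
    ∃ c, 0 ≤ c ∧ ∀ g : EuclideanSpace ℝ (Fin n) → F, ContDiff ℝ ∞ g → HasCompactSupport g →
      l2 (fderiv ℝ g) ≤
        c * l2 (fun y => ∑ j, a j (fderiv ℝ g y (EuclideanSpace.single j 1))) := by
  obtain ⟨c, hc0, hc⟩ := exists_symbol_lower_bound a h
  obtain ⟨C, hC0, hC⟩ := exists_l2_fourier_bound n F
  -- One term for each of the `n` partial derivatives; each is taken to the Fourier side and back
  -- (two factors `C`), where the symbol bound contributes `c`.
  refine ⟨n * (C * (c * C)), by positivity, fun g hg hgc => ?_⟩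
  let f : 𝓢(EuclideanSpace ℝ (Fin n), F) := hgc.toSchwartzMap hg
  let f' : Fin n → 𝓢(EuclideanSpace ℝ (Fin n), F) := fun j => ∂_{EuclideanSpace.single j (1 : ℝ)} f
  let T : 𝓢(EuclideanSpace ℝ (Fin n), F) := ∑ j, postcompCLM (a j) (f' j)
  have hf' : ∀ j y, f' j y = fderiv ℝ g y (EuclideanSpace.single j 1) := fun j y => rfl
  have hT : (T : EuclideanSpace ℝ (Fin n) → F) =
      fun y => ∑ j, a j (fderiv ℝ g y (EuclideanSpace.single j 1)) := by
    ext y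
    simp [T, hf']
  -- The factor `2πi` occurs both for the single derivatives and for the operator `T`, so it does
  -- not affect the constant.
  have hF' : ∀ j ξ, 𝓕 (f' j) ξ = (2 * Real.pi * Complex.I) • (ξ j : ℂ) • 𝓕 f ξ := by
    intro j ξ
    have ht : (inner ℝ · (EuclideanSpace.single j (1 : ℝ)) :
      EuclideanSpace ℝ (Fin n) → ℝ).HasTemperateGrowth := by fun_prop
    simp only [f']
    rw [fourier_lineDerivOp_eq, smul_apply, smulLeftCLM_apply_apply ht]
    congr 1
    have hin : inner ℝ ξ (EuclideanSpace.single j (1 : ℝ)) = ξ j := by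
      simpa using EuclideanSpace.inner_single_right (𝕜 := ℝ) j (1 : ℝ) ξ
    rw [hin, Complex.coe_smul]
  have hFT : ∀ ξ, 𝓕 T ξ = (2 * Real.pi * Complex.I) • ∑ j, (ξ j : ℂ) • a j (𝓕 f ξ) := by
    intro ξ
    have : 𝓕 T = ∑ j, 𝓕 (postcompCLM (a j) (f' j)) :=
      map_sum (fourierCLM ℂ (𝓢(EuclideanSpace ℝ (Fin n), F))) _ _
    rw [this, sum_apply, Finset.smul_sum]
    refine Finset.sum_congr rfl fun j _ => ?_
    rw [fourier_postcompCLM, hF', map_smul, map_smul]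
  have h1 : ∀ j, l2 (f' j) ≤ C * (c * C) * l2 T := by
    intro j
    have : l2 (𝓕 (f' j) : 𝓢(EuclideanSpace ℝ (Fin n), F)) ≤
        c * l2 (𝓕 T : 𝓢(EuclideanSpace ℝ (Fin n), F)) := by
      refine l2_le_of_norm_le ((𝓕 T : 𝓢(EuclideanSpace ℝ (Fin n), F)).memLp 2) hc0 fun ξ => ?_
      rw [hF', hFT, norm_smul, norm_smul, norm_smul]
      have h2 := hc ξ (𝓕 f ξ)
      have h3 : ‖(ξ j : ℂ)‖ ≤ ‖ξ‖ := by
        rw [Complex.norm_real]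
        exact PiLp.norm_apply_le ξ j
      calc ‖(2 * Real.pi * Complex.I : ℂ)‖ * (‖(ξ j : ℂ)‖ * ‖𝓕 f ξ‖)
          ≤ ‖(2 * Real.pi * Complex.I : ℂ)‖ * (c * ‖∑ j, (ξ j : ℂ) • a j (𝓕 f ξ)‖) :=
            mul_le_mul_of_nonneg_left
              ((mul_le_mul_of_nonneg_right h3 (norm_nonneg _)).trans h2) (norm_nonneg _)
        _ = _ := by ring
    calc l2 (f' j) ≤ C * l2 (𝓕 (f' j) : 𝓢(EuclideanSpace ℝ (Fin n), F)) := (hC _).1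
      _ ≤ C * (c * (C * l2 T)) := by
          gcongr
          exact this.trans (by gcongr; exact (hC _).2)
      _ = _ := by ring
  rw [← hT]
  calc l2 (fderiv ℝ g) ≤ ∑ j, l2 (f' j) := l2_fderiv_le_sum hg hgc
    _ ≤ ∑ _j : Fin n, C * (c * C) * l2 T := Finset.sum_le_sum fun j _ => h1 j
    _ = _ := by simp; ring

end ConstantCoefficients

/-! ### First-order operators with variable coefficients on `ℝⁿ` -/

section LocalOperators

variable {n : ℕ} {F : Type*} [NormedAddCommGroup F] [NormedSpace ℂ F]

/-- The operator `∑ j, a j * ∂/∂y_j + b`. -/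
def localOp (a : Fin n → EuclideanSpace ℝ (Fin n) → (F →L[ℂ] F))
    (b : EuclideanSpace ℝ (Fin n) → (F →L[ℂ] F)) (g : EuclideanSpace ℝ (Fin n) → F)
    (y : EuclideanSpace ℝ (Fin n)) : F :=
  ∑ j, a j y (fderiv ℝ g y (EuclideanSpace.single j 1)) + b y (g y)

/-- The matrix-valued function `∑ j, ∂ζ/∂y_j * a j`, which is the commutator of
`∑ j, a j * ∂/∂y_j + b` with the multiplication by `ζ`. -/
def symbolOf (a : Fin n → EuclideanSpace ℝ (Fin n) → (F →L[ℂ] F))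
    (ζ : EuclideanSpace ℝ (Fin n) → ℝ) (y : EuclideanSpace ℝ (Fin n)) : F →L[ℂ] F :=
  ∑ j, fderiv ℝ ζ y (EuclideanSpace.single j 1) • a j y

variable {a : Fin n → EuclideanSpace ℝ (Fin n) → (F →L[ℂ] F)}
  {b : EuclideanSpace ℝ (Fin n) → (F →L[ℂ] F)} {g : EuclideanSpace ℝ (Fin n) → F}
  {U : Set (EuclideanSpace ℝ (Fin n))}

theorem fderiv_eq_zero_of_notMem_tsupport {W : Type*} [NormedAddCommGroup W] [NormedSpace ℝ W]
    {f : EuclideanSpace ℝ (Fin n) → W} {y : EuclideanSpace ℝ (Fin n)} (hy : y ∉ tsupport f) :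
    fderiv ℝ f y = 0 := by
  have h : f =ᶠ[nhds y] fun _ => 0 := notMem_tsupport_iff_eventuallyEq.1 hy
  rw [h.fderiv_eq]
  simp

theorem localOp_eq_zero {y : EuclideanSpace ℝ (Fin n)} (hy : y ∉ tsupport g) :
    localOp a b g y = 0 := by
  simp [localOp, fderiv_eq_zero_of_notMem_tsupport hy, image_eq_zero_of_notMem_tsupport hy]

theorem tsupport_localOp_subset : tsupport (localOp a b g) ⊆ tsupport g :=
  closure_minimal (fun _ hy => by_contra fun h => hy (localOp_eq_zero h)) (isClosed_tsupport _)

/-- A function which is smooth on an open set containing its support is smooth. -/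
theorem contDiff_of_tsupport_subset {W : Type*} [NormedAddCommGroup W] [NormedSpace ℝ W]
    {f : EuclideanSpace ℝ (Fin n) → W} (hU : IsOpen U) (hf : ContDiffOn ℝ ∞ f U)
    (hs : tsupport f ⊆ U) : ContDiff ℝ ∞ f := by
  rw [contDiff_iff_contDiffAt]
  intro y
  by_cases hy : y ∈ tsupport f
  · exact hf.contDiffAt (hU.mem_nhds (hs hy))
  · exact contDiffAt_const.congr_of_eventuallyEq (notMem_tsupport_iff_eventuallyEq.1 hy)

/-- The fibers are complex, but smoothness is always meant over `ℝ`; evaluation of complex linear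
maps is therefore needed as a real bilinear map. -/
theorem isBoundedBilinearMap_apply_real (W : Type*) [NormedAddCommGroup W] [NormedSpace ℂ W] :
    IsBoundedBilinearMap ℝ (fun p : (F →L[ℂ] W) × F => p.1 p.2) where
  add_left := fun _ _ _ => rfl
  smul_left := fun _ _ _ => rfl
  add_right := fun f _ _ => map_add f _ _
  smul_right := fun c f x => by
    rw [← Complex.coe_smul, map_smul, Complex.coe_smul]
  bound := ⟨1, one_pos, fun f x => by simpa using f.le_opNorm x⟩

theorem ContDiffOn.clm_apply_complex {W : Type*} [NormedAddCommGroup W] [NormedSpace ℂ W]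
    {f : EuclideanSpace ℝ (Fin n) → (F →L[ℂ] W)}
    {u : EuclideanSpace ℝ (Fin n) → F} (hf : ContDiffOn ℝ ∞ f U) (hu : ContDiffOn ℝ ∞ u U) :
    ContDiffOn ℝ ∞ (fun y => f y (u y)) U := by
  exact (isBoundedBilinearMap_apply_real W).contDiff.comp_contDiffOn (hf.prodMk hu)

theorem ContDiff.clm_apply_complex {W : Type*} [NormedAddCommGroup W] [NormedSpace ℂ W]
    {f : EuclideanSpace ℝ (Fin n) → (F →L[ℂ] W)}
    {u : EuclideanSpace ℝ (Fin n) → F} (hf : ContDiff ℝ ∞ f) (hu : ContDiff ℝ ∞ u) :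
    ContDiff ℝ ∞ (fun y => f y (u y)) :=
  (isBoundedBilinearMap_apply_real W).contDiff.comp (hf.prodMk hu)

theorem contDiffOn_localOp (hU : IsOpen U) (ha : ∀ j, ContDiffOn ℝ ∞ (a j) U)
    (hb : ContDiffOn ℝ ∞ b U) (hg : ContDiffOn ℝ ∞ g U) :
    ContDiffOn ℝ ∞ (localOp a b g) U := by
  refine ContDiffOn.add (ContDiffOn.sum fun j _ => (ha j).clm_apply_complex ?_)
    (hb.clm_apply_complex hg)
  exact (hg.fderiv_of_isOpen hU (by simp)).clm_apply contDiffOn_const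

theorem contDiff_localOp (hU : IsOpen U) (ha : ∀ j, ContDiffOn ℝ ∞ (a j) U)
    (hb : ContDiffOn ℝ ∞ b U) (hg : ContDiff ℝ ∞ g) (hs : tsupport g ⊆ U) :
    ContDiff ℝ ∞ (localOp a b g) :=
  contDiff_of_tsupport_subset hU (contDiffOn_localOp hU ha hb hg.contDiffOn)
    (tsupport_localOp_subset.trans hs)

theorem HasCompactSupport.localOp (hc : HasCompactSupport g) :
    HasCompactSupport (localOp a b g) :=
  hc.of_isClosed_subset (isClosed_tsupport _) tsupport_localOp_subset

/-- Leibniz rule. The zeroth-order term commutes with real scalar functions, so the commutator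
contains no derivative of `g`. -/
theorem localOp_smul (ζ : EuclideanSpace ℝ (Fin n) → ℝ) {y : EuclideanSpace ℝ (Fin n)}
    (hζ : DifferentiableAt ℝ ζ y) (hg : DifferentiableAt ℝ g y) :
    localOp a b (fun z => ζ z • g z) y = ζ y • localOp a b g y + symbolOf a ζ y (g y) := by
  have hr : ∀ (T : F →L[ℂ] F) (c : ℝ) (v : F), T (c • v) = c • T v := fun T c v => by
    rw [← Complex.coe_smul, map_smul, Complex.coe_smul]
  simp only [localOp, symbolOf, fderiv_fun_smul hζ hg, sum_apply, smul_apply, add_apply,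
    ContinuousLinearMap.smulRight_apply, map_add, hr, Finset.sum_add_distrib, smul_add,
    Finset.smul_sum]
  abel

theorem localOp_congr {f : EuclideanSpace ℝ (Fin n) → F} {y : EuclideanSpace ℝ (Fin n)}
    (h : f =ᶠ[nhds y] g) : localOp a b f y = localOp a b g y := by
  simp only [localOp, h.fderiv_eq, h.eq_of_nhds]

theorem norm_sum_apply_fderiv_le (T : Fin n → (F →L[ℂ] F))
    (A : EuclideanSpace ℝ (Fin n) →L[ℝ] F) :
    ‖∑ j, T j (A (EuclideanSpace.single j 1))‖ ≤ (∑ j, ‖T j‖) * ‖A‖ := by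
  rw [Finset.sum_mul]
  refine (norm_sum_le _ _).trans (Finset.sum_le_sum fun j _ => ?_)
  refine ((T j).le_opNorm _).trans (mul_le_mul_of_nonneg_left ?_ (norm_nonneg _))
  simpa using A.le_opNorm (EuclideanSpace.single j 1)

theorem norm_symbolOf_le (ζ : EuclideanSpace ℝ (Fin n) → ℝ) (y : EuclideanSpace ℝ (Fin n)) :
    ‖symbolOf a ζ y‖ ≤ ‖fderiv ℝ ζ y‖ * ∑ j, ‖a j y‖ := by
  rw [Finset.mul_sum]
  refine (norm_sum_le _ _).trans (Finset.sum_le_sum fun j _ => ?_)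
  rw [norm_smul]
  gcongr
  simpa using (fderiv ℝ ζ y).le_opNorm (EuclideanSpace.single j 1)

theorem exists_bound_of_isCompact {W : Type*} [NormedAddCommGroup W]
    {f : EuclideanSpace ℝ (Fin n) → W} {K : Set (EuclideanSpace ℝ (Fin n))} (hK : IsCompact K)
    (hf : ContinuousOn f K) : ∃ B, 0 ≤ B ∧ ∀ y ∈ K, ‖f y‖ ≤ B := by
  obtain ⟨B, hB⟩ := hK.exists_bound_of_continuousOn hf
  exact ⟨max B 0, le_max_right _ _, fun y hy => (hB y hy).trans (le_max_left _ _)⟩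

theorem memLp_of_contDiff {W : Type*} [NormedAddCommGroup W] [NormedSpace ℝ W]
    {f : EuclideanSpace ℝ (Fin n) → W} (hf : ContDiff ℝ ∞ f) (hc : HasCompactSupport f) :
    MemLp f 2 volume :=
  hf.continuous.memLp_of_hasCompactSupport hc

/-- A finite smooth partition of unity on a compact set. -/
theorem exists_finite_partition {K : Set (EuclideanSpace ℝ (Fin n))} (hK : IsCompact K)
    (V : EuclideanSpace ℝ (Fin n) → Set (EuclideanSpace ℝ (Fin n))) (hV : ∀ i, IsOpen (V i))
    (hKV : ∀ y ∈ K, y ∈ V y) :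
    ∃ (s : Finset (EuclideanSpace ℝ (Fin n)))
      (ζ : EuclideanSpace ℝ (Fin n) → EuclideanSpace ℝ (Fin n) → ℝ),
      (∀ i, ContDiff ℝ ∞ (ζ i)) ∧ (∀ i, tsupport (ζ i) ⊆ V i) ∧
      ∀ y ∈ K, ∑ i ∈ s, ζ i y = 1 := by
  obtain ⟨f, hf⟩ := SmoothPartitionOfUnity.exists_isSubordinate 𝓘(ℝ, EuclideanSpace ℝ (Fin n))
    hK.isClosed V hV fun y hy => Set.mem_iUnion_of_mem y (hKV y hy)
  have hfin := f.locallyFinite.finite_nonempty_inter_compact hK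
  refine ⟨hfin.toFinset, fun i => f i, fun i => (f i).contMDiff.contDiff, hf, fun y hy => ?_⟩
  rw [← f.sum_eq_one hy]
  refine (finsum_eq_sum_of_support_subset _ fun i hi => ?_).symm
  exact hfin.mem_toFinset.2 ⟨y, hi, hy⟩

variable [FiniteDimensional ℂ F]

/-- The elliptic estimate for functions supported near a point. -/
theorem exists_l2_fderiv_le_near (hU : IsOpen U) (ha : ∀ j, ContDiffOn ℝ ∞ (a j) U)
    (hb : ContDiffOn ℝ ∞ b U)
    (hell : ∀ y ∈ U, ∀ ξ : EuclideanSpace ℝ (Fin n), ξ ≠ 0 → IsUnit (principalSymbol a y ξ))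
    {y₀ : EuclideanSpace ℝ (Fin n)} (hy₀ : y₀ ∈ U) :
    ∃ r C, 0 < r ∧ 0 ≤ C ∧ Metric.ball y₀ r ⊆ U ∧ ∀ g : EuclideanSpace ℝ (Fin n) → F,
      ContDiff ℝ ∞ g → HasCompactSupport g → tsupport g ⊆ Metric.ball y₀ r →
        l2 (fderiv ℝ g) ≤ C * (l2 (localOp a b g) + l2 g) := by
  obtain ⟨c, hc0, hc⟩ := exists_l2_fderiv_le_of_constant (fun j => a j y₀) (hell y₀ hy₀)
  have hcont : ∀ j, ContinuousAt (a j) y₀ := fun j => (ha j).continuousOn.continuousAt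
    (hU.mem_nhds hy₀)
  -- The oscillation of the leading coefficients is made so small that, multiplied by the constant
  -- `c` of the frozen operator, it is at most `1/2`. The `+ 1` keeps the threshold meaningful for
  -- `c = 0`.
  have h1 : ∀ᶠ y in nhds y₀, ∑ j, ‖a j y₀ - a j y‖ < (2 * (c + 1))⁻¹ := by
    have : ContinuousAt (fun y => ∑ j, ‖a j y₀ - a j y‖) y₀ :=
      tendsto_finsetSum _ fun j _ => (continuousAt_const.sub (hcont j)).norm
    refine this.eventually (gt_mem_nhds ?_)
    simp only [sub_self, norm_zero, Finset.sum_const_zero]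
    positivity
  have h2 : ∀ᶠ y in nhds y₀, ‖b y‖ < ‖b y₀‖ + 1 :=
    (hb.continuousOn.continuousAt (hU.mem_nhds hy₀)).norm.eventually (gt_mem_nhds (by simp))
  obtain ⟨r, hr, hball⟩ := Metric.eventually_nhds_iff_ball.1
    ((h1.and h2).and (hU.mem_nhds hy₀))
  refine ⟨r, 2 * c * (‖b y₀‖ + 2), hr, by positivity, fun y hy => (hball y hy).2,
    fun g hg hgc hs => ?_⟩
  have hsU : tsupport g ⊆ U := fun y hy => (hball y (hs hy)).2
  set B := ‖b y₀‖ + 1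
  have hB : 0 ≤ B := by positivity
  set ε := (2 * (c + 1))⁻¹ with hε
  have hε0 : 0 ≤ ε := by positivity
  have mA : MemLp (localOp a b g) 2 volume :=
    memLp_of_contDiff (contDiff_localOp hU ha hb hg hsU) hgc.localOp
  have mg := memLp_of_contDiff hg hgc
  have mA' : MemLp (fun y => ‖localOp a b g y‖ + B * ‖g y‖) 2 volume :=
    mA.norm.add (mg.norm.const_mul B)
  have hp : ∀ y, ‖∑ j, a j y₀ (fderiv ℝ g y (EuclideanSpace.single j 1))‖ ≤
      1 * ‖(‖localOp a b g y‖ + B * ‖g y‖)‖ + ε * ‖fderiv ℝ g y‖ := by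
    intro y
    rw [Real.norm_of_nonneg (by positivity), one_mul]
    by_cases hy : y ∈ tsupport g
    · have hyb := (hball y (hs hy)).1
      -- Freezing the coefficients: the operator at `y₀` is the given one minus its zeroth-order
      -- term plus a small first-order error.
      have e : ∑ j, a j y₀ (fderiv ℝ g y (EuclideanSpace.single j 1)) =
          localOp a b g y - b y (g y) +
            ∑ j, (a j y₀ - a j y) (fderiv ℝ g y (EuclideanSpace.single j 1)) := by
        simp [localOp, Finset.sum_sub_distrib]
      rw [e]
      refine (norm_add_le _ _).trans (add_le_add ((norm_sub_le _ _).trans ?_) ?_)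
      · gcongr
        exact ((b y).le_opNorm _).trans (mul_le_mul_of_nonneg_right hyb.2.le (norm_nonneg _))
      · exact (norm_sum_apply_fderiv_le (fun j => a j y₀ - a j y) _).trans
          (mul_le_mul_of_nonneg_right hyb.1.le (norm_nonneg _))
    · simp only [fderiv_eq_zero_of_notMem_tsupport hy, zero_apply, map_zero,
        Finset.sum_const_zero, norm_zero]
      positivity
  have k1 := l2_le_of_norm_le_add mA' (memLp_fderiv hg hgc) zero_le_one hε0 hp
  have k2 : l2 (fun y => ‖localOp a b g y‖ + B * ‖g y‖) ≤ 1 * l2 (localOp a b g) + B * l2 g :=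
    l2_le_of_norm_le_add mA mg zero_le_one hB fun y => by
      rw [Real.norm_of_nonneg (by positivity), one_mul]
  have k3 := hc g hg hgc
  have k4 : c * ε ≤ 1 / 2 := by
    rw [hε]
    have : 0 < c + 1 := by positivity
    rw [mul_inv_le_iff₀ (by positivity)]
    linarith
  have n1 := l2_nonneg (fderiv ℝ g)
  have n2 := l2_nonneg (localOp a b g)
  have n3 := l2_nonneg g
  have k5 : l2 (fderiv ℝ g) ≤
      c * (l2 (localOp a b g) + B * l2 g) + c * ε * l2 (fderiv ℝ g) := by
    refine k3.trans ?_
    calc _ ≤ c * (1 * (1 * l2 (localOp a b g) + B * l2 g) + ε * l2 (fderiv ℝ g)) := by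
          gcongr
          exact k1.trans (by gcongr)
      _ = _ := by ring
  -- The first-order error is absorbed by the left-hand side, which doubles the constant.
  have k6 : c * ε * l2 (fderiv ℝ g) ≤ 1 / 2 * l2 (fderiv ℝ g) := by gcongr
  have hbn : 0 ≤ ‖b y₀‖ := norm_nonneg _
  have k7 : l2 (localOp a b g) + B * l2 g ≤ (‖b y₀‖ + 2) * (l2 (localOp a b g) + l2 g) := by
    simp only [B]
    nlinarith [mul_nonneg hbn n2]
  have k8 := mul_le_mul_of_nonneg_left k7 hc0
  nlinarith

/-- The elliptic estimate for functions supported in a fixed compact set. -/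
theorem exists_l2_fderiv_le (hU : IsOpen U) (ha : ∀ j, ContDiffOn ℝ ∞ (a j) U)
    (hb : ContDiffOn ℝ ∞ b U)
    (hell : ∀ y ∈ U, ∀ ξ : EuclideanSpace ℝ (Fin n), ξ ≠ 0 → IsUnit (principalSymbol a y ξ))
    {K : Set (EuclideanSpace ℝ (Fin n))} (hK : IsCompact K) (hKU : K ⊆ U) :
    ∃ C, 0 ≤ C ∧ ∀ g : EuclideanSpace ℝ (Fin n) → F, ContDiff ℝ ∞ g → tsupport g ⊆ K →
      l2 (fderiv ℝ g) ≤ C * (l2 (localOp a b g) + l2 g) := by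
  have hnear : ∀ y₀, ∃ r C, (y₀ ∈ U → 0 < r) ∧ 0 ≤ C ∧ Metric.ball y₀ r ⊆ U ∧
      ∀ g : EuclideanSpace ℝ (Fin n) → F,
      ContDiff ℝ ∞ g → HasCompactSupport g → tsupport g ⊆ Metric.ball y₀ r →
        l2 (fderiv ℝ g) ≤ C * (l2 (localOp a b g) + l2 g) := by
    intro y₀
    by_cases hy₀ : y₀ ∈ U
    · obtain ⟨r, C, h1, h2, h3, h4⟩ := exists_l2_fderiv_le_near hU ha hb hell hy₀
      exact ⟨r, C, fun _ => h1, h2, h3, h4⟩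
    -- The partition of unity is indexed by all points of the space. Off `U` the ball of radius zero
    -- is empty, so only `g = 0` has to be considered.
    · refine ⟨0, 0, fun h => absurd h hy₀, le_rfl, by simp, fun g hg hgc hs => ?_⟩
      have hf : fderiv ℝ g = 0 := by
        ext1 y
        exact fderiv_eq_zero_of_notMem_tsupport fun hy => by simpa using hs hy
      rw [hf, l2_zero, zero_mul]
  choose r C hr hC0 hrU hC using hnear
  obtain ⟨s, ζ, hζ, hζs, hζ1⟩ := exists_finite_partition hK (fun y => Metric.ball y (r y))
    (fun _ => Metric.isOpen_ball) fun y hy => Metric.mem_ball_self (hr y (hKU hy))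
  have hbd : ∀ i, ∃ B, 0 ≤ B ∧ ∀ y ∈ K, ‖ζ i y‖ ≤ B ∧ ‖symbolOf a (ζ i) y‖ ≤ B := by
    intro i
    obtain ⟨B1, h1, hB1⟩ := exists_bound_of_isCompact hK (hζ i).continuous.continuousOn
    have hc : ContinuousOn (fun y => ‖fderiv ℝ (ζ i) y‖ * ∑ j, ‖a j y‖) K :=
      ((hζ i).continuous_fderiv (by simp)).norm.continuousOn.mul
        (continuousOn_finsetSum _ fun j _ => ((ha j).continuousOn.mono hKU).norm)
    obtain ⟨B2, h2, hB2⟩ := exists_bound_of_isCompact hK hc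
    refine ⟨max B1 B2, le_max_of_le_left h1, fun y hy => ⟨(hB1 y hy).trans (le_max_left _ _),
      (norm_symbolOf_le _ _).trans (((le_abs_self _).trans (hB2 y hy)).trans (le_max_right _ _))⟩⟩
  choose B hB0 hB using hbd
  -- For `G i = ζ i • g`, the bound of the operator contributes `B i * (l2 (localOp a b g) + l2 g)`
  -- and the bound of the function itself another `B i * l2 g`.
  refine ⟨∑ i ∈ s, C i * (2 * B i), Finset.sum_nonneg fun i _ => by
    have := hB0 i; have := hC0 i; positivity, fun g hg hgK => ?_⟩
  have hgc : HasCompactSupport g := hK.of_isClosed_subset (isClosed_tsupport _) hgK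
  have hgU := hgK.trans hKU
  have mA : MemLp (localOp a b g) 2 volume :=
    memLp_of_contDiff (contDiff_localOp hU ha hb hg hgU) hgc.localOp
  have mg := memLp_of_contDiff hg hgc
  let G : EuclideanSpace ℝ (Fin n) → EuclideanSpace ℝ (Fin n) → F := fun i y => ζ i y • g y
  have hG : ∀ i, ContDiff ℝ ∞ (G i) := fun i => (hζ i).smul hg
  have hGc : ∀ i, HasCompactSupport (G i) := fun i => hgc.smul_left
  have hGs : ∀ i, tsupport (G i) ⊆ tsupport g := fun i => tsupport_smul_subset_right _ _
  have hGs' : ∀ i, tsupport (G i) ⊆ Metric.ball i (r i) := fun i =>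
    (tsupport_smul_subset_left _ _).trans (hζs i)
  have hsum : fderiv ℝ g = ∑ i ∈ s, fderiv ℝ (G i) := by
    -- The functions `ζ i` sum to one only on `K`, which suffices because `g` is supported there.
    have e : g = fun y => ∑ i ∈ s, G i y := by
      ext y
      by_cases hy : y ∈ tsupport g
      · simp only [G]
        rw [← Finset.sum_smul, hζ1 y (hgK hy), one_smul]
      · simp [G, image_eq_zero_of_notMem_tsupport hy]
    conv_lhs => rw [e]
    ext1 y
    rw [fderiv_fun_sum fun i _ => ((hG i).differentiable (by simp)) y, Finset.sum_apply]
  have hop : ∀ i, l2 (localOp a b (G i)) ≤ B i * l2 (localOp a b g) + B i * l2 g := fun i => by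
    refine l2_le_of_norm_le_add mA mg (hB0 i) (hB0 i) fun y => ?_
    by_cases hy : y ∈ tsupport g
    · simp only [G]
      rw [localOp_smul _ ((hζ i).differentiable (by simp) y) (hg.differentiable (by simp) y)]
      refine (norm_add_le _ _).trans (add_le_add ?_ ?_)
      · rw [norm_smul]
        gcongr
        exact (hB i y (hgK hy)).1
      · refine (ContinuousLinearMap.le_opNorm _ _).trans ?_
        gcongr
        exact (hB i y (hgK hy)).2
    · rw [localOp_eq_zero fun h => hy (hGs i h), norm_zero]
      have := hB0 i
      positivity
  have hid : ∀ i, l2 (G i) ≤ B i * l2 g := fun i => l2_le_of_norm_le mg (hB0 i) fun y => by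
    by_cases hy : y ∈ tsupport g
    · simp only [G]
      rw [norm_smul]
      gcongr
      exact (hB i y (hgK hy)).1
    · rw [image_eq_zero_of_notMem_tsupport fun h => hy (hGs i h), norm_zero]
      have := hB0 i
      positivity
  rw [hsum, Finset.sum_mul]
  refine (l2_sum_le s fun i _ => memLp_fderiv (hG i) (hGc i)).trans
    (Finset.sum_le_sum fun i _ => ?_)
  refine (hC i (G i) (hG i) (hGc i) (hGs' i)).trans ?_
  rw [mul_assoc]
  refine mul_le_mul_of_nonneg_left ?_ (hC0 i)
  have n2 := mul_nonneg (hB0 i) (l2_nonneg (localOp a b g))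
  linarith [hop i, hid i]

end LocalOperators

/-! ### Mollification -/

section Mollifier

variable {n : ℕ}

/-- An even mollifier with support in the ball of radius `δ`, with a bound for its derivative. -/
structure IsMollifier (C δ : ℝ) (m : EuclideanSpace ℝ (Fin n) → ℝ) : Prop where
  contDiff : ContDiff ℝ ∞ m
  tsupport_subset : tsupport m ⊆ Metric.closedBall 0 δ
  nonneg : ∀ z, 0 ≤ m z
  even : ∀ z, m (-z) = m z
  integral_eq : ∫ z, m z = 1
  integral_fderiv_le : ∫ z, ‖z‖ * ‖fderiv ℝ m z‖ ≤ C

/-- The mollifiers are the dilates `δ⁻ⁿ η(z/δ)` of one even bump. The integral of `‖z‖ * ‖fderiv ℝ m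
z‖` is invariant under this scaling, and so `C` does not depend on `δ`; this is what makes the
commutator estimates uniform. -/
theorem exists_mollifier (n : ℕ) : ∃ C, 0 ≤ C ∧ ∀ δ, 0 < δ →
    ∃ m : EuclideanSpace ℝ (Fin n) → ℝ, IsMollifier C δ m := by
  let φ : ContDiffBump (0 : EuclideanSpace ℝ (Fin n)) := ⟨1 / 2, 1, by norm_num, by norm_num⟩
  set η := φ.normed volume with hη
  have hηs : ContDiff ℝ ∞ η := φ.contDiff_normed
  refine ⟨∫ z, ‖z‖ * ‖fderiv ℝ η z‖, integral_nonneg fun z => by positivity, fun δ hδ => ?_⟩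
  have hδn : 0 < δ ^ n := pow_pos hδ n
  have hint : ∀ f : EuclideanSpace ℝ (Fin n) → ℝ,
      ∫ z, (δ ^ n)⁻¹ * f (δ⁻¹ • z) = ∫ z, f z := fun f => by
    rw [integral_const_mul, Measure.integral_comp_inv_smul, finrank_euclideanSpace_fin,
      abs_of_pos hδn, smul_eq_mul, inv_mul_cancel_left₀ hδn.ne']
  have hd : ∀ z, fderiv ℝ (fun z => (δ ^ n)⁻¹ * η (δ⁻¹ • z)) z =
      (δ ^ n)⁻¹ • δ⁻¹ • fderiv ℝ η (δ⁻¹ • z) := fun z => by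
    have h1 : DifferentiableAt ℝ (fun z => η (δ⁻¹ • z)) z :=
      (hηs.differentiable (by simp) _).comp z (differentiableAt_id.const_smul δ⁻¹)
    rw [fderiv_const_mul h1, fderiv_comp_smul]
  refine ⟨fun z => (δ ^ n)⁻¹ * η (δ⁻¹ • z),
    contDiff_const.mul (hηs.comp (contDiff_const_smul _)), ?_, fun z => ?_, fun z => ?_, ?_, ?_⟩
  · refine closure_minimal (fun z hz => ?_) Metric.isClosed_closedBall
    have h1 : δ⁻¹ • z ∈ tsupport η := subset_tsupport _ fun h => hz (by simp [h])
    rw [hη, φ.tsupport_normed_eq, mem_closedBall_zero_iff, norm_smul, Real.norm_of_nonneg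
      (inv_nonneg.2 hδ.le), inv_mul_le_iff₀ hδ] at h1
    simpa [φ] using h1
  · exact mul_nonneg (inv_nonneg.2 hδn.le) (φ.nonneg_normed _)
  · simp only [smul_neg, hη, φ.normed_neg]
  · rw [hint, hη, φ.integral_normed]
  · have e : ∀ z, ‖z‖ * ‖fderiv ℝ (fun z => (δ ^ n)⁻¹ * η (δ⁻¹ • z)) z‖ =
        (δ ^ n)⁻¹ * (fun z => ‖z‖ * ‖fderiv ℝ η z‖) (δ⁻¹ • z) := fun z => by
      simp only [hd, norm_smul, Real.norm_of_nonneg (inv_nonneg.2 hδn.le),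
        Real.norm_of_nonneg (inv_nonneg.2 hδ.le)]
      ring
    simp_rw [e]
    exact (hint fun z => ‖z‖ * ‖fderiv ℝ η z‖).le

variable {C δ : ℝ} {m : EuclideanSpace ℝ (Fin n) → ℝ}

theorem IsMollifier.hasCompactSupport (hm : IsMollifier C δ m) : HasCompactSupport m :=
  (isCompact_closedBall _ _).of_isClosed_subset (isClosed_tsupport _) hm.tsupport_subset

theorem IsMollifier.integrable (hm : IsMollifier C δ m) : Integrable m :=
  hm.contDiff.continuous.integrable_of_hasCompactSupport hm.hasCompactSupport

theorem IsMollifier.continuous_fderiv (hm : IsMollifier C δ m) : Continuous (fderiv ℝ m) :=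
  hm.contDiff.continuous_fderiv (by simp)

variable {W : Type*} [NormedAddCommGroup W] [NormedSpace ℝ W]

/-- The convolution of `m` and `g`. -/
def mollify (m : EuclideanSpace ℝ (Fin n) → ℝ) (g : EuclideanSpace ℝ (Fin n) → W)
    (x : EuclideanSpace ℝ (Fin n)) : W :=
  ∫ y, m (x - y) • g y

theorem mollify_eq_convolution (m : EuclideanSpace ℝ (Fin n) → ℝ)
    (g : EuclideanSpace ℝ (Fin n) → W) :
    mollify m g = convolution m g (ContinuousLinearMap.lsmul ℝ ℝ) volume := by
  ext x
  exact (convolution_eq_swap (μ := volume) (f := m) (g := g)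
    (ContinuousLinearMap.lsmul ℝ ℝ)).symm

variable {g : EuclideanSpace ℝ (Fin n) → W}

theorem integrable_kernel {k : EuclideanSpace ℝ (Fin n) → ℝ} (hk : Continuous k)
    (hg : Continuous g) (hc : HasCompactSupport g) (x : EuclideanSpace ℝ (Fin n)) :
    Integrable fun y => k (x - y) • g y :=
  ((hk.comp (continuous_const.sub continuous_id)).smul hg).integrable_of_hasCompactSupport
    hc.smul_left

theorem IsMollifier.contDiff_mollify (hm : IsMollifier C δ m) (hg : Continuous g) :
    ContDiff ℝ ∞ (mollify m g) := by
  rw [mollify_eq_convolution]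
  exact hm.hasCompactSupport.contDiff_convolution_left _ hm.contDiff hg.locallyIntegrable

theorem IsMollifier.tsupport_mollify_subset (hm : IsMollifier C δ m) :
    tsupport (mollify m g) ⊆ Metric.cthickening δ (tsupport g) := by
  refine closure_minimal (fun x hx => ?_) Metric.isClosed_cthickening
  rw [mollify_eq_convolution] at hx
  obtain ⟨z, hz, y, hy, rfl⟩ := support_convolution_subset _ hx
  have h1 := mem_closedBall_zero_iff.1 (hm.tsupport_subset (subset_tsupport _ hz))
  exact Metric.mem_cthickening_of_dist_le _ y _ _ (subset_tsupport _ hy) (by simpa using h1)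

theorem IsMollifier.hasCompactSupport_mollify (hm : IsMollifier C δ m)
    (hc : HasCompactSupport g) : HasCompactSupport (mollify m g) := by
  rw [mollify_eq_convolution]
  exact hm.hasCompactSupport.convolution _ hc

theorem mollify_add {f : EuclideanSpace ℝ (Fin n) → W} (hm : Continuous m) (hf : Continuous f)
    (hfc : HasCompactSupport f) (hg : Continuous g) (hgc : HasCompactSupport g) :
    mollify m (f + g) = mollify m f + mollify m g := by
  ext x
  simp only [mollify, Pi.add_apply, smul_add]
  exact integral_add (integrable_kernel hm hf hfc x) (integrable_kernel hm hg hgc x)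

theorem mollify_sub {f : EuclideanSpace ℝ (Fin n) → W} (hm : Continuous m) (hf : Continuous f)
    (hfc : HasCompactSupport f) (hg : Continuous g) (hgc : HasCompactSupport g) :
    mollify m (f - g) = mollify m f - mollify m g := by
  ext x
  simp only [mollify, Pi.sub_apply, smul_sub]
  exact integral_sub (integrable_kernel hm hf hfc x) (integrable_kernel hm hg hgc x)

theorem mollify_smul {W : Type*} [NormedAddCommGroup W] [NormedSpace ℂ W]
    {g : EuclideanSpace ℝ (Fin n) → W} (c : ℂ) : mollify m (c • g) = c • mollify m g := by
  ext x
  simp only [mollify, Pi.smul_apply, smul_comm _ c]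
  exact integral_smul _ _

theorem IsMollifier.fderiv_mollify_apply (hm : IsMollifier C δ m) (hg : ContDiff ℝ ∞ g)
    (hc : HasCompactSupport g) (x v : EuclideanSpace ℝ (Fin n)) :
    fderiv ℝ (mollify m g) x v = mollify m (fun y => fderiv ℝ g y v) x := by
  rw [mollify_eq_convolution, mollify_eq_convolution,
    (hc.hasFDerivAt_convolution_right (ContinuousLinearMap.lsmul ℝ ℝ)
      hm.contDiff.continuous.locallyIntegrable (hg.of_le (by simp)) x).fderiv]
  exact convolution_precompR_apply _ hm.contDiff.continuous.locallyIntegrable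
    (hc.fderiv (𝕜 := ℝ)) (hg.continuous_fderiv (by simp)) x v

/-- Integration by parts moves the derivative to the kernel. In this form bounds involve only `g`
and not its derivatives. -/
theorem IsMollifier.fderiv_mollify_apply' (hm : IsMollifier C δ m) (hg : ContDiff ℝ ∞ g)
    (hc : HasCompactSupport g) (x v : EuclideanSpace ℝ (Fin n)) :
    fderiv ℝ (mollify m g) x v = ∫ y, fderiv ℝ m (x - y) v • g y := by
  rw [hm.fderiv_mollify_apply hg hc]
  have hl : ∀ y, HasFDerivAt (fun y => m (x - y) • g y)
      (m (x - y) • fderiv ℝ g y + ((fderiv ℝ m (x - y)).comp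
        (-ContinuousLinearMap.id ℝ (EuclideanSpace ℝ (Fin n)))).smulRight (g y)) y := fun y =>
    (((hm.contDiff.differentiable (by simp) (x - y)).hasFDerivAt).comp y
      ((hasFDerivAt_id y).const_sub x)).smul (hg.differentiable (by simp) y).hasFDerivAt
  have i1 : Integrable fun y => m (x - y) • fderiv ℝ g y v :=
    integrable_kernel hm.contDiff.continuous
      ((hg.continuous_fderiv (by simp)).clm_apply continuous_const) (hc.fderiv_apply (𝕜 := ℝ) v) x
  have i2 : Integrable fun y => fderiv ℝ m (x - y) v • g y :=
    integrable_kernel (k := fun z => fderiv ℝ m z v)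
      (hm.continuous_fderiv.clm_apply continuous_const) hg.continuous hc x
  have i3 := integrable_kernel hm.contDiff.continuous hg.continuous hc x
  -- Integration by parts against the constant function one: the integral over `y` of the derivative
  -- of `m (x - y) • g y` vanishes.
  have h0 := integral_smul_fderiv_eq_neg_fderiv_smul_of_integrable (μ := volume) (𝕜 := ℝ)
    (f := fun _ => (1 : ℝ)) (g := fun y => m (x - y) • g y) (v := v) (by simp)
    (by
      simp only [(hl _).fderiv, one_smul]
      refine (i1.sub i2).congr (Filter.Eventually.of_forall fun y => ?_)
      simp [sub_eq_add_neg]) (by simpa using i3) (fun _ _ => by fun_prop)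
    (fun y _ => (hl y).differentiableAt)
  simp only [(hl _).fderiv, one_smul] at h0
  simp only [fderiv_fun_const, Pi.zero_apply, zero_apply, zero_smul, integral_zero, neg_zero,
    add_apply, smul_apply, ContinuousLinearMap.smulRight_apply, ContinuousLinearMap.comp_apply,
    neg_apply, ContinuousLinearMap.id_apply, map_neg, neg_smul] at h0
  refine eq_of_sub_eq_zero ?_
  rw [mollify, ← integral_sub i1 i2, ← h0]
  simp only [sub_eq_add_neg]

theorem IsMollifier.norm_mollify_le (hm : IsMollifier C δ m) (x : EuclideanSpace ℝ (Fin n)) :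
    ‖mollify m g x‖ ≤ ∫ y, m (x - y) * ‖g y‖ := by
  refine (norm_integral_le_integral_norm _).trans (le_of_eq ?_)
  simp_rw [norm_smul, Real.norm_of_nonneg (hm.nonneg _)]

theorem IsMollifier.l2_mollify_le (hm : IsMollifier C δ m) (hg : Continuous g)
    (hc : HasCompactSupport g) : l2 (mollify m g) ≤ l2 g := by
  have h := l2_le_of_norm_le_convolution (f := mollify m g) (hg.memLp_of_hasCompactSupport hc) hg
    hm.contDiff.continuous hm.nonneg hm.integrable hm.norm_mollify_le
  rwa [hm.integral_eq, one_mul] at h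

/-- Young's inequality with the kernel `‖fderiv ℝ m‖`. The constant depends on the mollifier; the
estimate serves only for a fixed one, to see that a first-order operator after smoothing is bounded
in `L²`. -/
theorem IsMollifier.l2_fderiv_mollify_le (hm : IsMollifier C δ m) :
    ∃ B, 0 ≤ B ∧ ∀ g : EuclideanSpace ℝ (Fin n) → W, ContDiff ℝ ∞ g → HasCompactSupport g →
      l2 (fderiv ℝ (mollify m g)) ≤ B * l2 g := by
  refine ⟨∫ z, ‖fderiv ℝ m z‖, integral_nonneg fun _ => norm_nonneg _, fun g hg hc => ?_⟩
  refine l2_le_of_norm_le_convolution (hg.continuous.memLp_of_hasCompactSupport hc) hg.continuous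
    hm.continuous_fderiv.norm (fun _ => norm_nonneg _)
    (hm.continuous_fderiv.norm.integrable_of_hasCompactSupport
      (hm.hasCompactSupport.fderiv (𝕜 := ℝ)).norm) fun x => ?_
  refine ContinuousLinearMap.opNorm_le_bound _
    (integral_nonneg fun _ => mul_nonneg (norm_nonneg _) (norm_nonneg _)) fun v => ?_
  rw [hm.fderiv_mollify_apply' hg hc, ← integral_mul_const]
  refine norm_integral_le_of_norm_le
    ((integrable_kernel hm.continuous_fderiv.norm hg.continuous.norm hc.norm x).mul_const _)
    (Filter.Eventually.of_forall fun y => ?_)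
  rw [norm_smul]
  calc _ ≤ ‖fderiv ℝ m (x - y)‖ * ‖v‖ * ‖g y‖ := by
        gcongr
        exact ContinuousLinearMap.le_opNorm _ _
    _ = _ := by ring

/-- A smooth function with compact support is approximated by its mollifications. -/
theorem exists_l2_mollify_sub_le [CompleteSpace W] (hg : ContDiff ℝ ∞ g)
    (hc : HasCompactSupport g) :
    ∃ B, 0 ≤ B ∧ ∀ C δ (m : EuclideanSpace ℝ (Fin n) → ℝ), IsMollifier C δ m → 0 ≤ δ → δ ≤ 1 →
      l2 (mollify m g - g) ≤ B * δ := by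
  obtain ⟨L, hL⟩ := hg.lipschitzWith_of_hasCompactSupport hc (by simp)
  -- For `δ ≤ 1` both `g` and its mollification are supported in `K`. There they differ by at most
  -- `L * δ`, because `g` is Lipschitz and the kernel is a probability density supported in the ball
  -- of radius `δ`.
  set K := Metric.cthickening 1 (tsupport g)
  have hK : IsCompact K := IsCompact.cthickening hc
  have hgK : tsupport g ⊆ K := Metric.self_subset_cthickening _
  have m1 : MemLp (K.indicator fun _ => (1 : ℝ)) 2 volume :=
    memLp_indicator_const 2 hK.isClosed.measurableSet 1 (Or.inr hK.measure_lt_top.ne)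
  refine ⟨L * l2 (K.indicator fun _ => (1 : ℝ)), mul_nonneg L.2 (l2_nonneg _),
    fun C δ m hm hδ0 hδ => ?_⟩
  have key : l2 (mollify m g - g) ≤ (L * δ) * l2 (K.indicator fun _ => (1 : ℝ)) := by
    refine l2_le_of_norm_le m1 (mul_nonneg L.2 hδ0) fun x => ?_
    by_cases hx : x ∈ K
    · rw [Set.indicator_of_mem hx, norm_one, mul_one]
      have e : (mollify m g - g) x = ∫ y, m (x - y) • (g y - g x) := by
        have i2 : Integrable fun y => m (x - y) • g x :=
          (hm.integrable.comp_sub_left x).smul_const _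
        simp only [smul_sub]
        rw [integral_sub (integrable_kernel hm.contDiff.continuous hg.continuous hc x) i2,
          integral_smul_const, integral_sub_left_eq_self m, hm.integral_eq, one_smul]
        rfl
      rw [e]
      have h1 : ∫ y, m (x - y) * (L * δ) = L * δ := by
        rw [integral_mul_const, integral_sub_left_eq_self m, hm.integral_eq, one_mul]
      refine (norm_integral_le_of_norm_le ((hm.integrable.comp_sub_left x).mul_const (L * δ))
        (Filter.Eventually.of_forall fun y => ?_)).trans h1.le
      rw [norm_smul, Real.norm_of_nonneg (hm.nonneg _)]
      by_cases hy : m (x - y) = 0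
      · simp [hy]
      · have h2 := mem_closedBall_zero_iff.1 (hm.tsupport_subset (subset_tsupport _ hy))
        refine mul_le_mul_of_nonneg_left ?_ (hm.nonneg _)
        rw [← dist_eq_norm]
        refine (hL.dist_le_mul y x).trans (mul_le_mul_of_nonneg_left ?_ L.2)
        rwa [dist_comm, dist_eq_norm]
    · have h1 : mollify m g x = 0 := image_eq_zero_of_notMem_tsupport fun h =>
        hx (Metric.cthickening_mono hδ _ (hm.tsupport_mollify_subset h))
      have h2 : g x = 0 := image_eq_zero_of_notMem_tsupport fun h => hx (hgK h)
      simp [h1, h2, hx]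
  linarith [key]

/-- Mollification commutes with partial derivatives, so the approximation estimate is applied to
each of them. -/
theorem exists_l2_fderiv_mollify_sub_le [CompleteSpace W] (hg : ContDiff ℝ ∞ g)
    (hc : HasCompactSupport g) :
    ∃ B, 0 ≤ B ∧ ∀ C δ (m : EuclideanSpace ℝ (Fin n) → ℝ), IsMollifier C δ m → 0 ≤ δ → δ ≤ 1 →
      l2 (fderiv ℝ (mollify m g - g)) ≤ B * δ := by
  have hd : ∀ v, ContDiff ℝ ∞ fun y => fderiv ℝ g y v := fun v =>
    (hg.fderiv_right (m := ∞) (by simp)).clm_apply contDiff_const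
  have hdc : ∀ v, HasCompactSupport fun y => fderiv ℝ g y v := fun v =>
    hc.fderiv_apply (𝕜 := ℝ) v
  choose B hB0 hB using fun j : Fin n =>
    exists_l2_mollify_sub_le (hd (EuclideanSpace.single j 1)) (hdc (EuclideanSpace.single j 1))
  refine ⟨∑ j, B j, Finset.sum_nonneg fun j _ => hB0 j, fun C δ m hm h0 h1 => ?_⟩
  have hmg := hm.contDiff_mollify hg.continuous
  refine (l2_fderiv_le_sum (hmg.sub hg) ((hm.hasCompactSupport_mollify hc).sub hc)).trans ?_
  rw [Finset.sum_mul]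
  refine Finset.sum_le_sum fun j _ => ?_
  have e : (fun y => fderiv ℝ (mollify m g - g) y (EuclideanSpace.single j 1)) =
      mollify m (fun y => fderiv ℝ g y (EuclideanSpace.single j 1)) -
        fun y => fderiv ℝ g y (EuclideanSpace.single j 1) := by
    ext y
    rw [fderiv_sub (hmg.differentiable (by simp) y) (hg.differentiable (by simp) y), sub_apply,
      hm.fderiv_mollify_apply hg hc]
    rfl
  have h := hB j C δ m hm h0 h1
  rw [← e] at h
  exact h

end Mollifier

/-! ### Friedrichs' lemma on the commutator of a first-order operator with mollifiers -/

section Friedrichs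

variable {n : ℕ} {F : Type*} [NormedAddCommGroup F] [NormedSpace ℂ F]

theorem fderiv_clm_apply_complex {a : EuclideanSpace ℝ (Fin n) → (F →L[ℂ] F)}
    {g : EuclideanSpace ℝ (Fin n) → F} (ha : ContDiff ℝ ∞ a) (hg : ContDiff ℝ ∞ g)
    (y v : EuclideanSpace ℝ (Fin n)) :
    fderiv ℝ (fun z => a z (g z)) y v = a y (fderiv ℝ g y v) + fderiv ℝ a y v (g y) := by
  have h := ((isBoundedBilinearMap_apply_real (F := F) F).hasFDerivAt (a y, g y)).comp y
    ((ha.differentiable (by simp) y).hasFDerivAt.prodMk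
      (hg.differentiable (by simp) y).hasFDerivAt)
  exact DFunLike.congr_fun h.fderiv v

theorem mollify_sum {W : Type*} [NormedAddCommGroup W] [NormedSpace ℝ W] {ι : Type*}
    (s : Finset ι) {m : EuclideanSpace ℝ (Fin n) → ℝ} {f : ι → EuclideanSpace ℝ (Fin n) → W}
    (hm : Continuous m) (hf : ∀ i ∈ s, Continuous (f i))
    (hfc : ∀ i ∈ s, HasCompactSupport (f i)) :
    mollify m (∑ i ∈ s, f i) = ∑ i ∈ s, mollify m (f i) := by
  ext x
  simp only [mollify, Finset.sum_apply, Finset.smul_sum]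
  exact integral_finsetSum s fun i hi => integrable_kernel hm (hf i hi) (hfc i hi) x

/-- After integration by parts the commutator is an integral operator with kernel `∂ₑm(x - y) (a(x)
- a(y)) + m(x - y) ∂ₑa(y)`, in which no derivative of `g` is left. The factor `a(x) - a(y)`, of size
`‖x - y‖`, compensates the growth of `∂ₑm` for small radii, and Young's inequality concludes. -/
theorem exists_l2_commutator_le_of_single {a : EuclideanSpace ℝ (Fin n) → (F →L[ℂ] F)}
    [CompleteSpace F]
    (ha : ContDiff ℝ ∞ a) (hac : HasCompactSupport a) (e : EuclideanSpace ℝ (Fin n)) :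
    ∃ L, 0 ≤ L ∧ ∀ C δ (m : EuclideanSpace ℝ (Fin n) → ℝ), IsMollifier C δ m →
      ∀ g : EuclideanSpace ℝ (Fin n) → F, ContDiff ℝ ∞ g → HasCompactSupport g →
        l2 ((fun x => a x (fderiv ℝ (mollify m g) x e)) -
          mollify m fun y => a y (fderiv ℝ g y e)) ≤ L * (C + 1) * l2 g := by
  obtain ⟨L, hL⟩ := ha.lipschitzWith_of_hasCompactSupport hac (by simp)
  refine ⟨L * ‖e‖, by positivity, fun C δ m hm g hg hc => ?_⟩
  have hmc := hm.contDiff.continuous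
  -- Dominating kernel: the Lipschitz constant of `a` bounds both its increments and its derivative.
  -- The two summands have integrals at most `C` and `1`.
  set k : EuclideanSpace ℝ (Fin n) → ℝ :=
    fun z => L * ‖e‖ * (‖z‖ * ‖fderiv ℝ m z‖ + m z) with hk
  have hkc : Continuous k := by
    have := hm.continuous_fderiv
    fun_prop
  have i1 : Integrable fun z => ‖z‖ * ‖fderiv ℝ m z‖ :=
    (continuous_norm.mul hm.continuous_fderiv.norm).integrable_of_hasCompactSupport
      (hm.hasCompactSupport.fderiv (𝕜 := ℝ)).norm.mul_left
  have hk0 : ∀ z, 0 ≤ k z := fun z => by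
    have := hm.nonneg z
    positivity
  have hki : Integrable k := (i1.add hm.integrable).const_mul _
  have hkint : ∫ z, k z ≤ L * ‖e‖ * (C + 1) := by
    rw [hk, integral_const_mul, integral_add i1 hm.integrable, hm.integral_eq]
    have := hm.integral_fderiv_le
    gcongr
  have hag : ContDiff ℝ ∞ fun y => a y (g y) := ha.clm_apply_complex hg
  have hda : ContDiff ℝ ∞ fun y => fderiv ℝ a y e :=
    (ha.fderiv_right (m := ∞) (by simp)).clm_apply contDiff_const
  have hdag : ContDiff ℝ ∞ fun y => fderiv ℝ a y e (g y) := hda.clm_apply_complex hg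
  have hsupp : ∀ T : EuclideanSpace ℝ (Fin n) → (F →L[ℂ] F),
      HasCompactSupport fun y => T y (g y) := fun T =>
    hc.mono fun y hy => fun h => hy (by simp [h])
  have key : ∀ x, a x (fderiv ℝ (mollify m g) x e) - mollify m (fun y => a y (fderiv ℝ g y e)) x =
      ∫ y, (fderiv ℝ m (x - y) e • (a x - a y) (g y) + m (x - y) • fderiv ℝ a y e (g y)) := by
    intro x
    have hr : ∀ (T : F →L[ℂ] F) (c : ℝ) (v : F), T (c • v) = c • T v := fun T c v => by
      rw [← Complex.coe_smul, map_smul, Complex.coe_smul]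
    have hk1 : Continuous fun z => fderiv ℝ m z e := hm.continuous_fderiv.clm_apply continuous_const
    -- `a ∂g = ∂(a g) - (∂a) g`; the first term is in the form required for moving the derivative to
    -- the kernel.
    have e1 : (fun y => a y (fderiv ℝ g y e)) =
        (fun y => fderiv ℝ (fun z => a z (g z)) y e) - fun y => fderiv ℝ a y e (g y) := by
      ext y
      simp [fderiv_clm_apply_complex ha hg]
    have j0 : Integrable fun y => fderiv ℝ m (x - y) e • g y :=
      integrable_kernel hk1 hg.continuous hc x
    have j1 : Integrable fun y => fderiv ℝ m (x - y) e • a x (g y) :=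
      integrable_kernel hk1 ((a x).continuous.comp hg.continuous) (hsupp fun _ => a x) x
    have j2 : Integrable fun y => fderiv ℝ m (x - y) e • a y (g y) :=
      integrable_kernel hk1 hag.continuous (hsupp a) x
    have j3 : Integrable fun y => m (x - y) • fderiv ℝ a y e (g y) :=
      integrable_kernel hmc hdag.continuous (hsupp _) x
    have hdg : ContDiff ℝ ∞ fun y => fderiv ℝ (fun z => a z (g z)) y e :=
      (hag.fderiv_right (m := ∞) (by simp)).clm_apply contDiff_const
    rw [e1, mollify_sub hmc hdg.continuous ((hsupp a).fderiv_apply (𝕜 := ℝ) e) hdag.continuous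
      (hsupp _), Pi.sub_apply, ← hm.fderiv_mollify_apply hag (hsupp a),
      hm.fderiv_mollify_apply' hag (hsupp a), hm.fderiv_mollify_apply' hg hc,
      ← ContinuousLinearMap.integral_comp_comm _ j0, mollify]
    simp only [hr, sub_apply, smul_sub]
    have j12 : Integrable fun y => fderiv ℝ m (x - y) e • a x (g y) -
        fderiv ℝ m (x - y) e • a y (g y) := j1.sub j2
    rw [integral_add j12 j3, integral_sub j1 j2]
    abel
  have h := l2_le_of_norm_le_convolution (hg.continuous.memLp_of_hasCompactSupport hc)
    hg.continuous hkc hk0 hki (f := (fun x => a x (fderiv ℝ (mollify m g) x e)) -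
          mollify m fun y => a y (fderiv ℝ g y e)) fun x => by
      rw [Pi.sub_apply, key]
      refine norm_integral_le_of_norm_le (integrable_kernel hkc hg.continuous.norm hc.norm x)
        (Filter.Eventually.of_forall fun y => ?_)
      have h1 : ‖a x - a y‖ ≤ L * ‖x - y‖ := by
        simpa [dist_eq_norm] using hL.dist_le_mul x y
      have h2 : ‖fderiv ℝ a y e‖ ≤ L * ‖e‖ := (ContinuousLinearMap.le_opNorm _ _).trans
        (mul_le_mul_of_nonneg_right (norm_fderiv_le_of_lipschitz ℝ hL) (norm_nonneg _))
      have h3 : ‖fderiv ℝ m (x - y) e‖ ≤ ‖fderiv ℝ m (x - y)‖ * ‖e‖ :=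
        ContinuousLinearMap.le_opNorm _ _
      have h4 : ‖(a x - a y) (g y)‖ ≤ L * ‖x - y‖ * ‖g y‖ :=
        (ContinuousLinearMap.le_opNorm _ _).trans
          (mul_le_mul_of_nonneg_right h1 (norm_nonneg _))
      have h5 : ‖fderiv ℝ a y e (g y)‖ ≤ L * ‖e‖ * ‖g y‖ :=
        (ContinuousLinearMap.le_opNorm _ _).trans
          (mul_le_mul_of_nonneg_right h2 (norm_nonneg _))
      have h6 := hm.nonneg (x - y)
      calc _ ≤ ‖fderiv ℝ m (x - y) e‖ * ‖(a x - a y) (g y)‖ +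
            m (x - y) * ‖fderiv ℝ a y e (g y)‖ := by
              refine (norm_add_le _ _).trans (le_of_eq ?_)
              rw [norm_smul, norm_smul, Real.norm_of_nonneg h6]
        _ ≤ (‖fderiv ℝ m (x - y)‖ * ‖e‖) * (L * ‖x - y‖ * ‖g y‖) +
            m (x - y) * (L * ‖e‖ * ‖g y‖) := by gcongr
        _ = _ := by simp only [hk]; ring
  exact h.trans (mul_le_mul_of_nonneg_right hkint (l2_nonneg _))

/-- Friedrichs' lemma: the commutators of a first-order operator with mollifiers are bounded in
the `L²` norm, uniformly in the radius of the mollifier. -/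
theorem exists_l2_commutator_le [CompleteSpace F]
    {a : Fin n → EuclideanSpace ℝ (Fin n) → (F →L[ℂ] F)}
    {b : EuclideanSpace ℝ (Fin n) → (F →L[ℂ] F)} (ha : ∀ j, ContDiff ℝ ∞ (a j))
    (hac : ∀ j, HasCompactSupport (a j)) (hb : ContDiff ℝ ∞ b) (hbc : HasCompactSupport b)
    {C : ℝ} (hC : 0 ≤ C) :
    ∃ L, 0 ≤ L ∧ ∀ δ (m : EuclideanSpace ℝ (Fin n) → ℝ), IsMollifier C δ m →
      ∀ g : EuclideanSpace ℝ (Fin n) → F, ContDiff ℝ ∞ g → HasCompactSupport g →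
        l2 (localOp a b (mollify m g) - mollify m (localOp a b g)) ≤ L * l2 g := by
  choose L hL0 hL using fun j => exists_l2_commutator_le_of_single (ha j) (hac j)
    (EuclideanSpace.single j 1)
  obtain ⟨B, hB⟩ := hb.continuous.bounded_above_of_compact_support hbc
  have hB0 : 0 ≤ B := (norm_nonneg _).trans (hB 0)
  -- The zeroth-order term has no derivative to compensate: both halves of its commutator are simply
  -- bounded by `B * l2 g`, whence `2 * B`.
  refine ⟨(∑ j, L j) * (C + 1) + 2 * B, add_nonneg (mul_nonneg
    (Finset.sum_nonneg fun j _ => hL0 j) (by positivity)) (by positivity),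
    fun δ m hm g hg hc => ?_⟩
  have hmc := hm.contDiff.continuous
  have hmg := hm.contDiff_mollify hg.continuous
  have hmgc := hm.hasCompactSupport_mollify hc
  have hsupp : ∀ (T : EuclideanSpace ℝ (Fin n) → (F →L[ℂ] F))
      (u : EuclideanSpace ℝ (Fin n) → F), HasCompactSupport u →
      HasCompactSupport fun y => T y (u y) := fun T u hu =>
    hu.mono fun y hy => fun h => hy (by simp [h])
  have hd : ∀ u : EuclideanSpace ℝ (Fin n) → F, ContDiff ℝ ∞ u → ∀ j,
      ContDiff ℝ ∞ fun y => a j y (fderiv ℝ u y (EuclideanSpace.single j 1)) := fun u hu j =>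
    (ha j).clm_apply_complex ((hu.fderiv_right (m := ∞) (by simp)).clm_apply contDiff_const)
  have hdc : ∀ u : EuclideanSpace ℝ (Fin n) → F, HasCompactSupport u → ∀ j,
      HasCompactSupport fun y => a j y (fderiv ℝ u y (EuclideanSpace.single j 1)) := fun u hu j =>
    hsupp _ _ (hu.fderiv_apply (𝕜 := ℝ) _)
  have hbg : ContDiff ℝ ∞ fun y => b y (g y) := hb.clm_apply_complex hg
  have hbgc : HasCompactSupport fun y => b y (g y) := hsupp b g hc
  have e0 : localOp a b g =
      (∑ j, fun y => a j y (fderiv ℝ g y (EuclideanSpace.single j 1))) + fun y => b y (g y) := by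
    ext y
    simp [localOp]
  let A : Fin n → EuclideanSpace ℝ (Fin n) → F := fun j =>
    (fun x => a j x (fderiv ℝ (mollify m g) x (EuclideanSpace.single j 1))) -
      mollify m fun y => a j y (fderiv ℝ g y (EuclideanSpace.single j 1))
  let R : EuclideanSpace ℝ (Fin n) → F := (fun x => b x (mollify m g x)) -
    mollify m fun y => b y (g y)
  have e1 : localOp a b (mollify m g) - mollify m (localOp a b g) = (∑ j, A j) + R := by
    rw [e0, mollify_add hmc (by
        rw [show (∑ j, fun y => a j y (fderiv ℝ g y (EuclideanSpace.single j 1))) =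
          fun y => ∑ j, a j y (fderiv ℝ g y (EuclideanSpace.single j 1)) from by ext; simp]
        exact continuous_finsetSum _ fun j _ => (hd g hg j).continuous)
      (by
        refine hc.mono' fun y hy => by_contra fun h => hy ?_
        simp [fderiv_eq_zero_of_notMem_tsupport h]) hbg.continuous hbgc,
      mollify_sum _ hmc (fun j _ => (hd g hg j).continuous) (fun j _ => hdc g hc j)]
    simp only [A, R, Finset.sum_sub_distrib]
    ext x
    simp only [localOp, Pi.sub_apply, Pi.add_apply, Finset.sum_apply]
    abel
  have mA : ∀ j ∈ Finset.univ, MemLp (A j) 2 volume := fun j _ =>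
    (((hd _ hmg j).continuous).memLp_of_hasCompactSupport (hdc _ hmgc j)).sub
      ((hm.contDiff_mollify (hd g hg j).continuous).continuous.memLp_of_hasCompactSupport
        (hm.hasCompactSupport_mollify (hdc g hc j)))
  have m1 : MemLp (mollify m g) 2 volume := memLp_of_contDiff hmg hmgc
  have m2 : MemLp (mollify m fun y => b y (g y)) 2 volume :=
    memLp_of_contDiff (hm.contDiff_mollify hbg.continuous) (hm.hasCompactSupport_mollify hbgc)
  have mR : MemLp R 2 volume :=
    (memLp_of_contDiff (hb.clm_apply_complex hmg) (hsupp b _ hmgc)).sub m2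
  have bR : l2 R ≤ 2 * B * l2 g := by
    have h1 : l2 R ≤ B * l2 (mollify m g) + 1 * l2 (mollify m fun y => b y (g y)) :=
      l2_le_of_norm_le_add m1 m2 hB0 zero_le_one fun x => by
        rw [one_mul]
        refine (norm_sub_le _ _).trans (add_le_add_left ?_ _)
        exact ((b x).le_opNorm _).trans (mul_le_mul_of_nonneg_right (hB x) (norm_nonneg _))
    have h2 := hm.l2_mollify_le hg.continuous hc
    have h3 := hm.l2_mollify_le hbg.continuous hbgc
    have h4 : l2 (fun y => b y (g y)) ≤ B * l2 g :=
      l2_le_of_norm_le (memLp_of_contDiff hg hc) hB0 fun y =>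
        ((b y).le_opNorm _).trans (mul_le_mul_of_nonneg_right (hB y) (norm_nonneg _))
    have h5 := mul_le_mul_of_nonneg_left h2 hB0
    linarith
  rw [e1]
  refine (l2_add_le (memLp_sum _ mA) mR).trans ?_
  have h1 := (l2_sum_le _ mA).trans (Finset.sum_le_sum fun j _ => hL j C δ m hm g hg hc)
  rw [← Finset.sum_mul, ← Finset.sum_mul] at h1
  linarith

end Friedrichs

/-- `g` is a smooth function on `ℝⁿ` with compact support contained in `U`. -/
structure IsTestOn {n : ℕ} {W : Type*} [NormedAddCommGroup W] [NormedSpace ℝ W]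
    (U : Set (EuclideanSpace ℝ (Fin n))) (g : EuclideanSpace ℝ (Fin n) → W) : Prop where
  contDiff : ContDiff ℝ ∞ g
  hasCompactSupport : HasCompactSupport g
  tsupport_subset : tsupport g ⊆ U

namespace IsTestOn

variable {n : ℕ} {W : Type*} [NormedAddCommGroup W] [NormedSpace ℝ W]
  {U : Set (EuclideanSpace ℝ (Fin n))} {f g : EuclideanSpace ℝ (Fin n) → W}

theorem memLp (hg : IsTestOn U g) : MemLp g 2 volume :=
  memLp_of_contDiff hg.contDiff hg.hasCompactSupport

theorem add (hf : IsTestOn U f) (hg : IsTestOn U g) : IsTestOn U (f + g) :=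
  ⟨hf.contDiff.add hg.contDiff, hf.hasCompactSupport.add hg.hasCompactSupport,
    (tsupport_add f g).trans (Set.union_subset hf.tsupport_subset hg.tsupport_subset)⟩

theorem sub (hf : IsTestOn U f) (hg : IsTestOn U g) : IsTestOn U (f - g) :=
  ⟨hf.contDiff.sub hg.contDiff, hf.hasCompactSupport.sub hg.hasCompactSupport,
    (tsupport_sub f g).trans (Set.union_subset hf.tsupport_subset hg.tsupport_subset)⟩

theorem const_smul {W : Type*} [NormedAddCommGroup W] [NormedSpace ℂ W]
    {g : EuclideanSpace ℝ (Fin n) → W} (hg : IsTestOn U g) (c : ℂ) : IsTestOn U (c • g) :=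
  ⟨hg.contDiff.const_smul c, hg.hasCompactSupport.smul_left (f := fun _ => c),
    (tsupport_smul_subset_right (fun _ => c) g).trans hg.tsupport_subset⟩

theorem mono {V : Set (EuclideanSpace ℝ (Fin n))} (hg : IsTestOn U g) (h : U ⊆ V) :
    IsTestOn V g :=
  ⟨hg.contDiff, hg.hasCompactSupport, hg.tsupport_subset.trans h⟩

theorem eq_zero (hg : IsTestOn U g) {y : EuclideanSpace ℝ (Fin n)} (hy : y ∉ U) : g y = 0 :=
  image_eq_zero_of_notMem_tsupport fun h => hy (hg.tsupport_subset h)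

theorem of_isCompact {K : Set (EuclideanSpace ℝ (Fin n))} (hK : IsCompact K)
    (hg : ContDiff ℝ ∞ g) (h : tsupport g ⊆ K) : IsTestOn K g :=
  ⟨hg, hK.of_isClosed_subset (isClosed_tsupport _) h, h⟩

theorem localOp {F : Type*} [NormedAddCommGroup F] [NormedSpace ℂ F]
    {g : EuclideanSpace ℝ (Fin n) → F} (hg : IsTestOn U g) (hU : IsOpen U)
    {a : Fin n → EuclideanSpace ℝ (Fin n) → (F →L[ℂ] F)}
    {b : EuclideanSpace ℝ (Fin n) → (F →L[ℂ] F)} (ha : ∀ j, ContDiffOn ℝ ∞ (a j) U)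
    (hb : ContDiffOn ℝ ∞ b U) : IsTestOn U (localOp a b g) :=
  ⟨contDiff_localOp hU ha hb hg.contDiff hg.tsupport_subset, hg.hasCompactSupport.localOp,
    tsupport_localOp_subset.trans hg.tsupport_subset⟩

theorem mollify {C δ : ℝ} {m : EuclideanSpace ℝ (Fin n) → ℝ} (hm : IsMollifier C δ m)
    (hg : IsTestOn U g) : IsTestOn (Metric.cthickening δ U) (mollify m g) :=
  ⟨hm.contDiff_mollify hg.contDiff.continuous, hm.hasCompactSupport_mollify hg.hasCompactSupport,
    hm.tsupport_mollify_subset.trans (Metric.cthickening_subset_of_subset _ hg.tsupport_subset)⟩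

end IsTestOn

/-! ### Smooth sections supported in one chart -/

section LocalSections

variable {n : ℕ} {X : Type*} [TopologicalSpace X] [ChartedSpace (EuclideanSpace ℝ (Fin n)) X]
  {F : Type*} [NormedAddCommGroup F] [NormedSpace ℂ F]
  {E : X → Type*} [TopologicalSpace (TotalSpace F E)] [∀ x, TopologicalSpace (E x)]
  [∀ x, AddCommGroup (E x)] [∀ x, Module ℂ (E x)] [FiberBundle F E]
  [VectorBundle ℝ F E] [VectorBundle ℂ F E]

variable (n F E) in
/-- The domain in `X` of the preferred chart and trivialization at `x₀`. -/
def chartDomain (x₀ : X) : Set X :=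
  (chartAt (EuclideanSpace ℝ (Fin n)) x₀).source ∩ (trivializationAt F E x₀).baseSet

theorem isOpen_chartDomain (x₀ : X) : IsOpen (chartDomain n F E x₀) :=
  (chartAt (EuclideanSpace ℝ (Fin n)) x₀).open_source.inter (trivializationAt F E x₀).open_baseSet

theorem mem_chartDomain_self (x₀ : X) : x₀ ∈ chartDomain n F E x₀ :=
  ⟨mem_chart_source _ x₀, FiberBundle.mem_baseSet_trivializationAt' x₀⟩

theorem chart_mem_localDomain {x₀ x : X} (hx : x ∈ chartDomain n F E x₀) :
    chartAt (EuclideanSpace ℝ (Fin n)) x₀ x ∈ localDomain n F E x₀ :=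
  ⟨(chartAt _ x₀).map_source hx.1, by
    rw [Set.mem_preimage, (chartAt _ x₀).left_inv hx.1]; exact hx.2⟩

theorem symm_mem_chartDomain {x₀ : X} {y : EuclideanSpace ℝ (Fin n)}
    (hy : y ∈ localDomain n F E x₀) :
    (chartAt (EuclideanSpace ℝ (Fin n)) x₀).symm y ∈ chartDomain n F E x₀ :=
  ⟨(chartAt _ x₀).map_target hy.1, hy.2⟩

theorem localRep_chart {x₀ x : X} (hx : x ∈ chartDomain n F E x₀) (u : ∀ x, E x) :
    localRep n F E x₀ u (chartAt (EuclideanSpace ℝ (Fin n)) x₀ x) =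
      (trivializationAt F E x₀ ⟨x, u x⟩).2 := by
  unfold localRep
  rw [(chartAt _ x₀).left_inv hx.1]

theorem section_eq_of_localRep_eq {x₀ x : X} (hx : x ∈ chartDomain n F E x₀) {u v : ∀ x, E x}
    (h : localRep n F E x₀ u (chartAt (EuclideanSpace ℝ (Fin n)) x₀ x) =
      localRep n F E x₀ v (chartAt (EuclideanSpace ℝ (Fin n)) x₀ x)) : u x = v x := by
  rw [localRep_chart hx, localRep_chart hx] at h
  rw [← (trivializationAt F E x₀).symm_apply_apply_mk hx.2 (u x), h,
    (trivializationAt F E x₀).symm_apply_apply_mk hx.2 (v x)]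

theorem localRep_zero (x₀ : X) {y : EuclideanSpace ℝ (Fin n)}
    (hy : y ∈ localDomain n F E x₀) : localRep n F E x₀ (0 : ∀ x, E x) y = 0 :=
  ((trivializationAt F E x₀).linear ℂ hy.2).map_zero

theorem localRep_sub (x₀ : X) (u v : ∀ x, E x) {y : EuclideanSpace ℝ (Fin n)}
    (hy : y ∈ localDomain n F E x₀) :
    localRep n F E x₀ (u - v) y = localRep n F E x₀ u y - localRep n F E x₀ v y :=
  ((trivializationAt F E x₀).linear ℂ hy.2).map_sub _ _

open Classical in
/-- The section represented by `g` in the preferred chart and trivialization at `x₀`, extended by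
zero. -/
def rawOfLocal (x₀ : X) (g : EuclideanSpace ℝ (Fin n) → F) (x : X) : E x :=
  if x ∈ chartDomain n F E x₀ then
    (trivializationAt F E x₀).symm x (g (chartAt (EuclideanSpace ℝ (Fin n)) x₀ x)) else 0

theorem rawOfLocal_of_notMem {x₀ x : X} (hx : x ∉ chartDomain n F E x₀)
    (g : EuclideanSpace ℝ (Fin n) → F) : rawOfLocal (E := E) x₀ g x = 0 := if_neg hx

theorem trivialization_rawOfLocal {x₀ x : X} (hx : x ∈ chartDomain n F E x₀)
    (g : EuclideanSpace ℝ (Fin n) → F) :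
    (trivializationAt F E x₀ ⟨x, rawOfLocal x₀ g x⟩).2 =
      g (chartAt (EuclideanSpace ℝ (Fin n)) x₀ x) := by
  rw [rawOfLocal, if_pos hx, (trivializationAt F E x₀).apply_mk_symm hx.2]

theorem localRep_rawOfLocal {x₀ : X} (g : EuclideanSpace ℝ (Fin n) → F)
    {y : EuclideanSpace ℝ (Fin n)} (hy : y ∈ localDomain n F E x₀) :
    localRep n F E x₀ (rawOfLocal x₀ g) y = g y := by
  rw [localRep, trivialization_rawOfLocal (symm_mem_chartDomain hy),
    (chartAt _ x₀).right_inv hy.1]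

theorem rawOfLocal_eq_zero {x₀ x : X} {g : EuclideanSpace ℝ (Fin n) → F}
    (hx : x ∈ chartDomain n F E x₀ → g (chartAt (EuclideanSpace ℝ (Fin n)) x₀ x) = 0) :
    rawOfLocal (E := E) x₀ g x = 0 := by
  by_cases h : x ∈ chartDomain n F E x₀
  · refine section_eq_of_localRep_eq (v := 0) h ?_
    rw [localRep_rawOfLocal g (chart_mem_localDomain h), hx h,
      localRep_zero _ (chart_mem_localDomain h)]
  · exact rawOfLocal_of_notMem h g

variable [T2Space X]

/-- The image of the support of `g` in `X` is compact, hence closed since `X` is Hausdorff. Off this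
set the extension by zero vanishes, so it remains smooth across the boundary of the chart domain. -/
theorem eventually_rawOfLocal_eq_zero {x₀ x : X} {g : EuclideanSpace ℝ (Fin n) → F}
    (hg : IsTestOn (localDomain n F E x₀) g) (hx : x ∉ chartDomain n F E x₀) :
    ∀ᶠ z in nhds x, rawOfLocal (E := E) x₀ g z = 0 := by
  set φ := chartAt (EuclideanSpace ℝ (Fin n)) x₀
  have hK : IsCompact (φ.symm '' tsupport g) :=
    hg.hasCompactSupport.isCompact.image_of_continuousOn
      (φ.continuousOn_symm.mono fun y hy => (hg.tsupport_subset hy).1)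
  have hxK : x ∉ φ.symm '' tsupport g := by
    rintro ⟨y, hy, rfl⟩
    exact hx (symm_mem_chartDomain (hg.tsupport_subset hy))
  filter_upwards [hK.isClosed.isOpen_compl.mem_nhds hxK] with z hz
  refine rawOfLocal_eq_zero fun h => image_eq_zero_of_notMem_tsupport fun hs => hz ?_
  exact ⟨_, hs, φ.left_inv h.1⟩

variable [IsManifold (𝓡 n) ∞ X] [ContMDiffVectorBundle ∞ F E (𝓡 n)]

theorem isSmoothSection_rawOfLocal {x₀ : X} {g : EuclideanSpace ℝ (Fin n) → F}
    (hg : IsTestOn (localDomain n F E x₀) g) : IsSmoothSection n F E (rawOfLocal x₀ g) := by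
  intro x
  by_cases hx : x ∈ chartDomain n F E x₀
  · have h1 : ContMDiffOn (𝓡 n) 𝓘(ℝ, F) ∞
        (fun x => g (chartAt (EuclideanSpace ℝ (Fin n)) x₀ x)) (chartDomain n F E x₀) :=
      hg.contDiff.contMDiff.comp_contMDiffOn
        ((contMDiffOn_chart (I := 𝓡 n) (x := x₀)).mono Set.inter_subset_left)
    have h2 : ContMDiffOn (𝓡 n) ((𝓡 n).prod 𝓘(ℝ, F)) ∞
        (fun x => TotalSpace.mk' F x (rawOfLocal (E := E) x₀ g x)) (chartDomain n F E x₀) :=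
      ((trivializationAt F E x₀).contMDiffOn_section_iff (IB := 𝓡 n) (isOpen_chartDomain x₀)
        Set.inter_subset_right).2 (h1.congr fun z hz => trivialization_rawOfLocal hz g)
    exact h2.contMDiffAt ((isOpen_chartDomain x₀).mem_nhds hx)
  · refine (Bundle.contMDiff_zeroSection ℝ E x).congr_of_eventuallyEq ?_
    filter_upwards [eventually_rawOfLocal_eq_zero hg hx] with z hz
    rw [hz]
    rfl

open Classical in
/-- The smooth section represented by `g` in the preferred chart and trivialization at `x₀`; it is
meaningful if `g` is smooth with compact support in `localDomain n F E x₀`. -/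
def SmoothSection.ofLocal (x₀ : X) (g : EuclideanSpace ℝ (Fin n) → F) : SmoothSection n F E :=
  if h : IsSmoothSection n F E (rawOfLocal x₀ g) then ⟨rawOfLocal x₀ g, h⟩ else 0

theorem coe_ofLocal {x₀ : X} {g : EuclideanSpace ℝ (Fin n) → F}
    (hg : IsTestOn (localDomain n F E x₀) g) :
    ((SmoothSection.ofLocal x₀ g : SmoothSection n F E) : ∀ x, E x) = rawOfLocal x₀ g := by
  rw [SmoothSection.ofLocal, dif_pos (isSmoothSection_rawOfLocal hg)]

theorem localRep_ofLocal {x₀ : X} {g : EuclideanSpace ℝ (Fin n) → F}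
    (hg : IsTestOn (localDomain n F E x₀) g) {y : EuclideanSpace ℝ (Fin n)}
    (hy : y ∈ localDomain n F E x₀) :
    localRep n F E x₀ (SmoothSection.ofLocal x₀ g : SmoothSection n F E) y = g y := by
  rw [coe_ofLocal hg, localRep_rawOfLocal g hy]

theorem ofLocal_apply_of_notMem {x₀ x : X} {g : EuclideanSpace ℝ (Fin n) → F}
    (hg : IsTestOn (localDomain n F E x₀) g) (hx : x ∉ chartDomain n F E x₀) :
    ((SmoothSection.ofLocal x₀ g : SmoothSection n F E) : ∀ x, E x) x = 0 := by
  rw [coe_ofLocal hg, rawOfLocal_of_notMem hx]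

/-- A section which vanishes outside of the chart domain is determined by its local
representation. -/
theorem eq_ofLocal {x₀ : X} {g : EuclideanSpace ℝ (Fin n) → F}
    (hg : IsTestOn (localDomain n F E x₀) g) {u : SmoothSection n F E}
    (h1 : ∀ y ∈ localDomain n F E x₀, localRep n F E x₀ u y = g y)
    (h2 : ∀ x ∉ chartDomain n F E x₀, (u : ∀ x, E x) x = 0) :
    u = SmoothSection.ofLocal x₀ g := by
  ext x
  by_cases hx : x ∈ chartDomain n F E x₀
  · refine section_eq_of_localRep_eq hx ?_
    rw [h1 _ (chart_mem_localDomain hx), localRep_ofLocal hg (chart_mem_localDomain hx)]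
  · rw [h2 x hx, ofLocal_apply_of_notMem hg hx]

theorem ofLocal_add {x₀ : X} {f g : EuclideanSpace ℝ (Fin n) → F}
    (hf : IsTestOn (localDomain n F E x₀) f) (hg : IsTestOn (localDomain n F E x₀) g) :
    (SmoothSection.ofLocal x₀ (f + g) : SmoothSection n F E) =
      SmoothSection.ofLocal x₀ f + SmoothSection.ofLocal x₀ g := by
  refine (eq_ofLocal (hf.add hg) (fun y hy => ?_) fun x hx => ?_).symm
  · exact (localRep_add x₀ _ _ hy).trans (by
      rw [localRep_ofLocal hf hy, localRep_ofLocal hg hy]; rfl)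
  · exact (congrArg₂ (· + ·) (ofLocal_apply_of_notMem hf hx)
      (ofLocal_apply_of_notMem hg hx)).trans (add_zero 0)

theorem ofLocal_sub {x₀ : X} {f g : EuclideanSpace ℝ (Fin n) → F}
    (hf : IsTestOn (localDomain n F E x₀) f) (hg : IsTestOn (localDomain n F E x₀) g) :
    (SmoothSection.ofLocal x₀ (f - g) : SmoothSection n F E) =
      SmoothSection.ofLocal x₀ f - SmoothSection.ofLocal x₀ g := by
  refine (eq_ofLocal (hf.sub hg) (fun y hy => ?_) fun x hx => ?_).symm
  · exact (localRep_sub x₀ _ _ hy).trans (by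
      rw [localRep_ofLocal hf hy, localRep_ofLocal hg hy]; rfl)
  · exact (congrArg₂ (· - ·) (ofLocal_apply_of_notMem hf hx)
      (ofLocal_apply_of_notMem hg hx)).trans (sub_zero 0)

theorem ofLocal_smul {x₀ : X} {g : EuclideanSpace ℝ (Fin n) → F} (c : ℂ)
    (hg : IsTestOn (localDomain n F E x₀) g) :
    (SmoothSection.ofLocal x₀ (c • g) : SmoothSection n F E) =
      c • SmoothSection.ofLocal x₀ g := by
  refine (eq_ofLocal (hg.const_smul c) (fun y hy => ?_) fun x hx => ?_).symm
  · exact (localRep_smul x₀ c _ hy).trans (by rw [localRep_ofLocal hg hy]; rfl)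
  · exact (congrArg (c • ·) (ofLocal_apply_of_notMem hg hx)).trans (smul_zero c)

/-! ### Locality of differential operators -/

/-- In the local form at `x` the value of `P u` at `x` depends only on the value and the first
derivatives of `u` there. -/
theorem IsFirstOrderDifferentialOperator.apply_eq_zero
    {P : SmoothSection n F E →ₗ[ℂ] SmoothSection n F E}
    (hP : IsFirstOrderDifferentialOperator P) {u : SmoothSection n F E} {x : X}
    (hu : ∀ᶠ z in nhds x, (u : ∀ x, E x) z = 0) : (P u : ∀ x, E x) x = 0 := by
  obtain ⟨a, b, hab⟩ := hP x
  have hx : x ∈ chartDomain n F E x := mem_chartDomain_self x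
  set φ := chartAt (EuclideanSpace ℝ (Fin n)) x
  have hy := chart_mem_localDomain hx
  have h0 : localRep n F E x u =ᶠ[nhds (φ x)] fun _ => 0 := by
    have h1 : Filter.Tendsto φ.symm (nhds (φ x)) (nhds x) := by
      have := φ.continuousAt_symm (φ.map_source hx.1)
      rwa [ContinuousAt, φ.left_inv hx.1] at this
    filter_upwards [h1.eventually hu, (isOpen_localDomain x).mem_nhds hy] with z hz hzU
    rw [← localRep_zero (F := F) (E := E) x hzU]
    simp only [localRep]
    congr 3
  refine section_eq_of_localRep_eq (v := 0) hx ?_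
  rw [hab.eq u _ hy, localRep_zero x hy, h0.fderiv_eq, h0.eq_of_nhds]
  simp

/-- The local form determines the section inside the chart domain at `x₀`. Outside of it, where this
local form says nothing, locality of `P` gives zero. -/
theorem IsLocalForm.apply_ofLocal {P : SmoothSection n F E →ₗ[ℂ] SmoothSection n F E}
    (hP : IsFirstOrderDifferentialOperator P) {x₀ : X}
    {a : Fin n → EuclideanSpace ℝ (Fin n) → (F →L[ℂ] F)}
    {b : EuclideanSpace ℝ (Fin n) → (F →L[ℂ] F)} (hab : IsLocalForm P x₀ a b)
    {g : EuclideanSpace ℝ (Fin n) → F} (hg : IsTestOn (localDomain n F E x₀) g) :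
    P (SmoothSection.ofLocal x₀ g) = SmoothSection.ofLocal x₀ (localOp a b g) := by
  refine eq_ofLocal (hg.localOp (isOpen_localDomain x₀) hab.smooth_coeff hab.smooth_zeroth)
    (fun y hy => ?_) fun x hx => ?_
  · rw [hab.eq _ y hy]
    refine localOp_congr (a := a) (b := b) ?_
    filter_upwards [(isOpen_localDomain x₀).mem_nhds hy] with z hz
    exact localRep_ofLocal hg hz
  · refine hP.apply_eq_zero ?_
    rw [coe_ofLocal hg]
    exact eventually_rawOfLocal_eq_zero hg hx

/-! ### Decomposition of sections with respect to an atlas -/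

variable [CompactSpace X] (𝒜 : SobolevAtlas n F E)

theorem SobolevAtlas.tsupport_piece_subset (i : Fin 𝒜.size) (u : ∀ x, E x) :
    tsupport (𝒜.piece i u) ⊆ 𝒜.core i :=
  closure_minimal (fun _ hy => by_contra fun h => hy (𝒜.piece_eq_zero i u h))
    (𝒜.isCompact_core i).isClosed

theorem SobolevAtlas.isTestOn_piece (i : Fin 𝒜.size) (u : SmoothSection n F E) :
    IsTestOn (𝒜.core i) (𝒜.piece i u) :=
  .of_isCompact (𝒜.isCompact_core i) (𝒜.contDiff_piece i u) (𝒜.tsupport_piece_subset i u)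

theorem SobolevAtlas.ofLocal_piece_apply (i : Fin 𝒜.size) (u : SmoothSection n F E) (x : X) :
    ((SmoothSection.ofLocal (𝒜.center i) (𝒜.piece i u) : SmoothSection n F E) : ∀ x, E x) x =
      (𝒜.weight i x : ℂ) • (u : ∀ x, E x) x := by
  have ht := (𝒜.isTestOn_piece i u).mono (𝒜.core_subset i)
  by_cases hx : x ∈ chartDomain n F E (𝒜.center i)
  · have hy := chart_mem_localDomain hx
    refine section_eq_of_localRep_eq (v := (𝒜.weight i x : ℂ) • (u : ∀ x, E x)) hx ?_
    rw [localRep_ofLocal ht hy, localRep_smul _ _ _ hy, SobolevAtlas.piece,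
      Set.indicator_of_mem hy, (chartAt _ (𝒜.center i)).left_inv hx.1, Complex.coe_smul]
  · rw [ofLocal_apply_of_notMem ht hx]
    have : 𝒜.weight i x = 0 := image_eq_zero_of_notMem_tsupport fun h =>
      hx (𝒜.tsupport_subset i h)
    rw [this, Complex.ofReal_zero, zero_smul]

/-- The weights sum to one. Through this decomposition estimates for sections reduce to estimates
for functions in charts. -/
theorem SobolevAtlas.sum_ofLocal_piece (u : SmoothSection n F E) :
    ∑ i, SmoothSection.ofLocal (𝒜.center i) (𝒜.piece i u) = u := by
  ext x
  have h : ((∑ i, SmoothSection.ofLocal (𝒜.center i) (𝒜.piece i u) :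
      SmoothSection n F E) : ∀ x, E x) x = ∑ i, (𝒜.weight i x : ℂ) • (u : ∀ x, E x) x := by
    rw [Submodule.coe_sum, Finset.sum_apply]
    exact Finset.sum_congr rfl fun i _ => 𝒜.ofLocal_piece_apply i u x
  rw [h, ← Finset.sum_smul, ← Complex.ofReal_sum, 𝒜.sum_weight, Complex.ofReal_one, one_smul]

end LocalSections

/-! ### Integration in a chart -/

section ChartIntegral

variable (n : ℕ) {X : Type*} [TopologicalSpace X] [ChartedSpace (EuclideanSpace ℝ (Fin n)) X]
  [MeasurableSpace X] (μ : Measure X) [IsSmoothDensity n μ]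

/-- The density of `μ` in the preferred chart at `x₀`. -/
def chartDensity (x₀ : X) : EuclideanSpace ℝ (Fin n) → ℝ :=
  Classical.choose (IsSmoothDensity.exists_density (n := n) (μ := μ) x₀)

theorem contDiffOn_chartDensity (x₀ : X) :
    ContDiffOn ℝ ∞ (chartDensity n μ x₀) (chartAt (EuclideanSpace ℝ (Fin n)) x₀).target :=
  (Classical.choose_spec (IsSmoothDensity.exists_density (n := n) (μ := μ) x₀)).1

theorem chartDensity_pos {x₀ : X} {y : EuclideanSpace ℝ (Fin n)}
    (hy : y ∈ (chartAt (EuclideanSpace ℝ (Fin n)) x₀).target) : 0 < chartDensity n μ x₀ y :=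
  (Classical.choose_spec (IsSmoothDensity.exists_density (n := n) (μ := μ) x₀)).2.1 y hy

theorem map_chart_eq (x₀ : X) :
    (μ.restrict (chartAt (EuclideanSpace ℝ (Fin n)) x₀).source).map
        (chartAt (EuclideanSpace ℝ (Fin n)) x₀) =
      (volume.restrict (chartAt (EuclideanSpace ℝ (Fin n)) x₀).target).withDensity
        (fun y => ENNReal.ofReal (chartDensity n μ x₀ y)) :=
  (Classical.choose_spec (IsSmoothDensity.exists_density (n := n) (μ := μ) x₀)).2.2

variable {n} [BorelSpace X]

theorem measurableSet_chart_preimage (x₀ : X) {K : Set (EuclideanSpace ℝ (Fin n))}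
    (hK : IsCompact K) :
    MeasurableSet ((chartAt (EuclideanSpace ℝ (Fin n)) x₀).source ∩
      chartAt (EuclideanSpace ℝ (Fin n)) x₀ ⁻¹' K) := by
  set φ := chartAt (EuclideanSpace ℝ (Fin n)) x₀
  have h := φ.isOpen_inter_preimage hK.isClosed.isOpen_compl
  have e : φ.source ∩ φ ⁻¹' K = φ.source \ (φ.source ∩ φ ⁻¹' Kᶜ) := by
    ext x
    simp only [Set.mem_inter_iff, Set.mem_preimage, Set.mem_sdiff, Set.mem_compl_iff]
    tauto
  rw [e]
  exact φ.open_source.measurableSet.diff h.measurableSet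

/-- Change of variables: the measure is pushed forward by the chart, where it has a density with
respect to Lebesgue measure. Compactness of `K` inside the target makes the density measurable on
the region of integration. -/
theorem setIntegral_chart {W : Type*} [NormedAddCommGroup W] [NormedSpace ℝ W]
    [SecondCountableTopology W] (x₀ : X)
    {K : Set (EuclideanSpace ℝ (Fin n))} (hK : IsCompact K)
    (hKt : K ⊆ (chartAt (EuclideanSpace ℝ (Fin n)) x₀).target) {f : X → W} (hf : Continuous f) :
    ∫ x in (chartAt (EuclideanSpace ℝ (Fin n)) x₀).source ∩
        chartAt (EuclideanSpace ℝ (Fin n)) x₀ ⁻¹' K, f x ∂μ =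
      ∫ y in K, chartDensity n μ x₀ y • f ((chartAt (EuclideanSpace ℝ (Fin n)) x₀).symm y) := by
  set φ := chartAt (EuclideanSpace ℝ (Fin n)) x₀ with hφ
  have hKm := hK.isClosed.measurableSet
  have hm : AEMeasurable φ (μ.restrict φ.source) :=
    φ.continuousOn.aemeasurable φ.open_source.measurableSet
  -- The inverse chart is continuous only on the target, which suffices because the pushforward is
  -- absolutely continuous with respect to Lebesgue measure restricted to the target.
  have hmf : AEStronglyMeasurable (fun y => f (φ.symm y))
      ((μ.restrict φ.source).map φ) := by
    rw [map_chart_eq]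
    refine AEStronglyMeasurable.mono_ac (withDensity_absolutelyContinuous _ _) ?_
    exact (hf.comp_continuousOn φ.continuousOn_symm).aestronglyMeasurable
      φ.open_target.measurableSet
  have hρ : AEMeasurable (fun y => ENNReal.ofReal (chartDensity n μ x₀ y))
      ((volume.restrict φ.target).restrict K) := by
    rw [Measure.restrict_restrict hKm, Set.inter_eq_left.2 hKt]
    exact (((contDiffOn_chartDensity n μ x₀).continuousOn.mono hKt).aemeasurable
      hKm).ennreal_ofReal
  calc ∫ x in φ.source ∩ φ ⁻¹' K, f x ∂μ
      = ∫ x in φ.source ∩ φ ⁻¹' K, f (φ.symm (φ x)) ∂μ := by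
        refine setIntegral_congr_fun (measurableSet_chart_preimage x₀ hK) fun x hx => ?_
        rw [φ.left_inv hx.1]
    _ = ∫ x in φ ⁻¹' K, f (φ.symm (φ x)) ∂(μ.restrict φ.source) := by
        rw [Measure.restrict_restrict' φ.open_source.measurableSet, Set.inter_comm]
    _ = ∫ y in K, f (φ.symm y) ∂((μ.restrict φ.source).map φ) :=
        (setIntegral_map hKm hmf hm).symm
    _ = ∫ y in K, (ENNReal.ofReal (chartDensity n μ x₀ y)).toReal • f (φ.symm y)
          ∂(volume.restrict φ.target) := by
        rw [map_chart_eq]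
        exact setIntegral_withDensity_eq_setIntegral_toReal_smul₀ hρ
          (Filter.Eventually.of_forall fun _ => ENNReal.ofReal_lt_top) _ hKm
    _ = _ := by
        rw [Measure.restrict_restrict hKm, Set.inter_eq_left.2 hKt]
        refine setIntegral_congr_fun hKm fun y hy => ?_
        simp only [ENNReal.toReal_ofReal (chartDensity_pos n μ (hKt hy)).le]

/-- The integral of a function which vanishes outside of a compact subset of a chart. -/
theorem integral_chart {W : Type*} [NormedAddCommGroup W] [NormedSpace ℝ W]
    [SecondCountableTopology W] (x₀ : X)
    {K : Set (EuclideanSpace ℝ (Fin n))} (hK : IsCompact K)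
    (hKt : K ⊆ (chartAt (EuclideanSpace ℝ (Fin n)) x₀).target) {f : X → W} (hf : Continuous f)
    (h0 : ∀ x, ¬ (x ∈ (chartAt (EuclideanSpace ℝ (Fin n)) x₀).source ∧
      chartAt (EuclideanSpace ℝ (Fin n)) x₀ x ∈ K) → f x = 0) :
    ∫ x, f x ∂μ =
      ∫ y in K, chartDensity n μ x₀ y • f ((chartAt (EuclideanSpace ℝ (Fin n)) x₀).symm y) := by
  rw [← setIntegral_chart μ x₀ hK hKt hf]
  exact (setIntegral_eq_integral_of_forall_compl_eq_zero h0).symm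

end ChartIntegral

/-! ### Hermitian metrics in local coordinates -/

section LocalForm

variable {n : ℕ} {X : Type*} [TopologicalSpace X] [ChartedSpace (EuclideanSpace ℝ (Fin n)) X]
  {F : Type*} [NormedAddCommGroup F] [NormedSpace ℂ F]
  {E : X → Type*} [TopologicalSpace (TotalSpace F E)] [∀ x, TopologicalSpace (E x)]
  [∀ x, AddCommGroup (E x)] [∀ x, Module ℂ (E x)] [FiberBundle F E]
  [VectorBundle ℝ F E] [VectorBundle ℂ F E] (h : HermitianMetric n F E)

/-- A Hermitian metric in the preferred chart and trivialization at `x₀`. -/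
def HermitianMetric.localForm (x₀ : X) (y : EuclideanSpace ℝ (Fin n)) : F →ₗ⋆[ℂ] F →ₗ[ℂ] ℂ :=
  LinearMap.mk₂'ₛₗ (starRingEnd ℂ) (RingHom.id ℂ)
    (fun v w => h.form ((chartAt (EuclideanSpace ℝ (Fin n)) x₀).symm y)
      ((trivializationAt F E x₀).symmₗ ℂ ((chartAt (EuclideanSpace ℝ (Fin n)) x₀).symm y) v)
      ((trivializationAt F E x₀).symmₗ ℂ ((chartAt (EuclideanSpace ℝ (Fin n)) x₀).symm y) w))
    (fun v v' w => by simp only [map_add, LinearMap.add_apply])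
    (fun c v w => by simp only [map_smul, LinearMap.map_smulₛₗ₂])
    (fun v w w' => by simp only [map_add])
    (fun c v w => by simp only [map_smul, RingHom.id_apply])

theorem HermitianMetric.localForm_apply (x₀ : X) (y : EuclideanSpace ℝ (Fin n)) (v w : F) :
    h.localForm x₀ y v w = h.form ((chartAt (EuclideanSpace ℝ (Fin n)) x₀).symm y)
      ((trivializationAt F E x₀).symmₗ ℂ ((chartAt (EuclideanSpace ℝ (Fin n)) x₀).symm y) v)
      ((trivializationAt F E x₀).symmₗ ℂ ((chartAt (EuclideanSpace ℝ (Fin n)) x₀).symm y) w) :=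
  rfl

theorem HermitianMetric.localForm_localRep (x₀ : X) {y : EuclideanSpace ℝ (Fin n)}
    (hy : y ∈ localDomain n F E x₀) (u v : ∀ x, E x) :
    h.localForm x₀ y (localRep n F E x₀ u y) (localRep n F E x₀ v y) =
      h.form ((chartAt (EuclideanSpace ℝ (Fin n)) x₀).symm y)
        (u ((chartAt (EuclideanSpace ℝ (Fin n)) x₀).symm y))
        (v ((chartAt (EuclideanSpace ℝ (Fin n)) x₀).symm y)) := by
  rw [h.localForm_apply,
    (trivializationAt F E x₀).coe_symmₗ hy.2, localRep, localRep,
    (trivializationAt F E x₀).symm_apply_apply_mk hy.2,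
    (trivializationAt F E x₀).symm_apply_apply_mk hy.2]

theorem HermitianMetric.localForm_pos (x₀ : X) {y : EuclideanSpace ℝ (Fin n)}
    (hy : y ∈ localDomain n F E x₀) {v : F} (hv : v ≠ 0) : 0 < (h.localForm x₀ y v v).re := by
  rw [h.localForm_apply]
  refine h.pos _ _ fun h0 => hv ?_
  rw [(trivializationAt F E x₀).coe_symmₗ hy.2] at h0
  have h1 := (trivializationAt F E x₀).apply_mk_symm hy.2 v
  rw [h0] at h1
  have h2 := ((trivializationAt F E x₀).linear ℂ hy.2).map_zero
  rw [h1] at h2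
  exact h2

theorem HermitianMetric.localForm_conj (x₀ : X) (y : EuclideanSpace ℝ (Fin n)) (v w : F) :
    starRingEnd ℂ (h.localForm x₀ y v w) = h.localForm x₀ y w v :=
  h.conj_symm _ _ _

variable [FiniteDimensional ℂ F]

variable (F) in
/-- The coordinates of a vector of `F` with respect to a fixed basis. -/
def fiberCoord (k : Fin (Module.finrank ℂ F)) : F →L[ℂ] ℂ :=
  LinearMap.toContinuousLinearMap ((Module.finBasis ℂ F).coord k)

theorem sum_fiberCoord (v : F) : ∑ k, fiberCoord F k v • Module.finBasis ℂ F k = v :=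
  (Module.finBasis ℂ F).sum_repr v

theorem fiberCoord_basis (k l : Fin (Module.finrank ℂ F)) :
    fiberCoord F k (Module.finBasis ℂ F l) = if k = l then 1 else 0 := by
  change (Module.finBasis ℂ F).repr (Module.finBasis ℂ F l) k = _
  rw [Module.Basis.repr_self, Finsupp.single_apply]
  simp [eq_comm]

/-- The Gram matrix of a Hermitian metric in local coordinates. -/
def HermitianMetric.gram (x₀ : X) (y : EuclideanSpace ℝ (Fin n)) :
    Matrix (Fin (Module.finrank ℂ F)) (Fin (Module.finrank ℂ F)) ℂ :=
  Matrix.of fun k l => h.localForm x₀ y (Module.finBasis ℂ F k) (Module.finBasis ℂ F l)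

theorem HermitianMetric.localForm_eq_sum (x₀ : X) (y : EuclideanSpace ℝ (Fin n)) (v w : F) :
    h.localForm x₀ y v w =
      ∑ k, ∑ l, starRingEnd ℂ (fiberCoord F k v) * fiberCoord F l w * h.gram x₀ y k l := by
  conv_lhs => rw [← sum_fiberCoord v, ← sum_fiberCoord w]
  simp only [map_sum, LinearMap.sum_apply, LinearMap.map_smulₛₗ₂, map_smul, smul_eq_mul,
    HermitianMetric.gram, Matrix.of_apply, Finset.mul_sum, mul_assoc]
  rw [Finset.sum_comm]
  exact Finset.sum_congr rfl fun k _ => Finset.sum_congr rfl fun l _ => by ring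

variable [T2Space X] [IsManifold (𝓡 n) ∞ X] [ContMDiffVectorBundle ∞ F E (𝓡 n)]

theorem exists_test_eq_one {U K : Set (EuclideanSpace ℝ (Fin n))} (hU : IsOpen U)
    (hK : IsCompact K) (hKU : K ⊆ U) :
    ∃ θ : EuclideanSpace ℝ (Fin n) → ℝ, IsTestOn U θ ∧ ∀ᶠ y in nhdsSet K, θ y = 1 := by
  obtain ⟨L, hL, hKL, hLU⟩ := exists_compact_between hK hU hKU
  obtain ⟨f, h1, h0, -⟩ := exists_contMDiffMap_one_nhds_of_subset_interior (n := (⊤ : ℕ∞))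
    𝓘(ℝ, EuclideanSpace ℝ (Fin n)) hK.isClosed hKL
  have hs : tsupport f ⊆ L :=
    closure_minimal (fun y hy => by_contra fun hn => hy (h0 y hn)) hL.isClosed
  exact ⟨f, ⟨f.contMDiff.contDiff, hL.of_isClosed_subset (isClosed_tsupport _) hs,
    hs.trans hLU⟩, h1⟩

/-- Smoothness of the metric is known only for pairs of global smooth sections. The constant basis
vectors are therefore cut off by a function equal to one near `y` and extended to global sections.
-/
theorem HermitianMetric.contDiffOn_gram (x₀ : X) (k l : Fin (Module.finrank ℂ F)) :
    ContDiffOn ℝ ∞ (fun y => h.gram x₀ y k l) (localDomain n F E x₀) := by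
  intro y hy
  have hU := isOpen_localDomain (n := n) (F := F) (E := E) x₀
  obtain ⟨θ, hθ, hθ1⟩ := exists_test_eq_one hU isCompact_singleton (Set.singleton_subset_iff.2 hy)
  rw [nhdsSet_singleton] at hθ1
  have ht : ∀ k, IsTestOn (localDomain n F E x₀) fun y => θ y • Module.finBasis ℂ F k := fun k =>
    ⟨hθ.contDiff.smul contDiff_const, hθ.hasCompactSupport.smul_right,
      (tsupport_smul_subset_left _ _).trans hθ.tsupport_subset⟩
  let S : Fin (Module.finrank ℂ F) → SmoothSection n F E := fun k =>
    SmoothSection.ofLocal x₀ fun y => θ y • Module.finBasis ℂ F k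
  have h1 : ContDiffOn ℝ ∞ (fun z => h.form ((chartAt (EuclideanSpace ℝ (Fin n)) x₀).symm z)
      ((S k : ∀ x, E x) ((chartAt (EuclideanSpace ℝ (Fin n)) x₀).symm z))
      ((S l : ∀ x, E x) ((chartAt (EuclideanSpace ℝ (Fin n)) x₀).symm z)))
      (chartAt (EuclideanSpace ℝ (Fin n)) x₀).target := by
    rw [← contMDiffOn_iff_contDiffOn]
    exact (h.smooth (S k) (S l)).comp_contMDiffOn (contMDiffOn_chart_symm (I := 𝓡 n) (x := x₀))
  refine ((h1.contDiffAt ((chartAt _ x₀).open_target.mem_nhds hy.1)).congr_of_eventuallyEq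
    ?_).contDiffWithinAt
  filter_upwards [hθ1, hU.mem_nhds hy] with z hz hzU
  rw [← h.localForm_localRep x₀ hzU, localRep_ofLocal (ht k) hzU, localRep_ofLocal (ht l) hzU,
    hz, one_smul, one_smul]
  rfl

theorem HermitianMetric.contDiffOn_localForm {x₀ : X} {U : Set (EuclideanSpace ℝ (Fin n))}
    (hU : U ⊆ localDomain n F E x₀)
    {f g : EuclideanSpace ℝ (Fin n) → F} (hf : ContDiffOn ℝ ∞ f U) (hg : ContDiffOn ℝ ∞ g U) :
    ContDiffOn ℝ ∞ (fun y => h.localForm x₀ y (f y) (g y)) U := by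
  simp only [h.localForm_eq_sum]
  have hc : ∀ k, ContDiff ℝ ∞ (fiberCoord F k) := fun k =>
    ((fiberCoord F k).restrictScalars ℝ).contDiff
  refine ContDiffOn.sum fun k _ => ContDiffOn.sum fun l _ => ContDiffOn.mul (ContDiffOn.mul ?_ ?_)
    ((h.contDiffOn_gram x₀ k l).mono hU)
  · exact Complex.conjCLE.contDiff.comp_contDiffOn ((hc k).comp_contDiffOn hf)
  · exact (hc l).comp_contDiffOn hg

theorem HermitianMetric.continuousOn_localForm_prod (x₀ : X) :
    ContinuousOn (fun p : EuclideanSpace ℝ (Fin n) × F => h.localForm x₀ p.1 p.2 p.2)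
      (localDomain n F E x₀ ×ˢ Set.univ) := by
  simp only [h.localForm_eq_sum]
  refine continuousOn_finsetSum _ fun k _ => continuousOn_finsetSum _ fun l _ =>
    ContinuousOn.mul (Continuous.continuousOn ?_)
      ((h.contDiffOn_gram x₀ k l).continuousOn.comp continuousOn_fst fun p hp => hp.1)
  exact (Complex.continuous_conj.comp ((fiberCoord F k).continuous.comp continuous_snd)).mul
    ((fiberCoord F l).continuous.comp continuous_snd)

theorem HermitianMetric.localForm_real_smul (x₀ : X) (y : EuclideanSpace ℝ (Fin n)) (r : ℝ)
    (v : F) : (h.localForm x₀ y ((r : ℂ) • v) ((r : ℂ) • v)).re =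
      r ^ 2 * (h.localForm x₀ y v v).re := by
  rw [LinearMap.map_smulₛₗ₂, map_smul, Complex.conj_ofReal, smul_smul, smul_eq_mul,
    ← Complex.ofReal_mul, Complex.re_ofReal_mul, sq]

/-- On compact sets a Hermitian metric is comparable with the norm of the model fiber. -/
theorem HermitianMetric.exists_localForm_bounds (x₀ : X) {ρ : EuclideanSpace ℝ (Fin n) → ℝ} {K : Set (EuclideanSpace ℝ (Fin n))}
    (hK : IsCompact K) (hKU : K ⊆ localDomain n F E x₀) (hρ : ContinuousOn ρ K)
    (hρ0 : ∀ y ∈ K, 0 < ρ y) :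
    ∃ c C, 0 < c ∧ 0 ≤ C ∧ ∀ y ∈ K, ∀ v : F,
      c * ‖v‖ ^ 2 ≤ ρ y * (h.localForm x₀ y v v).re ∧
        ρ y * (h.localForm x₀ y v v).re ≤ C * ‖v‖ ^ 2 := by
  have : ProperSpace F := FiniteDimensional.proper ℂ F
  have hS : IsCompact (K ×ˢ Metric.sphere (0 : F) 1) := hK.prod (isCompact_sphere _ _)
  have hcont : ContinuousOn (fun p : EuclideanSpace ℝ (Fin n) × F =>
      ρ p.1 * (h.localForm x₀ p.1 p.2 p.2).re) (K ×ˢ Metric.sphere (0 : F) 1) :=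
    (hρ.comp continuousOn_fst fun p hp => hp.1).mul (Complex.continuous_re.comp_continuousOn
      ((h.continuousOn_localForm_prod x₀).mono (Set.prod_mono hKU (Set.subset_univ _))))
  -- The weighted quadratic form is continuous and positive on the compact product of `K` with the
  -- unit sphere. It is homogeneous of degree two, so bounds there suffice.
  obtain ⟨c, hc0, hc⟩ := hS.exists_forall_le' hcont (a := 0) fun p hp =>
    mul_pos (hρ0 _ hp.1) (h.localForm_pos x₀ (hKU hp.1)
      (ne_zero_of_mem_unit_sphere ⟨p.2, hp.2⟩))
  obtain ⟨C, hC⟩ := hS.exists_bound_of_continuousOn hcont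
  refine ⟨c, max C 0, hc0, le_max_right _ _, fun y hy v => ?_⟩
  by_cases hv : v = 0
  · simp [hv]
  have hn : 0 < ‖v‖ := norm_pos_iff.2 hv
  set w : F := ((‖v‖⁻¹ : ℝ) : ℂ) • v with hw
  have hw1 : (y, w) ∈ K ×ˢ Metric.sphere (0 : F) 1 := by
    refine ⟨hy, ?_⟩
    rw [mem_sphere_zero_iff_norm, hw, norm_smul, Complex.norm_real, norm_inv, norm_norm,
      inv_mul_cancel₀ hn.ne']
  have hvw : v = ((‖v‖ : ℝ) : ℂ) • w := by
    rw [hw, smul_smul, ← Complex.ofReal_mul, mul_inv_cancel₀ hn.ne', Complex.ofReal_one, one_smul]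
  have e : ρ y * (h.localForm x₀ y v v).re = ‖v‖ ^ 2 * (ρ y * (h.localForm x₀ y w w).re) := by
    conv_lhs => rw [hvw, h.localForm_real_smul]
    ring
  have h1 := hc _ hw1
  have h2 := ((le_abs_self _).trans (hC _ hw1)).trans (le_max_left C 0)
  rw [e]
  constructor
  · rw [mul_comm]
    exact mul_le_mul_of_nonneg_left h1 (by positivity)
  · rw [mul_comm (max C 0)]
    exact mul_le_mul_of_nonneg_left h2 (by positivity)

end LocalForm

/-! ### Square integrability of test functions and symmetry of mollification -/

theorem IsTestOn.integrable_norm_sq {n : ℕ} {W : Type*} [NormedAddCommGroup W] [NormedSpace ℝ W]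
    {U : Set (EuclideanSpace ℝ (Fin n))} {g : EuclideanSpace ℝ (Fin n) → W} (hg : IsTestOn U g) :
    Integrable fun y => ‖g y‖ ^ 2 :=
  (memLp_two_iff_integrable_sq_norm hg.memLp.1).1 hg.memLp

/-- Mollification by an even kernel is symmetric. -/
theorem IsMollifier.integral_apply_mollify {n : ℕ} {F : Type*} [NormedAddCommGroup F]
    [NormedSpace ℂ F] [CompleteSpace F] {C δ : ℝ} {m : EuclideanSpace ℝ (Fin n) → ℝ}
    (hm : IsMollifier C δ m)
    {U V : Set (EuclideanSpace ℝ (Fin n))} {Λ : EuclideanSpace ℝ (Fin n) → (F →L[ℂ] ℂ)}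
    {g : EuclideanSpace ℝ (Fin n) → F} (hΛ : IsTestOn U Λ) (hg : IsTestOn V g) :
    ∫ y, Λ y (mollify m g y) = ∫ z, mollify m Λ z (g z) := by
  have hcont : Continuous (Function.uncurry fun y z => m (y - z) • Λ y (g z)) :=
    (hm.contDiff.continuous.comp (continuous_fst.sub continuous_snd)).smul
      ((hΛ.contDiff.continuous.comp continuous_fst).clm_apply
        (hg.contDiff.continuous.comp continuous_snd))
  have hsupp : HasCompactSupport (Function.uncurry fun y z => m (y - z) • Λ y (g z)) := by
    refine HasCompactSupport.intro (hΛ.hasCompactSupport.isCompact.prod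
      hg.hasCompactSupport.isCompact) fun p hp => ?_
    change m (p.1 - p.2) • Λ p.1 (g p.2) = 0
    by_cases h1 : p.1 ∈ tsupport Λ
    · rw [image_eq_zero_of_notMem_tsupport (f := g) fun h2 => hp ⟨h1, h2⟩, map_zero, smul_zero]
    · rw [image_eq_zero_of_notMem_tsupport h1, zero_apply, smul_zero]
  calc ∫ y, Λ y (mollify m g y) = ∫ y, ∫ z, m (y - z) • Λ y (g z) := by
        refine integral_congr_ae (Filter.Eventually.of_forall fun y => ?_)
        change Λ y (∫ z, m (y - z) • g z) = _
        rw [← ContinuousLinearMap.integral_comp_comm (Λ y)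
          (integrable_kernel hm.contDiff.continuous
            hg.contDiff.continuous hg.hasCompactSupport y)]
        refine integral_congr_ae (Filter.Eventually.of_forall fun z => ?_)
        exact ((Λ y).restrictScalars ℝ).map_smul _ _
    _ = ∫ z, ∫ y, m (y - z) • Λ y (g z) :=
        integral_integral_swap_of_hasCompactSupport hcont hsupp
    _ = ∫ z, mollify m Λ z (g z) := by
        refine integral_congr_ae (Filter.Eventually.of_forall fun z => ?_)
        change _ = (∫ y, m (z - y) • Λ y) (g z)
        rw [ContinuousLinearMap.integral_apply
          (integrable_kernel hm.contDiff.continuous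
            hΛ.contDiff.continuous hΛ.hasCompactSupport z)]
        refine integral_congr_ae (Filter.Eventually.of_forall fun y => ?_)
        change m (y - z) • Λ y (g z) = (m (z - y) • Λ y) (g z)
        -- After Fubini the roles of `y` and `z` in the kernel are interchanged; evenness restores
        -- the kernel.
        rw [← hm.even, neg_sub]
        rfl

/-! ### The `L²` norm of sections -/

section SectionNorm

variable {n : ℕ} {X : Type*} [TopologicalSpace X] [ChartedSpace (EuclideanSpace ℝ (Fin n)) X]
  [CompactSpace X] [MeasurableSpace X] [BorelSpace X]
  {F : Type*} [NormedAddCommGroup F] [NormedSpace ℂ F]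
  {E : X → Type*} [TopologicalSpace (TotalSpace F E)] [∀ x, TopologicalSpace (E x)]
  [∀ x, AddCommGroup (E x)] [∀ x, Module ℂ (E x)] [FiberBundle F E]
  [VectorBundle ℝ F E] [VectorBundle ℂ F E]
  (h : HermitianMetric n F E) (μ : Measure X) [IsSmoothDensity n μ]

/-- The `L²` norm of a smooth section. -/
def sectionNorm (u : SmoothSection n F E) : ℝ := ‖(show L2SmoothSection h μ from u)‖

theorem sectionNorm_nonneg (u : SmoothSection n F E) : 0 ≤ sectionNorm h μ u := norm_nonneg _

theorem sectionNorm_sq (u : SmoothSection n F E) :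
    sectionNorm h μ u ^ 2 = (l2Inner h μ u u).re :=
  (@inner_self_eq_norm_sq ℂ (L2SmoothSection h μ) _ _ _ u).symm

theorem sectionNorm_sub_le (u v : SmoothSection n F E) :
    sectionNorm h μ (u - v) ≤ sectionNorm h μ u + sectionNorm h μ v :=
  norm_sub_le (show L2SmoothSection h μ from u) v

theorem sectionNorm_sum_le {ι : Type*} (s : Finset ι) (u : ι → SmoothSection n F E) :
    sectionNorm h μ (∑ i ∈ s, u i) ≤ ∑ i ∈ s, sectionNorm h μ (u i) :=
  norm_sum_le s (fun i => (show L2SmoothSection h μ from u i))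

theorem integrable_form_re (u v : SmoothSection n F E) :
    Integrable (fun x => (h.form x ((u : ∀ x, E x) x) ((v : ∀ x, E x) x)).re) μ :=
  (integrable_form h μ u v).re

theorem sectionNorm_sq_eq_integral (u : SmoothSection n F E) :
    sectionNorm h μ u ^ 2 = ∫ x, (h.form x ((u : ∀ x, E x) x) ((u : ∀ x, E x) x)).re ∂μ := by
  rw [sectionNorm_sq]
  exact (integral_re (𝕜 := ℂ) (integrable_form h μ u u)).symm

theorem HermitianMetric.form_self_nonneg (x : X) (v : E x) : 0 ≤ (h.form x v v).re := by
  by_cases hv : v = 0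
  · simp [hv]
  · exact (h.pos x v hv).le

theorem l2Inner_conj (u v : SmoothSection n F E) :
    starRingEnd ℂ (l2Inner h μ u v) = l2Inner h μ v u := by
  unfold l2Inner
  rw [← integral_conj]
  simp_rw [h.conj_symm]

variable [T2Space X] [FiniteDimensional ℂ F]
  [IsManifold (𝓡 n) ∞ X] [ContMDiffVectorBundle ∞ F E (𝓡 n)]

/-- The `L²` inner product with a section supported in one chart. -/
theorem l2Inner_ofLocal {x₀ : X} {K : Set (EuclideanSpace ℝ (Fin n))} (hK : IsCompact K)
    (hKU : K ⊆ localDomain n F E x₀) {g : EuclideanSpace ℝ (Fin n) → F} (hg : IsTestOn K g)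
    (φ : SmoothSection n F E) :
    l2Inner h μ φ (SmoothSection.ofLocal x₀ g) =
      ∫ y in K, (chartDensity n μ x₀ y : ℂ) *
        h.localForm x₀ y (localRep n F E x₀ φ y) (g y) := by
  have hgU := hg.mono hKU
  unfold l2Inner
  rw [integral_chart μ x₀ hK (hKU.trans Set.inter_subset_left)
    (h.smooth φ (SmoothSection.ofLocal x₀ g)).continuous]
  · refine setIntegral_congr_fun hK.isClosed.measurableSet fun y hy => ?_
    simp only [Complex.real_smul]
    rw [← h.localForm_localRep x₀ (hKU hy), localRep_ofLocal hgU (hKU hy)]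
  · intro x hx
    have : ((SmoothSection.ofLocal x₀ g : SmoothSection n F E) : ∀ x, E x) x = 0 := by
      rw [coe_ofLocal hgU]
      exact rawOfLocal_eq_zero fun hd => hg.eq_zero fun hm => hx ⟨hd.1, hm⟩
    rw [this, map_zero]

/-- On `K` the metric times the density is at most a constant times the squared norm of the model
fiber. -/
theorem exists_sectionNorm_ofLocal_le {x₀ : X} {K : Set (EuclideanSpace ℝ (Fin n))}
    (hK : IsCompact K) (hKU : K ⊆ localDomain n F E x₀) :
    ∃ C, 0 ≤ C ∧ ∀ g, IsTestOn K g →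
      sectionNorm h μ (SmoothSection.ofLocal x₀ g) ≤ C * l2 g := by
  obtain ⟨c, C, -, hC, hb⟩ := h.exists_localForm_bounds x₀ hK hKU
    ((contDiffOn_chartDensity n μ x₀).continuousOn.mono (hKU.trans Set.inter_subset_left))
    fun y hy => chartDensity_pos n μ (hKU hy).1
  refine ⟨√C, Real.sqrt_nonneg _, fun g hg => ?_⟩
  refine le_of_sq_le_sq ?_ (by have := l2_nonneg g; positivity)
  rw [mul_pow, Real.sq_sqrt hC, l2_sq hg.memLp, sectionNorm_sq, l2Inner_ofLocal h μ hK hKU hg,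
    ← integral_const_mul]
  have hcont : ContinuousOn (fun y => (chartDensity n μ x₀ y : ℂ) * h.localForm x₀ y (g y) (g y))
      K :=
    (Complex.continuous_ofReal.comp_continuousOn
      ((contDiffOn_chartDensity n μ x₀).continuousOn.mono
        (hKU.trans Set.inter_subset_left))).mul
      (((h.contDiffOn_localForm subset_rfl hg.contDiff.contDiffOn
        hg.contDiff.contDiffOn).continuousOn).mono hKU)
  have hi : IntegrableOn (fun y => (chartDensity n μ x₀ y : ℂ) * h.localForm x₀ y (g y) (g y)) K :=
    hcont.integrableOn_compact hK
  have hi2 : Integrable fun y => C * ‖g y‖ ^ 2 := hg.integrable_norm_sq.const_mul C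
  have e : ∫ y in K, (chartDensity n μ x₀ y : ℂ) * h.localForm x₀ y
      (localRep n F E x₀ (SmoothSection.ofLocal x₀ g : SmoothSection n F E) y) (g y) =
      ∫ y in K, (chartDensity n μ x₀ y : ℂ) * h.localForm x₀ y (g y) (g y) :=
    setIntegral_congr_fun hK.isClosed.measurableSet fun y hy => by
      simp only [localRep_ofLocal (hg.mono hKU) (hKU hy)]
  rw [e]
  calc _ = ∫ y in K, ((chartDensity n μ x₀ y : ℂ) * h.localForm x₀ y (g y) (g y)).re :=
        (integral_re (𝕜 := ℂ) hi).symm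
    _ ≤ ∫ y in K, C * ‖g y‖ ^ 2 := by
        refine setIntegral_mono_on hi.re hi2.integrableOn hK.isClosed.measurableSet
          fun y hy => ?_
        rw [Complex.re_ofReal_mul]
        exact (hb y hy (g y)).2
    _ ≤ _ := setIntegral_le_integral hi2 (Filter.Eventually.of_forall fun y => by positivity)

/-- The local representation is smooth only on the local domain; the compact support of `T` inside
it removes its meaningless values. -/
theorem IsTestOn.apply_localRep {x₀ : X} {W : Type*} [NormedAddCommGroup W] [NormedSpace ℂ W]
    {K : Set (EuclideanSpace ℝ (Fin n))} (hKU : K ⊆ localDomain n F E x₀)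
    {T : EuclideanSpace ℝ (Fin n) → (F →L[ℂ] W)} (hT : IsTestOn K T) (u : SmoothSection n F E) :
    IsTestOn K fun y => T y (localRep n F E x₀ u y) := by
  have h0 : ∀ y ∉ tsupport T, T y (localRep n F E x₀ u y) = 0 := fun y hy => by
    rw [image_eq_zero_of_notMem_tsupport hy, zero_apply]
  have hs : tsupport (fun y => T y (localRep n F E x₀ u y)) ⊆ tsupport T :=
    closure_minimal (fun y hy => by_contra fun hn => hy (h0 y hn)) (isClosed_tsupport _)
  refine ⟨contDiff_of_tsupport_subset (isOpen_localDomain (n := n) (F := F) (E := E) x₀) ?_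
    ((hs.trans hT.tsupport_subset).trans hKU),
    hT.hasCompactSupport.isCompact.of_isClosed_subset (isClosed_tsupport _) hs,
    hs.trans hT.tsupport_subset⟩
  exact hT.contDiff.contDiffOn.clm_apply_complex (contDiffOn_localRep x₀ u)

/-- Converse comparison of norms, localized by `T`. It covers both the pieces of a section and the
zeroth-order commutator terms. -/
theorem exists_l2_apply_localRep_le {x₀ : X} {W : Type*} [NormedAddCommGroup W] [NormedSpace ℂ W]
    {T : EuclideanSpace ℝ (Fin n) → (F →L[ℂ] W)} (hT : IsTestOn (localDomain n F E x₀) T) :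
    ∃ C, 0 ≤ C ∧ ∀ u : SmoothSection n F E,
      l2 (fun y => T y (localRep n F E x₀ u y)) ≤ C * sectionNorm h μ u := by
  set K := tsupport T with hKdef
  have hK : IsCompact K := hT.hasCompactSupport.isCompact
  have hKU := hT.tsupport_subset
  have hKt : K ⊆ (chartAt (EuclideanSpace ℝ (Fin n)) x₀).target :=
    hKU.trans Set.inter_subset_left
  have hKm := hK.isClosed.measurableSet
  obtain ⟨c, _, hc, -, hb⟩ := h.exists_localForm_bounds x₀ hK hKU
    ((contDiffOn_chartDensity n μ x₀).continuousOn.mono hKt)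
    fun y hy => chartDensity_pos n μ (hKU hy).1
  obtain ⟨M, hM, hMb⟩ := exists_bound_of_isCompact hK hT.contDiff.continuous.continuousOn
  -- On `K`, `‖T v‖² ≤ M² ‖v‖²`, and `c ‖v‖²` is at most the density times the metric.
  refine ⟨√(M ^ 2 / c), Real.sqrt_nonneg _, fun u => ?_⟩
  refine le_of_sq_le_sq ?_ (by have := sectionNorm_nonneg h μ u; positivity)
  have ht := hT.apply_localRep subset_rfl u
  rw [mul_pow, Real.sq_sqrt (by positivity), l2_sq ht.memLp, sectionNorm_sq_eq_integral,
    ← integral_const_mul]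
  have hform := (h.smooth u u).continuous
  have hre : Continuous fun x => (h.form x ((u : ∀ x, E x) x) ((u : ∀ x, E x) x)).re :=
    Complex.continuous_re.comp hform
  have hcont : ContinuousOn (fun y => chartDensity n μ x₀ y *
      (h.form ((chartAt (EuclideanSpace ℝ (Fin n)) x₀).symm y)
        ((u : ∀ x, E x) ((chartAt (EuclideanSpace ℝ (Fin n)) x₀).symm y))
        ((u : ∀ x, E x) ((chartAt (EuclideanSpace ℝ (Fin n)) x₀).symm y))).re) K :=
    ((contDiffOn_chartDensity n μ x₀).continuousOn.mono hKt).mul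
      (hre.comp_continuousOn ((chartAt _ x₀).continuousOn_symm.mono hKt))
  have hi1 : Integrable fun y => ‖T y (localRep n F E x₀ u y)‖ ^ 2 :=
    ht.integrable_norm_sq
  have hi2 := hcont.integrableOn_compact (μ := volume) hK
  calc ∫ y, ‖T y (localRep n F E x₀ u y)‖ ^ 2
      = ∫ y in K, ‖T y (localRep n F E x₀ u y)‖ ^ 2 := by
        refine (setIntegral_eq_integral_of_forall_compl_eq_zero fun y hy => ?_).symm
        rw [image_eq_zero_of_notMem_tsupport hy]
        simp
    _ ≤ ∫ y in K, M ^ 2 / c * (chartDensity n μ x₀ y *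
          (h.form ((chartAt (EuclideanSpace ℝ (Fin n)) x₀).symm y)
          ((u : ∀ x, E x) ((chartAt (EuclideanSpace ℝ (Fin n)) x₀).symm y))
          ((u : ∀ x, E x) ((chartAt (EuclideanSpace ℝ (Fin n)) x₀).symm y))).re) := by
        refine setIntegral_mono_on hi1.integrableOn (hi2.const_mul _) hKm fun y hy => ?_
        rw [← h.localForm_localRep x₀ (hKU hy)]
        have h1 := (hb y hy (localRep n F E x₀ u y)).1
        have h2 : ‖T y (localRep n F E x₀ u y)‖ ≤ M * ‖localRep n F E x₀ u y‖ :=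
          ((T y).le_opNorm _).trans (mul_le_mul_of_nonneg_right (hMb y hy) (norm_nonneg _))
        calc _ ≤ (M * ‖localRep n F E x₀ u y‖) ^ 2 := pow_le_pow_left₀ (norm_nonneg _) h2 2
          _ = M ^ 2 / c * (c * ‖localRep n F E x₀ u y‖ ^ 2) := by field_simp
          _ ≤ _ := mul_le_mul_of_nonneg_left h1 (by positivity)
    _ = M ^ 2 / c * ∫ x in (chartAt (EuclideanSpace ℝ (Fin n)) x₀).source ∩
          chartAt (EuclideanSpace ℝ (Fin n)) x₀ ⁻¹' K,
          (h.form x ((u : ∀ x, E x) x) ((u : ∀ x, E x) x)).re ∂μ := by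
        rw [integral_const_mul, setIntegral_chart μ x₀ hK hKt hre]
        rfl
    _ ≤ M ^ 2 / c * ∫ x, (h.form x ((u : ∀ x, E x) x) ((u : ∀ x, E x) x)).re ∂μ :=
        mul_le_mul_of_nonneg_left (setIntegral_le_integral (integrable_form_re h μ u u)
          (Filter.Eventually.of_forall fun x => h.form_self_nonneg x _)) (by positivity)
    _ = _ := (integral_const_mul _ _).symm

/-- The `L²` inner product with a smooth section is given by a smooth functional in a chart. -/
theorem exists_integral_eq_l2Inner_ofLocal {x₀ : X} {K : Set (EuclideanSpace ℝ (Fin n))}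
    (hK : IsCompact K) (hKU : K ⊆ localDomain n F E x₀) (φ : SmoothSection n F E) :
    ∃ Λ : EuclideanSpace ℝ (Fin n) → (F →L[ℂ] ℂ), IsTestOn (localDomain n F E x₀) Λ ∧
      ∀ g, IsTestOn K g → l2Inner h μ φ (SmoothSection.ofLocal x₀ g) = ∫ y, Λ y (g y) := by
  have hU := isOpen_localDomain (n := n) (F := F) (E := E) x₀
  obtain ⟨θ, hθ, hθ1⟩ := exists_test_eq_one hU hK hKU
  -- The functional `v ↦ ρ h(φ, v)`, written in fiber coordinates so that its smoothness follows
  -- from that of its coefficients. The factor `θ`, equal to one on `K`, gives it compact support.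
  let Λ₀ : EuclideanSpace ℝ (Fin n) → (F →L[ℂ] ℂ) := fun y => ∑ l,
    ((chartDensity n μ x₀ y : ℂ) *
      h.localForm x₀ y (localRep n F E x₀ φ y) (Module.finBasis ℂ F l)) • fiberCoord F l
  have hΛ₀ : ContDiffOn ℝ ∞ Λ₀ (localDomain n F E x₀) := by
    refine ContDiffOn.sum fun l _ => ContDiffOn.smul (ContDiffOn.mul
      ?_ (h.contDiffOn_localForm subset_rfl (contDiffOn_localRep x₀ φ) contDiffOn_const))
      contDiffOn_const
    exact Complex.ofRealCLM.contDiff.comp_contDiffOn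
      ((contDiffOn_chartDensity n μ x₀).mono Set.inter_subset_left)
  let Λ : EuclideanSpace ℝ (Fin n) → (F →L[ℂ] ℂ) := fun y => θ y • Λ₀ y
  have hs : tsupport Λ ⊆ tsupport θ := tsupport_smul_subset_left θ Λ₀
  refine ⟨Λ, ⟨contDiff_of_tsupport_subset hU (hθ.contDiff.contDiffOn.smul hΛ₀)
    (hs.trans hθ.tsupport_subset),
    hθ.hasCompactSupport.isCompact.of_isClosed_subset (isClosed_tsupport _) hs,
    hs.trans hθ.tsupport_subset⟩, fun g hg => ?_⟩
  have e : ∫ y, Λ y (g y) = ∫ y in K, Λ y (g y) :=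
    (setIntegral_eq_integral_of_forall_compl_eq_zero
      fun y hy => by rw [hg.eq_zero hy, map_zero]).symm
  rw [l2Inner_ofLocal h μ hK hKU hg, e]
  refine setIntegral_congr_fun hK.isClosed.measurableSet fun y hy => ?_
  have h1 : θ y = 1 := hθ1.self_of_nhdsSet y hy
  simp only [Λ, Λ₀, h1, one_smul, sum_apply, smul_apply]
  conv_lhs => rw [← sum_fiberCoord (g y)]
  simp only [map_sum, map_smul, smul_eq_mul, Finset.mul_sum]
  exact Finset.sum_congr rfl fun l _ => by ring

theorem contDiffOn_det {V ι : Type*} [NormedAddCommGroup V] [NormedSpace ℝ V] [Fintype ι]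
    [DecidableEq ι] {U : Set V} {M : V → Matrix ι ι ℂ}
    (hM : ∀ k l, ContDiffOn ℝ ∞ (fun y => M y k l) U) : ContDiffOn ℝ ∞ (fun y => (M y).det) U := by
  simp only [Matrix.det_apply]
  refine ContDiffOn.sum fun σ _ => ContDiffOn.const_smul _ (contDiffOn_prod fun i _ => hM _ _)

/-- Cramer's rule: the entries of the inverse are quotients of determinants. -/
theorem contDiffOn_inv_apply {V ι : Type*} [NormedAddCommGroup V] [NormedSpace ℝ V] [Fintype ι]
    [DecidableEq ι] {U : Set V} {M : V → Matrix ι ι ℂ}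
    (hM : ∀ k l, ContDiffOn ℝ ∞ (fun y => M y k l) U) (h0 : ∀ y ∈ U, (M y).det ≠ 0) (k l : ι) :
    ContDiffOn ℝ ∞ (fun y => (M y)⁻¹ k l) U := by
  simp only [Matrix.inv_def, Matrix.smul_apply, smul_eq_mul, Ring.inverse_eq_inv',
    Matrix.adjugate_apply]
  refine ((contDiffOn_det hM).inv h0).mul (contDiffOn_det fun i j => ?_)
  by_cases hi : i = l
  · subst hi
    simp only [Matrix.updateRow_self]
    exact contDiffOn_const
  · simp only [Matrix.updateRow_ne hi]
    exact hM i j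

/-- A nonzero vector in the kernel of the Gram matrix would have zero length. -/
theorem HermitianMetric.det_gram_ne_zero {x₀ : X} {y : EuclideanSpace ℝ (Fin n)}
    (hy : y ∈ localDomain n F E x₀) : (h.gram x₀ y).det ≠ 0 := by
  intro h0
  obtain ⟨c, hc, hc0⟩ := Matrix.exists_mulVec_eq_zero_iff.2 h0
  set v : F := ∑ k, c k • Module.finBasis ℂ F k with hv
  have hcoord : ∀ k, fiberCoord F k v = c k := fun k => by
    simp [hv, fiberCoord_basis]
  have hv0 : v ≠ 0 := fun hz => hc (funext fun k => by rw [← hcoord k, hz]; simp)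
  have hpos := h.localForm_pos x₀ hy hv0
  have hz : h.localForm x₀ y v v = 0 := by
    rw [h.localForm_eq_sum]
    refine Finset.sum_eq_zero fun k _ => ?_
    have := congrFun hc0 k
    simp only [Matrix.mulVec, dotProduct, Pi.zero_apply] at this
    simp only [hcoord, mul_assoc, ← Finset.mul_sum]
    rw [show ∑ i, c i * h.gram x₀ y k i = ∑ i, h.gram x₀ y k i * c i from
      Finset.sum_congr rfl fun i _ => mul_comm _ _, this, mul_zero]
  rw [hz] at hpos
  simp at hpos

/-- A smooth functional in a chart is represented by a smooth section. -/
theorem exists_l2Inner_eq_integral {x₀ : X} {Λ : EuclideanSpace ℝ (Fin n) → (F →L[ℂ] ℂ)}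
    (hΛ : IsTestOn (localDomain n F E x₀) Λ) :
    ∃ ψ : SmoothSection n F E, ∀ w : SmoothSection n F E,
      l2Inner h μ ψ w = ∫ y, Λ y (localRep n F E x₀ w y) := by
  have hU := isOpen_localDomain (n := n) (F := F) (E := E) x₀
  set K := tsupport Λ with hKdef
  have hK : IsCompact K := hΛ.hasCompactSupport.isCompact
  have hKU : K ⊆ localDomain n F E x₀ := hΛ.tsupport_subset
  -- Pointwise Riesz representation: `g` has to solve `ρ h(g, v) = Λ v` for all `v`. The metric is
  -- conjugate linear in its first argument, so the conjugated coordinates of `g` form the row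
  -- vector `ρ⁻¹ Λ` times the inverse Gram matrix.
  let c : EuclideanSpace ℝ (Fin n) → Fin (Module.finrank ℂ F) → ℂ := fun y =>
    Matrix.vecMul (fun l => (chartDensity n μ x₀ y : ℂ)⁻¹ * Λ y (Module.finBasis ℂ F l))
      (h.gram x₀ y)⁻¹
  let g : EuclideanSpace ℝ (Fin n) → F := fun y =>
    ∑ k, starRingEnd ℂ (c y k) • Module.finBasis ℂ F k
  have hcU : ∀ k, ContDiffOn ℝ ∞ (fun y => c y k) (localDomain n F E x₀) := fun k => by
    simp only [c, Matrix.vecMul, dotProduct]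
    refine ContDiffOn.sum fun l _ => ContDiffOn.mul (ContDiffOn.mul (ContDiffOn.inv ?_ ?_) ?_)
      (contDiffOn_inv_apply (fun k l => h.contDiffOn_gram x₀ k l)
        (fun y hy => h.det_gram_ne_zero hy) _ _)
    · exact Complex.ofRealCLM.contDiff.comp_contDiffOn
        ((contDiffOn_chartDensity n μ x₀).mono Set.inter_subset_left)
    · exact fun y hy => Complex.ofReal_ne_zero.2 (chartDensity_pos n μ hy.1).ne'
    · exact (hΛ.contDiff.clm_apply_complex contDiff_const).contDiffOn
  have hgs : tsupport g ⊆ K := by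
    refine closure_minimal (fun y hy => by_contra fun hn => hy ?_) hK.isClosed
    have : Λ y = 0 := image_eq_zero_of_notMem_tsupport hn
    have hc0 : c y = 0 := by
      simp only [c, this, zero_apply, mul_zero]
      exact Matrix.zero_vecMul _
    simp [g, hc0]
  have hg : IsTestOn K g := by
    refine .of_isCompact hK (contDiff_of_tsupport_subset hU ?_ (hgs.trans hKU)) hgs
    refine ContDiffOn.sum fun k _ => ContDiffOn.smul ?_ contDiffOn_const
    exact Complex.conjCLE.contDiff.comp_contDiffOn (hcU k)
  refine ⟨SmoothSection.ofLocal x₀ g, fun w => ?_⟩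
  rw [← l2Inner_conj, l2Inner_ofLocal h μ hK hKU hg, ← integral_conj,
    ← setIntegral_eq_integral_of_forall_compl_eq_zero (s := K)
      (f := fun y => Λ y (localRep n F E x₀ w y)) fun y hy => by
        rw [image_eq_zero_of_notMem_tsupport hy, zero_apply]]
  refine setIntegral_congr_fun hK.isClosed.measurableSet fun y hy => ?_
  set v := localRep n F E x₀ w y
  have hρ : (chartDensity n μ x₀ y : ℂ) ≠ 0 :=
    Complex.ofReal_ne_zero.2 (chartDensity_pos n μ (hKU hy).1).ne'
  have hmul : Matrix.vecMul (c y) (h.gram x₀ y) =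
      fun l => (chartDensity n μ x₀ y : ℂ)⁻¹ * Λ y (Module.finBasis ℂ F l) := by
    simp only [c]
    rw [Matrix.vecMul_vecMul, Matrix.nonsing_inv_mul _ (h.det_gram_ne_zero (hKU hy)).isUnit,
      Matrix.vecMul_one]
  have hcoord : ∀ k, fiberCoord F k (g y) = starRingEnd ℂ (c y k) := fun k => by
    simp [g, fiberCoord_basis]
  have key : h.localForm x₀ y (g y) v = (chartDensity n μ x₀ y : ℂ)⁻¹ * Λ y v := by
    rw [h.localForm_eq_sum, Finset.sum_comm]
    conv_rhs => rw [← sum_fiberCoord v]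
    rw [map_sum, Finset.mul_sum]
    refine Finset.sum_congr rfl fun l _ => ?_
    have := congrFun hmul l
    simp only [Matrix.vecMul, dotProduct] at this
    rw [map_smul, smul_eq_mul, mul_left_comm, ← this, Finset.mul_sum]
    refine Finset.sum_congr rfl fun k _ => ?_
    rw [hcoord, Complex.conj_conj]
    ring
  simp only [map_mul, Complex.conj_ofReal]
  rw [h.localForm_conj, key, mul_inv_cancel_left₀ hρ]

end SectionNorm

/-! ### First-order operators on functions with support in a fixed compact set -/

/-- The sum of the constants serves for all indices. This makes chartwise estimates uniform over the
finitely many charts of an atlas. -/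
theorem exists_common_bound {ι : Type*} [Fintype ι] {p : ι → ℝ → Prop}
    (hp : ∀ i c c', p i c → c ≤ c' → p i c') (h : ∀ i, ∃ c, 0 ≤ c ∧ p i c) :
    ∃ c, 0 ≤ c ∧ ∀ i, p i c := by
  choose c hc0 hc using h
  exact ⟨∑ i, c i, Finset.sum_nonneg fun i _ => hc0 i, fun i => hp i _ _ (hc i)
    (Finset.single_le_sum (fun j _ => hc0 j) (Finset.mem_univ i))⟩

section LocalEstimates

variable {n : ℕ} {F : Type*} [NormedAddCommGroup F] [NormedSpace ℂ F]
  {U K : Set (EuclideanSpace ℝ (Fin n))} {a : Fin n → EuclideanSpace ℝ (Fin n) → (F →L[ℂ] F)}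
  {b : EuclideanSpace ℝ (Fin n) → (F →L[ℂ] F)}

theorem IsTestOn.memLp_fderiv {W : Type*} [NormedAddCommGroup W] [NormedSpace ℝ W]
    {g : EuclideanSpace ℝ (Fin n) → W} (hg : IsTestOn U g) : MemLp (fderiv ℝ g) 2 volume :=
  (hg.contDiff.continuous_fderiv (by simp)).memLp_of_hasCompactSupport
    (hg.hasCompactSupport.fderiv (𝕜 := ℝ))

theorem exists_l2_localOp_le (hK : IsCompact K) (ha : ∀ j, ContDiffOn ℝ ∞ (a j) K)
    (hb : ContDiffOn ℝ ∞ b K) :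
    ∃ C, 0 ≤ C ∧ ∀ g, IsTestOn K g → l2 (localOp a b g) ≤ C * (l2 (fderiv ℝ g) + l2 g) := by
  choose A hA0 hA using fun j => exists_bound_of_isCompact hK (ha j).continuousOn
  obtain ⟨B, hB0, hB⟩ := exists_bound_of_isCompact hK hb.continuousOn
  have hA0' : 0 ≤ ∑ j, A j := Finset.sum_nonneg fun j _ => hA0 j
  refine ⟨∑ j, A j + B, by positivity, fun g hg => ?_⟩
  have h1 : l2 (localOp a b g) ≤ (∑ j, A j) * l2 (fderiv ℝ g) + B * l2 g := by
    refine l2_le_of_norm_le_add hg.memLp_fderiv hg.memLp hA0' hB0 fun y => ?_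
    by_cases hy : y ∈ K
    · refine (norm_add_le _ _).trans (add_le_add ?_ ?_)
      · refine (norm_sum_apply_fderiv_le _ _).trans (mul_le_mul_of_nonneg_right ?_ (norm_nonneg _))
        exact Finset.sum_le_sum fun j _ => hA j y hy
      · exact ((b y).le_opNorm _).trans (mul_le_mul_of_nonneg_right (hB y hy) (norm_nonneg _))
    · rw [localOp_eq_zero fun h => hy (hg.tsupport_subset h), norm_zero]
      positivity
  nlinarith [l2_nonneg g, l2_nonneg (fderiv ℝ g), mul_nonneg hA0' (l2_nonneg g),
    mul_nonneg hB0 (l2_nonneg (fderiv ℝ g))]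

theorem isTestOn_symbolOf (hU : IsOpen U) (hKU : K ⊆ U) (ha : ∀ j, ContDiffOn ℝ ∞ (a j) U)
    {ζ : EuclideanSpace ℝ (Fin n) → ℝ} (hζ : IsTestOn K ζ) : IsTestOn K (symbolOf a ζ) := by
  have hs : tsupport (symbolOf a ζ) ⊆ tsupport ζ :=
    closure_minimal (fun y hy => by_contra fun hn => hy (by
      simp [symbolOf, fderiv_eq_zero_of_notMem_tsupport hn])) (isClosed_tsupport _)
  refine ⟨contDiff_of_tsupport_subset hU (ContDiffOn.sum fun j _ => ?_)
    ((hs.trans hζ.tsupport_subset).trans hKU),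
    hζ.hasCompactSupport.isCompact.of_isClosed_subset (isClosed_tsupport _) hs,
    hs.trans hζ.tsupport_subset⟩
  exact ((hζ.contDiff.fderiv_right (m := ∞) (by simp)).clm_apply
    contDiff_const).contDiffOn.smul (ha j)

/-- Friedrichs' lemma for an operator with coefficients defined near a compact set. -/
theorem exists_l2_commutator_le_of_isTestOn [CompleteSpace F] (hU : IsOpen U) (hK : IsCompact K)
    (hKU : K ⊆ U) (ha : ∀ j, ContDiffOn ℝ ∞ (a j) U) (hb : ContDiffOn ℝ ∞ b U) {C : ℝ}
    (hC : 0 ≤ C) :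
    ∃ L, 0 ≤ L ∧ ∀ δ (m : EuclideanSpace ℝ (Fin n) → ℝ), IsMollifier C δ m →
      ∀ g : EuclideanSpace ℝ (Fin n) → F, IsTestOn K g → IsTestOn K (mollify m g) →
        l2 (localOp a b (mollify m g) - mollify m (localOp a b g)) ≤ L * l2 g := by
  -- Multiplication by `θ` extends the coefficients to the whole space without changing the operator
  -- on functions supported in `K`. The mollified function has to be supported in `K` as well.
  obtain ⟨θ, hθ, hθ1⟩ := exists_test_eq_one hU hK hKU
  have hext : ∀ f : EuclideanSpace ℝ (Fin n) → (F →L[ℂ] F), ContDiffOn ℝ ∞ f U →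
      ContDiff ℝ ∞ (fun y => θ y • f y) ∧ HasCompactSupport fun y => θ y • f y := fun f hf => by
    have hs : tsupport (fun y => θ y • f y) ⊆ tsupport θ := tsupport_smul_subset_left θ f
    exact ⟨contDiff_of_tsupport_subset hU (hθ.contDiff.contDiffOn.smul hf)
      (hs.trans hθ.tsupport_subset),
      hθ.hasCompactSupport.isCompact.of_isClosed_subset (isClosed_tsupport _) hs⟩
  obtain ⟨L, hL0, hL⟩ := exists_l2_commutator_le (fun j => (hext _ (ha j)).1)
    (fun j => (hext _ (ha j)).2) (hext _ hb).1 (hext _ hb).2 hC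
  have e : ∀ g : EuclideanSpace ℝ (Fin n) → F, IsTestOn K g →
      localOp (fun j y => θ y • a j y) (fun y => θ y • b y) g = localOp a b g := fun g hg => by
    ext1 y
    by_cases hy : y ∈ K
    · have h1 : θ y = 1 := hθ1.self_of_nhdsSet y hy
      simp only [localOp, h1, one_smul]
    · have h0 : y ∉ tsupport g := fun h => hy (hg.tsupport_subset h)
      rw [localOp_eq_zero h0, localOp_eq_zero h0]
  refine ⟨L, hL0, fun δ m hm g hg hmg => ?_⟩
  have := hL δ m hm g hg.contDiff hg.hasCompactSupport
  rwa [e g hg, e _ hmg] at this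

end LocalEstimates

/-! ### Estimates for first-order operators on sections -/

section Estimates

variable {n : ℕ} {X : Type*} [TopologicalSpace X] [ChartedSpace (EuclideanSpace ℝ (Fin n)) X]
  [CompactSpace X] [MeasurableSpace X] [BorelSpace X]
  {F : Type*} [NormedAddCommGroup F] [NormedSpace ℂ F]
  {E : X → Type*} [TopologicalSpace (TotalSpace F E)] [∀ x, TopologicalSpace (E x)]
  [∀ x, AddCommGroup (E x)] [∀ x, Module ℂ (E x)] [FiberBundle F E]
  [VectorBundle ℝ F E] [VectorBundle ℂ F E]
  (h : HermitianMetric n F E) (μ : Measure X) [IsSmoothDensity n μ]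
  [T2Space X] [FiniteDimensional ℂ F]
  [IsManifold (𝓡 n) ∞ X] [ContMDiffVectorBundle ∞ F E (𝓡 n)] (𝒜 : SobolevAtlas n F E)

/-- The `i`-th weight in the `i`-th chart, extended by zero. -/
def SobolevAtlas.localWeight (i : Fin 𝒜.size) : EuclideanSpace ℝ (Fin n) → ℝ :=
  (localDomain n F E (𝒜.center i)).indicator fun y =>
    𝒜.weight i ((chartAt (EuclideanSpace ℝ (Fin n)) (𝒜.center i)).symm y)

theorem SobolevAtlas.piece_eq (i : Fin 𝒜.size) (u : ∀ x, E x) (y : EuclideanSpace ℝ (Fin n)) :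
    𝒜.piece i u y = 𝒜.localWeight i y • localRep n F E (𝒜.center i) u y := by
  by_cases hy : y ∈ localDomain n F E (𝒜.center i)
  · simp [SobolevAtlas.piece, SobolevAtlas.localWeight, hy]
  · simp [SobolevAtlas.piece, SobolevAtlas.localWeight, hy]

theorem SobolevAtlas.isTestOn_localWeight (i : Fin 𝒜.size) :
    IsTestOn (𝒜.core i) (𝒜.localWeight i) := by
  have h0 : ∀ y ∉ 𝒜.core i, 𝒜.localWeight i y = 0 := fun y hy => by
    by_contra h0
    have hd : y ∈ localDomain n F E (𝒜.center i) := Set.mem_of_indicator_ne_zero h0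
    rw [SobolevAtlas.localWeight, Set.indicator_of_mem hd] at h0
    exact hy ⟨_, subset_tsupport _ h0, (chartAt _ (𝒜.center i)).right_inv hd.1⟩
  have hs : tsupport (𝒜.localWeight i) ⊆ 𝒜.core i :=
    closure_minimal (fun y hy => by_contra fun hn => hy (h0 y hn)) (𝒜.isCompact_core i).isClosed
  refine .of_isCompact (𝒜.isCompact_core i) (contDiff_of_tsupport_subset
    (isOpen_localDomain (n := n) (F := F) (E := E) (𝒜.center i)) ?_
    (hs.trans (𝒜.core_subset i))) hs
  have h1 : ContDiffOn ℝ ∞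
      (fun y => 𝒜.weight i ((chartAt (EuclideanSpace ℝ (Fin n)) (𝒜.center i)).symm y))
      (localDomain n F E (𝒜.center i)) := by
    rw [← contMDiffOn_iff_contDiffOn]
    exact (𝒜.weight_smooth i).comp_contMDiffOn
      ((contMDiffOn_chart_symm (I := 𝓡 n) (x := 𝒜.center i)).mono Set.inter_subset_left)
  exact h1.congr fun y hy => Set.indicator_of_mem hy _

/-- The multiplication by a weight commutes with a first-order operator up to a multiplication. -/
theorem SobolevAtlas.piece_apply_operator {P : SmoothSection n F E →ₗ[ℂ] SmoothSection n F E}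
    {i : Fin 𝒜.size} {a : Fin n → EuclideanSpace ℝ (Fin n) → (F →L[ℂ] F)}
    {b : EuclideanSpace ℝ (Fin n) → (F →L[ℂ] F)} (hab : IsLocalForm P (𝒜.center i) a b)
    (u : SmoothSection n F E) :
    𝒜.piece i (P u) = localOp a b (𝒜.piece i u) - fun y =>
      symbolOf a (𝒜.localWeight i) y (localRep n F E (𝒜.center i) u y) := by
  have hU := isOpen_localDomain (n := n) (F := F) (E := E) (𝒜.center i)
  have hζ := 𝒜.isTestOn_localWeight i
  ext1 y
  rw [Pi.sub_apply, eq_sub_iff_add_eq]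
  by_cases hy : y ∈ localDomain n F E (𝒜.center i)
  · have e : 𝒜.piece i u = fun z => 𝒜.localWeight i z • localRep n F E (𝒜.center i) u z :=
      funext fun z => 𝒜.piece_eq i u z
    rw [e, localOp_smul _ (hζ.contDiff.differentiable (by simp) y)
      (((contDiffOn_localRep (𝒜.center i) u).contDiffAt (hU.mem_nhds hy)).differentiableAt
        (by simp)), 𝒜.piece_eq, hab.eq u y hy]
    rfl
  · have hK : y ∉ 𝒜.core i := fun hn => hy (𝒜.core_subset i hn)
    rw [𝒜.piece_eq_zero i _ hK, localOp_eq_zero fun hn => hK (𝒜.tsupport_piece_subset i u hn),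
      (isTestOn_symbolOf hU (𝒜.core_subset i) hab.smooth_coeff hζ).eq_zero hK]
    simp

theorem SobolevAtlas.exists_l2_piece_le :
    ∃ C, 0 ≤ C ∧ ∀ i, ∀ u : SmoothSection n F E, l2 (𝒜.piece i u) ≤ C * sectionNorm h μ u := by
  refine exists_common_bound (p := fun i C => ∀ u : SmoothSection n F E,
    l2 (𝒜.piece i u) ≤ C * sectionNorm h μ u) (fun i c c' hc hcc u => (hc u).trans
      (mul_le_mul_of_nonneg_right hcc (sectionNorm_nonneg h μ u))) fun i => ?_
  have hζ := 𝒜.isTestOn_localWeight i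
  -- A piece is the local representation multiplied by a compactly supported scalar endomorphism.
  have hT : IsTestOn (localDomain n F E (𝒜.center i)) fun y =>
      𝒜.localWeight i y • (1 : F →L[ℂ] F) :=
    ⟨hζ.contDiff.smul contDiff_const, hζ.hasCompactSupport.smul_right,
      ((tsupport_smul_subset_left (𝒜.localWeight i) fun _ => (1 : F →L[ℂ] F)).trans
        hζ.tsupport_subset).trans (𝒜.core_subset i)⟩
  obtain ⟨C, hC, hb⟩ := exists_l2_apply_localRep_le h μ hT
  refine ⟨C, hC, fun u => ?_⟩
  convert hb u using 2
  exact funext fun y => 𝒜.piece_eq i u y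

theorem SobolevAtlas.exists_l2_symbolOf_apply_le
    {P : SmoothSection n F E →ₗ[ℂ] SmoothSection n F E}
    {a : Fin 𝒜.size → Fin n → EuclideanSpace ℝ (Fin n) → (F →L[ℂ] F)}
    {b : Fin 𝒜.size → EuclideanSpace ℝ (Fin n) → (F →L[ℂ] F)}
    (hab : ∀ i, IsLocalForm P (𝒜.center i) (a i) (b i)) :
    ∃ C, 0 ≤ C ∧ ∀ i, ∀ u : SmoothSection n F E,
      l2 (fun y => symbolOf (a i) (𝒜.localWeight i) y (localRep n F E (𝒜.center i) u y)) ≤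
        C * sectionNorm h μ u := by
  refine exists_common_bound (p := fun i C => ∀ u : SmoothSection n F E,
    l2 (fun y => symbolOf (a i) (𝒜.localWeight i) y (localRep n F E (𝒜.center i) u y)) ≤
      C * sectionNorm h μ u) (fun i c c' hc hcc u => (hc u).trans
      (mul_le_mul_of_nonneg_right hcc (sectionNorm_nonneg h μ u))) fun i => ?_
  exact exists_l2_apply_localRep_le h μ ((isTestOn_symbolOf (isOpen_localDomain (𝒜.center i))
    (𝒜.core_subset i) (hab i).smooth_coeff (𝒜.isTestOn_localWeight i)).mono (𝒜.core_subset i))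

theorem SobolevAtlas.exists_sectionNorm_sum_ofLocal_le
    {K : Fin 𝒜.size → Set (EuclideanSpace ℝ (Fin n))} (hK : ∀ i, IsCompact (K i))
    (hKU : ∀ i, K i ⊆ localDomain n F E (𝒜.center i)) :
    ∃ C, 0 ≤ C ∧ ∀ f : Fin 𝒜.size → EuclideanSpace ℝ (Fin n) → F, (∀ i, IsTestOn (K i) (f i)) →
      sectionNorm h μ (∑ i, SmoothSection.ofLocal (𝒜.center i) (f i)) ≤ C * ∑ i, l2 (f i) := by
  obtain ⟨C, hC, hb⟩ := exists_common_bound (p := fun i C => ∀ g, IsTestOn (K i) g →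
    sectionNorm h μ (SmoothSection.ofLocal (𝒜.center i) g) ≤ C * l2 g)
    (fun i c c' hc hcc g hg => (hc g hg).trans (mul_le_mul_of_nonneg_right hcc (l2_nonneg g)))
    fun i => exists_sectionNorm_ofLocal_le h μ (hK i) (hKU i)
  refine ⟨C, hC, fun f hf => (sectionNorm_sum_le h μ _ _).trans ?_⟩
  rw [Finset.mul_sum]
  exact Finset.sum_le_sum fun i _ => hb i _ (hf i)

variable {P : SmoothSection n F E →ₗ[ℂ] SmoothSection n F E}

/-- A first-order operator is bounded from `H₁` to `H₀`. -/
theorem SobolevAtlas.exists_sectionNorm_apply_le (hP : IsFirstOrderDifferentialOperator P) :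
    ∃ C, 0 ≤ C ∧ ∀ u, sectionNorm h μ (P u) ≤ C * 𝒜.sobolevNorm u := by
  choose a b hab using fun i => hP (𝒜.center i)
  obtain ⟨C, hC, hCb⟩ := 𝒜.exists_sectionNorm_sum_ofLocal_le h μ 𝒜.isCompact_core 𝒜.core_subset
  obtain ⟨D, hD, hDb⟩ := exists_common_bound (p := fun i D => ∀ g, IsTestOn (𝒜.core i) g →
    l2 (localOp (a i) (b i) g) ≤ D * (l2 (fderiv ℝ g) + l2 g))
    (fun i c c' hc hcc g hg => (hc g hg).trans (mul_le_mul_of_nonneg_right hcc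
      (add_nonneg (l2_nonneg _) (l2_nonneg g))))
    fun i => exists_l2_localOp_le (𝒜.isCompact_core i)
      (fun j => ((hab i).smooth_coeff j).mono (𝒜.core_subset i))
      ((hab i).smooth_zeroth.mono (𝒜.core_subset i))
  refine ⟨C * D, by positivity, fun u => ?_⟩
  have ht := fun i => 𝒜.isTestOn_piece i u
  -- `P` is applied to the decomposition of `u`, not to a decomposition of `P u`; no commutator
  -- terms appear.
  have e : P u = ∑ i, SmoothSection.ofLocal (𝒜.center i)
      (localOp (a i) (b i) (𝒜.piece i u)) := by
    conv_lhs => rw [← 𝒜.sum_ofLocal_piece u, map_sum]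
    exact Finset.sum_congr rfl fun i _ =>
      (hab i).apply_ofLocal hP ((ht i).mono (𝒜.core_subset i))
  rw [e, mul_assoc]
  refine (hCb _ fun i => ?_).trans (mul_le_mul_of_nonneg_left ?_ hC)
  · exact .of_isCompact (𝒜.isCompact_core i) (contDiff_localOp (isOpen_localDomain (𝒜.center i))
      (hab i).smooth_coeff (hab i).smooth_zeroth (ht i).contDiff
      ((ht i).tsupport_subset.trans (𝒜.core_subset i)))
      (tsupport_localOp_subset.trans (ht i).tsupport_subset)
  · change _ ≤ D * ∑ i, (l2 (𝒜.piece i u) + l2 (fderiv ℝ (𝒜.piece i u)))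
    rw [Finset.mul_sum]
    refine Finset.sum_le_sum fun i _ => ?_
    rw [add_comm (l2 (𝒜.piece i u))]
    exact hDb i _ (ht i)

/-- The elliptic estimate. -/
theorem SobolevAtlas.exists_sobolevNorm_le (hP : IsFirstOrderDifferentialOperator P)
    (hell : IsElliptic P) :
    ∃ C, 0 ≤ C ∧ ∀ u, 𝒜.sobolevNorm u ≤ C * (sectionNorm h μ (P u) + sectionNorm h μ u) := by
  choose a b hab using fun i => hP (𝒜.center i)
  obtain ⟨C, hC, hCb⟩ := 𝒜.exists_l2_piece_le h μ
  obtain ⟨D, hD, hDb⟩ := 𝒜.exists_l2_symbolOf_apply_le h μ hab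
  obtain ⟨B, hB, hBb⟩ := exists_common_bound (p := fun i B =>
    ∀ g : EuclideanSpace ℝ (Fin n) → F, ContDiff ℝ ∞ g → tsupport g ⊆ 𝒜.core i →
      l2 (fderiv ℝ g) ≤ B * (l2 (localOp (a i) (b i) g) + l2 g))
    (fun i c c' hc hcc g hg hs => (hc g hg hs).trans (mul_le_mul_of_nonneg_right hcc
      (add_nonneg (l2_nonneg _) (l2_nonneg g))))
    fun i => exists_l2_fderiv_le (isOpen_localDomain (𝒜.center i)) (hab i).smooth_coeff
      (hab i).smooth_zeroth (hell _ _ _ (hab i)) (𝒜.isCompact_core i) (𝒜.core_subset i)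
  refine ⟨𝒜.size * (C + B * (C + D + C)), by positivity, fun u => ?_⟩
  have hN := sectionNorm_nonneg h μ u
  have hN' := sectionNorm_nonneg h μ (P u)
  change ∑ i, (l2 (𝒜.piece i u) + l2 (fderiv ℝ (𝒜.piece i u))) ≤ _
  have key : ∀ i, l2 (𝒜.piece i u) + l2 (fderiv ℝ (𝒜.piece i u)) ≤
      (C + B * (C + D + C)) * (sectionNorm h μ (P u) + sectionNorm h μ u) := fun i => by
    have ht := 𝒜.isTestOn_piece i u
    have hS := ((isTestOn_symbolOf (isOpen_localDomain (𝒜.center i)) (𝒜.core_subset i)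
      (hab i).smooth_coeff (𝒜.isTestOn_localWeight i)).apply_localRep (𝒜.core_subset i) u)
    -- The local operator applied to a piece differs from the piece of `P u` by a zeroth-order term,
    -- which the `L²` norm of `u` controls.
    have e : localOp (a i) (b i) (𝒜.piece i u) = 𝒜.piece i (P u) + fun y =>
        symbolOf (a i) (𝒜.localWeight i) y (localRep n F E (𝒜.center i) u y) := by
      rw [𝒜.piece_apply_operator (hab i), sub_add_cancel]
    have h1 := hBb i _ ht.contDiff ht.tsupport_subset
    have h2 : l2 (localOp (a i) (b i) (𝒜.piece i u)) ≤
        C * sectionNorm h μ (P u) + D * sectionNorm h μ u := by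
      rw [e]
      exact (l2_add_le (𝒜.isTestOn_piece i (P u)).memLp hS.memLp).trans
        (add_le_add (hCb i _) (hDb i u))
    have h3 := hCb i u
    have h4 : l2 (localOp (a i) (b i) (𝒜.piece i u)) + l2 (𝒜.piece i u) ≤
        (C + D + C) * (sectionNorm h μ (P u) + sectionNorm h μ u) := by
      nlinarith [mul_nonneg hC hN, mul_nonneg hD hN, mul_nonneg hC hN', mul_nonneg hD hN']
    have h5 := h1.trans (mul_le_mul_of_nonneg_left h4 hB)
    nlinarith [mul_nonneg hC hN']
  refine (Finset.sum_le_sum fun i _ => key i).trans (le_of_eq ?_)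
  rw [Finset.sum_const, Finset.card_univ, Fintype.card_fin, nsmul_eq_mul]
  ring

end Estimates

/-! ### Smoothing operators -/

theorem IsTestOn.smul {n : ℕ} {W : Type*} [NormedAddCommGroup W] [NormedSpace ℝ W]
    {U : Set (EuclideanSpace ℝ (Fin n))} {ζ : EuclideanSpace ℝ (Fin n) → ℝ}
    {g : EuclideanSpace ℝ (Fin n) → W} (hζ : IsTestOn U ζ) (hg : ContDiff ℝ ∞ g) :
    IsTestOn U fun y => ζ y • g y :=
  ⟨hζ.contDiff.smul hg, hζ.hasCompactSupport.smul_right,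
    (tsupport_smul_subset_left ζ g).trans hζ.tsupport_subset⟩

section Smoothing

variable {n : ℕ} {X : Type*} [TopologicalSpace X] [ChartedSpace (EuclideanSpace ℝ (Fin n)) X]
  [CompactSpace X] [MeasurableSpace X] [BorelSpace X]
  {F : Type*} [NormedAddCommGroup F] [NormedSpace ℂ F]
  {E : X → Type*} [TopologicalSpace (TotalSpace F E)] [∀ x, TopologicalSpace (E x)]
  [∀ x, AddCommGroup (E x)] [∀ x, Module ℂ (E x)] [FiberBundle F E]
  [VectorBundle ℝ F E] [VectorBundle ℂ F E]
  (h : HermitianMetric n F E) (μ : Measure X) [IsSmoothDensity n μ]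
  [T2Space X] [FiniteDimensional ℂ F]
  [IsManifold (𝓡 n) ∞ X] [ContMDiffVectorBundle ∞ F E (𝓡 n)] (𝒜 : SobolevAtlas n F E)

/-- The closed neighborhoods of radius `r` of the supports of the weights are contained in the
domains of the charts. -/
def SobolevAtlas.IsMargin (r : ℝ) : Prop :=
  ∀ i, Metric.cthickening r (𝒜.core i) ⊆ localDomain n F E (𝒜.center i)

theorem SobolevAtlas.exists_isMargin : ∃ r, 0 < r ∧ 𝒜.IsMargin r := by
  choose r hr hrU using fun i => (𝒜.isCompact_core i).exists_cthickening_subset_open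
    (isOpen_localDomain (n := n) (F := F) (E := E) (𝒜.center i)) (𝒜.core_subset i)
  obtain hs | hs := isEmpty_or_nonempty (Fin 𝒜.size)
  · exact ⟨1, one_pos, fun i => hs.elim i⟩
  · refine ⟨Finset.univ.inf' Finset.univ_nonempty r, (Finset.lt_inf'_iff _).2 fun i _ => hr i,
      fun i => (Metric.cthickening_mono (Finset.inf'_le _ (Finset.mem_univ i)) _).trans (hrU i)⟩

variable {𝒜} {r C δ : ℝ} {m : EuclideanSpace ℝ (Fin n) → ℝ}

theorem SobolevAtlas.isCompact_cthickening_core (i : Fin 𝒜.size) :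
    IsCompact (Metric.cthickening r (𝒜.core i)) := (𝒜.isCompact_core i).cthickening

theorem IsTestOn.cthickening_core {i : Fin 𝒜.size} {W : Type*} [NormedAddCommGroup W]
    [NormedSpace ℝ W] {g : EuclideanSpace ℝ (Fin n) → W} (hg : IsTestOn (𝒜.core i) g) :
    IsTestOn (Metric.cthickening r (𝒜.core i)) g :=
  hg.mono (Metric.self_subset_cthickening _)

theorem IsTestOn.mollify_core {i : Fin 𝒜.size} {g : EuclideanSpace ℝ (Fin n) → F}
    (hg : IsTestOn (𝒜.core i) g) (hm : IsMollifier C δ m) (hδ : δ ≤ r) :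
    IsTestOn (Metric.cthickening r (𝒜.core i)) (_root_.mollify m g) :=
  (hg.mollify hm).mono (Metric.cthickening_mono hδ _)

/-- The operator which mollifies the pieces of a section in the charts. -/
def SobolevAtlas.IsMargin.smoothing (hr : 𝒜.IsMargin r) (hm : IsMollifier C δ m) (hδ : δ ≤ r) :
    SmoothSection n F E →ₗ[ℂ] SmoothSection n F E where
  toFun u := ∑ i, SmoothSection.ofLocal (𝒜.center i) (mollify m (𝒜.piece i u))
  map_add' u v := by
    rw [← Finset.sum_add_distrib]
    refine Finset.sum_congr rfl fun i _ => ?_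
    have hu := 𝒜.isTestOn_piece i u
    have hv := 𝒜.isTestOn_piece i v
    rw [← ofLocal_add ((hu.mollify_core hm hδ).mono (hr i)) ((hv.mollify_core hm hδ).mono (hr i)),
      ← mollify_add hm.contDiff.continuous hu.contDiff.continuous hu.hasCompactSupport
        hv.contDiff.continuous hv.hasCompactSupport, ← 𝒜.piece_add]
    rfl
  map_smul' c u := by
    rw [RingHom.id_apply, Finset.smul_sum]
    refine Finset.sum_congr rfl fun i _ => ?_
    rw [← ofLocal_smul c (((𝒜.isTestOn_piece i u).mollify_core hm hδ).mono (hr i)),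
      ← mollify_smul, ← 𝒜.piece_smul]
    rfl

/-- Convolution with a nonnegative kernel of integral one does not increase the `L²` norm, so the
constant is independent of the mollifier. -/
theorem SobolevAtlas.IsMargin.exists_sectionNorm_smoothing_le (hr : 𝒜.IsMargin r) :
    ∃ B, 0 ≤ B ∧ ∀ C δ m (hm : IsMollifier C δ m) (hδ : δ ≤ r) u,
      sectionNorm h μ (hr.smoothing hm hδ u) ≤ B * sectionNorm h μ u := by
  obtain ⟨B, hB, hBb⟩ := 𝒜.exists_sectionNorm_sum_ofLocal_le h μ
    𝒜.isCompact_cthickening_core hr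
  obtain ⟨D, hD, hDb⟩ := 𝒜.exists_l2_piece_le h μ
  refine ⟨B * (𝒜.size * D), by positivity, fun C δ m hm hδ u => ?_⟩
  refine (hBb _ fun i => (𝒜.isTestOn_piece i u).mollify_core hm hδ).trans ?_
  rw [mul_assoc]
  refine mul_le_mul_of_nonneg_left ?_ hB
  calc _ ≤ ∑ _i : Fin 𝒜.size, D * sectionNorm h μ u := Finset.sum_le_sum fun i _ =>
        (hm.l2_mollify_le (𝒜.isTestOn_piece i u).contDiff.continuous
          (𝒜.isTestOn_piece i u).hasCompactSupport).trans (hDb i u)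
    _ = _ := by rw [Finset.sum_const, Finset.card_univ, Fintype.card_fin, nsmul_eq_mul]; ring

theorem SobolevAtlas.IsMargin.smoothing_sub_self (hr : 𝒜.IsMargin r) (hm : IsMollifier C δ m) (hδ : δ ≤ r)
    (u : SmoothSection n F E) : hr.smoothing hm hδ u - u =
      ∑ i, SmoothSection.ofLocal (𝒜.center i) (mollify m (𝒜.piece i u) - 𝒜.piece i u) := by
  have e : hr.smoothing hm hδ u - u =
      ∑ i, SmoothSection.ofLocal (𝒜.center i) (mollify m (𝒜.piece i u)) -
        ∑ i, SmoothSection.ofLocal (𝒜.center i) (𝒜.piece i u) := by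
    rw [𝒜.sum_ofLocal_piece u]
    rfl
  rw [e, ← Finset.sum_sub_distrib]
  exact Finset.sum_congr rfl fun i _ => (ofLocal_sub
    (((𝒜.isTestOn_piece i u).mollify_core hm hδ).mono (hr i))
    ((𝒜.isTestOn_piece i u).mono (𝒜.core_subset i))).symm

/-- Strong convergence to the identity: the constant depends on `u` through its pieces, but not on
the mollifier. -/
theorem SobolevAtlas.IsMargin.exists_sectionNorm_smoothing_sub_le (hr : 𝒜.IsMargin r) (u : SmoothSection n F E) :
    ∃ B, 0 ≤ B ∧ ∀ C δ m (hm : IsMollifier C δ m) (hδ : δ ≤ r), 0 ≤ δ → δ ≤ 1 →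
      sectionNorm h μ (hr.smoothing hm hδ u - u) ≤ B * δ := by
  have : CompleteSpace F := FiniteDimensional.complete ℂ F
  obtain ⟨B, hB, hBb⟩ := 𝒜.exists_sectionNorm_sum_ofLocal_le h μ
    𝒜.isCompact_cthickening_core hr
  have ht := fun i => 𝒜.isTestOn_piece i u
  choose D hD hDb using fun i => exists_l2_mollify_sub_le (ht i).contDiff (ht i).hasCompactSupport
  refine ⟨B * ∑ i, D i, mul_nonneg hB (Finset.sum_nonneg fun i _ => hD i),
    fun C δ m hm hδ h0 h1 => ?_⟩
  rw [hr.smoothing_sub_self hm hδ, mul_assoc, Finset.sum_mul]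
  exact (hBb _ fun i => ((ht i).mollify_core hm hδ).sub (ht i).cthickening_core).trans
    (mul_le_mul_of_nonneg_left (Finset.sum_le_sum fun i _ => hDb i C δ m hm h0 h1) hB)

/-- The adjoint of smoothing preserves smooth sections. In each chart pairing with `φ` is a smooth
functional; evenness of the kernel moves the mollification to it, and its product with the weight is
again represented by a smooth section. -/
theorem SobolevAtlas.IsMargin.exists_l2Inner_smoothing_eq (hr : 𝒜.IsMargin r) (hm : IsMollifier C δ m) (hδ : δ ≤ r)
    (φ : SmoothSection n F E) :
    ∃ ψ : SmoothSection n F E, ∀ w, l2Inner h μ φ (hr.smoothing hm hδ w) = l2Inner h μ ψ w := by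
  have : CompleteSpace F := FiniteDimensional.complete ℂ F
  choose Λ hΛ hΛb using fun i => exists_integral_eq_l2Inner_ofLocal h μ
    (𝒜.isCompact_cthickening_core (r := r) i) (hr i) φ
  have hT : ∀ i, IsTestOn (localDomain n F E (𝒜.center i)) fun y =>
      𝒜.localWeight i y • mollify m (Λ i) y := fun i =>
    ((𝒜.isTestOn_localWeight i).smul
      (hm.contDiff_mollify (hΛ i).contDiff.continuous)).mono (𝒜.core_subset i)
  choose ψ hψ using fun i => exists_l2Inner_eq_integral h μ (hT i)
  refine ⟨∑ i, ψ i, fun w => ?_⟩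
  have e1 : l2Inner h μ φ (hr.smoothing hm hδ w) =
      ∑ i, l2Inner h μ φ (SmoothSection.ofLocal (𝒜.center i) (mollify m (𝒜.piece i w))) :=
    inner_sum (𝕜 := ℂ) (E := L2SmoothSection h μ) Finset.univ
      (fun i => SmoothSection.ofLocal (𝒜.center i) (mollify m (𝒜.piece i w))) φ
  have e2 : l2Inner h μ (∑ i, ψ i) w = ∑ i, l2Inner h μ (ψ i) w :=
    sum_inner (𝕜 := ℂ) (E := L2SmoothSection h μ) Finset.univ (fun i => ψ i) w
  rw [e1, e2]
  refine Finset.sum_congr rfl fun i _ => ?_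
  rw [hΛb i _ ((𝒜.isTestOn_piece i w).mollify_core hm hδ),
    hm.integral_apply_mollify (hΛ i) (𝒜.isTestOn_piece i w), hψ i]
  refine integral_congr_ae (Filter.Eventually.of_forall fun z => ?_)
  simp only [𝒜.piece_eq, smul_apply]
  exact ((mollify m (Λ i) z).restrictScalars ℝ).map_smul _ _

variable {P : SmoothSection n F E →ₗ[ℂ] SmoothSection n F E}

theorem SobolevAtlas.IsMargin.apply_sum_ofLocal (hr : 𝒜.IsMargin r) (hP : IsFirstOrderDifferentialOperator P)
    {a : Fin 𝒜.size → Fin n → EuclideanSpace ℝ (Fin n) → (F →L[ℂ] F)}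
    {b : Fin 𝒜.size → EuclideanSpace ℝ (Fin n) → (F →L[ℂ] F)}
    (hab : ∀ i, IsLocalForm P (𝒜.center i) (a i) (b i))
    {f : Fin 𝒜.size → EuclideanSpace ℝ (Fin n) → F}
    (hf : ∀ i, IsTestOn (Metric.cthickening r (𝒜.core i)) (f i)) :
    P (∑ i, SmoothSection.ofLocal (𝒜.center i) (f i)) =
      ∑ i, SmoothSection.ofLocal (𝒜.center i) (localOp (a i) (b i) (f i)) := by
  rw [map_sum]
  exact Finset.sum_congr rfl fun i _ => (hab i).apply_ofLocal hP ((hf i).mono (hr i))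

/-- The operator norm of `P` on sums of local sections. -/
theorem SobolevAtlas.IsMargin.exists_sectionNorm_apply_sum_ofLocal_le (hr : 𝒜.IsMargin r)
    (hP : IsFirstOrderDifferentialOperator P) :
    ∃ B, 0 ≤ B ∧ ∀ f : Fin 𝒜.size → EuclideanSpace ℝ (Fin n) → F,
      (∀ i, IsTestOn (Metric.cthickening r (𝒜.core i)) (f i)) →
      sectionNorm h μ (P (∑ i, SmoothSection.ofLocal (𝒜.center i) (f i))) ≤
        B * ∑ i, (l2 (fderiv ℝ (f i)) + l2 (f i)) := by
  choose a b hab using fun i => hP (𝒜.center i)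
  obtain ⟨B, hB, hBb⟩ := 𝒜.exists_sectionNorm_sum_ofLocal_le h μ
    𝒜.isCompact_cthickening_core hr
  obtain ⟨D, hD, hDb⟩ := exists_common_bound (p := fun i D =>
    ∀ g, IsTestOn (Metric.cthickening r (𝒜.core i)) g →
      l2 (localOp (a i) (b i) g) ≤ D * (l2 (fderiv ℝ g) + l2 g))
    (fun i c c' hc hcc g hg => (hc g hg).trans (mul_le_mul_of_nonneg_right hcc
      (add_nonneg (l2_nonneg _) (l2_nonneg g))))
    fun i => exists_l2_localOp_le (𝒜.isCompact_cthickening_core i)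
      (fun j => ((hab i).smooth_coeff j).mono (hr i)) ((hab i).smooth_zeroth.mono (hr i))
  refine ⟨B * D, by positivity, fun f hf => ?_⟩
  rw [hr.apply_sum_ofLocal hP hab hf, mul_assoc, Finset.mul_sum]
  refine (hBb _ fun i => ?_).trans
    (mul_le_mul_of_nonneg_left (Finset.sum_le_sum fun i _ => hDb i _ (hf i)) hB)
  exact .of_isCompact (𝒜.isCompact_cthickening_core i)
    (contDiff_localOp (isOpen_localDomain (𝒜.center i)) (hab i).smooth_coeff (hab i).smooth_zeroth
      (hf i).contDiff ((hf i).tsupport_subset.trans (hr i)))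
    (tsupport_localOp_subset.trans (hf i).tsupport_subset)

/-- Mollification gains the derivative that `P` loses, at the price of a constant depending on the
mollifier. -/
theorem SobolevAtlas.IsMargin.exists_sectionNorm_apply_smoothing_le (hr : 𝒜.IsMargin r)
    (hP : IsFirstOrderDifferentialOperator P) (hm : IsMollifier C δ m) (hδ : δ ≤ r) :
    ∃ B, 0 ≤ B ∧ ∀ u, sectionNorm h μ (P (hr.smoothing hm hδ u)) ≤ B * sectionNorm h μ u := by
  obtain ⟨B, hB, hBb⟩ := hr.exists_sectionNorm_apply_sum_ofLocal_le h μ hP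
  obtain ⟨D, hD, hDb⟩ := 𝒜.exists_l2_piece_le h μ
  obtain ⟨L, hL, hLb⟩ := hm.l2_fderiv_mollify_le (W := F)
  refine ⟨B * (𝒜.size * ((L + 1) * D)), by positivity, fun u => ?_⟩
  refine (hBb _ fun i => (𝒜.isTestOn_piece i u).mollify_core hm hδ).trans ?_
  rw [mul_assoc]
  refine mul_le_mul_of_nonneg_left ?_ hB
  calc _ ≤ ∑ _i : Fin 𝒜.size, (L + 1) * (D * sectionNorm h μ u) :=
        Finset.sum_le_sum fun i _ => by
          have ht := 𝒜.isTestOn_piece i u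
          refine le_trans ?_ (mul_le_mul_of_nonneg_left (hDb i u) (by positivity))
          rw [add_mul, one_mul]
          exact add_le_add (hLb _ ht.contDiff ht.hasCompactSupport)
            (hm.l2_mollify_le ht.contDiff.continuous ht.hasCompactSupport)
    _ = _ := by rw [Finset.sum_const, Finset.card_univ, Fintype.card_fin, nsmul_eq_mul]; ring

/-- For fixed `u` the pieces also converge in their first derivatives, and `P` costs one derivative.
-/
theorem SobolevAtlas.IsMargin.exists_sectionNorm_apply_smoothing_sub_le (hr : 𝒜.IsMargin r)
    (hP : IsFirstOrderDifferentialOperator P) (u : SmoothSection n F E) :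
    ∃ B, 0 ≤ B ∧ ∀ C δ m (hm : IsMollifier C δ m) (hδ : δ ≤ r), 0 ≤ δ → δ ≤ 1 →
      sectionNorm h μ (P (hr.smoothing hm hδ u) - P u) ≤ B * δ := by
  have : CompleteSpace F := FiniteDimensional.complete ℂ F
  obtain ⟨B, hB, hBb⟩ := hr.exists_sectionNorm_apply_sum_ofLocal_le h μ hP
  have ht := fun i => 𝒜.isTestOn_piece i u
  choose D hD hDb using fun i => exists_l2_mollify_sub_le (ht i).contDiff (ht i).hasCompactSupport
  choose D' hD' hDb' using fun i =>
    exists_l2_fderiv_mollify_sub_le (ht i).contDiff (ht i).hasCompactSupport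
  refine ⟨B * ∑ i, (D' i + D i), mul_nonneg hB (Finset.sum_nonneg fun i _ =>
    add_nonneg (hD' i) (hD i)), fun C δ m hm hδ h0 h1 => ?_⟩
  rw [← map_sub, hr.smoothing_sub_self hm hδ, mul_assoc, Finset.sum_mul]
  refine (hBb _ fun i => ((ht i).mollify_core hm hδ).sub (ht i).cthickening_core).trans
    (mul_le_mul_of_nonneg_left (Finset.sum_le_sum fun i _ => ?_) hB)
  rw [add_mul]
  exact add_le_add (hDb' i C δ m hm h0 h1) (hDb i C δ m hm h0 h1)

/-- The commutators of a first-order operator with the smoothing operators are uniformly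
bounded. -/
theorem SobolevAtlas.IsMargin.exists_sectionNorm_commutator_le (hr : 𝒜.IsMargin r)
    (hP : IsFirstOrderDifferentialOperator P) (hC : 0 ≤ C) :
    ∃ B, 0 ≤ B ∧ ∀ δ m (hm : IsMollifier C δ m) (hδ : δ ≤ r) u,
      sectionNorm h μ (P (hr.smoothing hm hδ u) - hr.smoothing hm hδ (P u)) ≤
        B * sectionNorm h μ u := by
  have : CompleteSpace F := FiniteDimensional.complete ℂ F
  choose a b hab using fun i => hP (𝒜.center i)
  obtain ⟨B, hB, hBb⟩ := 𝒜.exists_sectionNorm_sum_ofLocal_le h μ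
    𝒜.isCompact_cthickening_core hr
  obtain ⟨D, hD, hDb⟩ := 𝒜.exists_l2_piece_le h μ
  obtain ⟨S, hS, hSb⟩ := 𝒜.exists_l2_symbolOf_apply_le h μ hab
  obtain ⟨L, hL, hLb⟩ := exists_common_bound (p := fun i L =>
    ∀ δ (m : EuclideanSpace ℝ (Fin n) → ℝ), IsMollifier C δ m →
      ∀ g : EuclideanSpace ℝ (Fin n) → F, IsTestOn (Metric.cthickening r (𝒜.core i)) g →
      IsTestOn (Metric.cthickening r (𝒜.core i)) (mollify m g) →
        l2 (localOp (a i) (b i) (mollify m g) - mollify m (localOp (a i) (b i) g)) ≤ L * l2 g)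
    (fun i c c' hc hcc δ m hm g h1 h2 => (hc δ m hm g h1 h2).trans
      (mul_le_mul_of_nonneg_right hcc (l2_nonneg g)))
    fun i => exists_l2_commutator_le_of_isTestOn (isOpen_localDomain (𝒜.center i))
      (𝒜.isCompact_cthickening_core i) (hr i) (hab i).smooth_coeff (hab i).smooth_zeroth hC
  refine ⟨B * (𝒜.size * (L * D + S)), by positivity, fun δ m hm hδ u => ?_⟩
  have ht := fun i => 𝒜.isTestOn_piece i u
  have hU := fun i => isOpen_localDomain (n := n) (F := F) (E := E) (𝒜.center i)
  have hs := fun i => (isTestOn_symbolOf (hU i) (𝒜.core_subset i)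
      (hab i).smooth_coeff (𝒜.isTestOn_localWeight i)).apply_localRep (𝒜.core_subset i) u
  have hop : ∀ i (K : Set (EuclideanSpace ℝ (Fin n))) (g : EuclideanSpace ℝ (Fin n) → F),
      IsCompact K → K ⊆ localDomain n F E (𝒜.center i) → IsTestOn K g →
      IsTestOn K (localOp (a i) (b i) g) := fun i K g hK hKU hg =>
    .of_isCompact hK (contDiff_localOp (hU i) (hab i).smooth_coeff (hab i).smooth_zeroth
      hg.contDiff (hg.tsupport_subset.trans hKU))
      (tsupport_localOp_subset.trans hg.tsupport_subset)
  have hop1 := fun i => hop i _ _ (𝒜.isCompact_cthickening_core i) (hr i)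
    ((ht i).mollify_core hm hδ)
  have hop2 := fun i => hop i _ _ (𝒜.isCompact_core i) (𝒜.core_subset i) (ht i)
  have hfam := fun i => ((hop1 i).sub ((hop2 i).mollify_core hm hδ)).add
    ((hs i).mollify_core hm hδ)
  -- Since a piece of `P u` is the local operator on the piece of `u` minus a zeroth-order term, the
  -- commutator splits into the Friedrichs commutators in the charts and mollified zeroth-order
  -- terms.
  have e : P (hr.smoothing hm hδ u) - hr.smoothing hm hδ (P u) =
      ∑ i, SmoothSection.ofLocal (𝒜.center i)
        (localOp (a i) (b i) (mollify m (𝒜.piece i u)) -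
          mollify m (localOp (a i) (b i) (𝒜.piece i u)) +
          mollify m fun y => symbolOf (a i) (𝒜.localWeight i) y
            (localRep n F E (𝒜.center i) u y)) := by
    change P (∑ i, SmoothSection.ofLocal (𝒜.center i) (mollify m (𝒜.piece i u))) -
      ∑ i, SmoothSection.ofLocal (𝒜.center i) (mollify m (𝒜.piece i (P u))) = _
    rw [hr.apply_sum_ofLocal hP hab fun i => (ht i).mollify_core hm hδ, ← Finset.sum_sub_distrib]
    refine Finset.sum_congr rfl fun i _ => ?_
    rw [← ofLocal_sub ((hop1 i).mono (hr i))
      (((𝒜.isTestOn_piece i (P u)).mollify_core hm hδ).mono (hr i)),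
      𝒜.piece_apply_operator (hab i), mollify_sub hm.contDiff.continuous
        (hop2 i).contDiff.continuous (hop2 i).hasCompactSupport (hs i).contDiff.continuous
        (hs i).hasCompactSupport]
    congr 1
    abel
  rw [e, mul_assoc]
  refine (hBb _ hfam).trans (mul_le_mul_of_nonneg_left ?_ hB)
  calc _ ≤ ∑ _i : Fin 𝒜.size, (L * (D * sectionNorm h μ u) + S * sectionNorm h μ u) :=
        Finset.sum_le_sum fun i _ => by
          refine (l2_add_le ((hop1 i).sub ((hop2 i).mollify_core hm hδ)).memLp
            ((hs i).mollify_core hm hδ).memLp).trans (add_le_add ?_ ?_)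
          · exact (hLb i δ m hm _ (ht i).cthickening_core ((ht i).mollify_core hm hδ)).trans
              (mul_le_mul_of_nonneg_left (hDb i u) hL)
          · exact (hm.l2_mollify_le (hs i).contDiff.continuous (hs i).hasCompactSupport).trans
              (hSb i u)
    _ = _ := by rw [Finset.sum_const, Finset.card_univ, Fintype.card_fin, nsmul_eq_mul]; ring

end Smoothing

/-! ### Extension of symmetric operators to completions -/

section Completion

open UniformSpace Filter Topology

/-- If a symmetric operator, bounded below by one, has bounded commutators with suitable smoothing
operators, then its range is dense. -/
theorem eq_zero_of_forall_inner_eq_zero {V : Type*} [SeminormedAddCommGroup V]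
    [InnerProductSpace ℂ V] {A : V →ₗ[ℂ] V} {J : ℕ → V →ₗ[ℂ] V}
    (hsym : ∀ u w, inner ℂ (A u) w = inner ℂ u (A w)) (hlow : ∀ u, ‖u‖ ≤ ‖A u‖)
    {B D : ℝ} (hB : 0 ≤ B) (hD : 0 ≤ D) (hJ : ∀ k u, ‖J k u‖ ≤ B * ‖u‖)
    (hJA : ∀ k u, ‖A (J k u) - J k (A u)‖ ≤ D * ‖u‖)
    (hAJ : ∀ k, ∃ L, 0 ≤ L ∧ ∀ u, ‖A (J k u)‖ ≤ L * ‖u‖)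
    (h1 : ∀ u, Tendsto (fun k => ‖J k u - u‖) atTop (𝓝 0))
    (h2 : ∀ u, Tendsto (fun k => ‖A (J k u) - J k (A u)‖) atTop (𝓝 0))
    (hadj : ∀ k φ, ∃ ψ, ∀ w, inner ℂ φ (J k w) = inner ℂ ψ w)
    {v : Completion V} (hv : ∀ u : V, inner ℂ ((A u : V) : Completion V) v = 0) : v = 0 := by
  have happrox : ∀ ε > 0, ∃ w : V, ‖(w : Completion V) - v‖ < ε := fun ε hε => by
    obtain ⟨w, hw⟩ := Metric.denseRange_iff.1 (Completion.denseRange_coe (α := V)) v ε hε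
    exact ⟨w, by rwa [dist_comm, dist_eq_norm] at hw⟩
  have main : ∀ ε > 0, ‖v‖ ≤ (2 * B + 2 * D + 6) * ε := by
    intro ε hε
    obtain ⟨w₀, hw₀⟩ := happrox ε hε
    -- The order of choices matters: `w₀` near `v` first, then `k` from the strong convergence at
    -- `w₀`, and at last `w` near `v`, as close as the bound `L` for this `k` requires.
    obtain ⟨k, hk1, hk2⟩ := (((h1 w₀).eventually_lt_const hε).and
      ((h2 w₀).eventually_lt_const hε)).exists
    obtain ⟨L, hL, hLb⟩ := hAJ k
    -- For this fixed `k`, `J A` is bounded because `A J` and the commutator are.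
    have hM : ∀ u, ‖J k (A u)‖ ≤ (L + D) * ‖u‖ := fun u => by
      have e : J k (A u) = A (J k u) - (A (J k u) - J k (A u)) := by abel
      rw [e, add_mul]
      exact (norm_sub_le _ _).trans (add_le_add (hLb u) (hJA k u))
    -- The weak equation enters here. With `ψ` the adjoint of `J k` applied to `J k (A w)`, symmetry
    -- gives `‖J k (A w)‖² = ⟨A ψ, w⟩`, and `⟨A ψ, v⟩ = 0` allows `w` to be replaced by `w - v`.
    -- Pairing with `A ψ` is bounded by `‖J k (A w)‖ * (L + D)`, and one factor `‖J k (A w)‖`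
    -- cancels.
    have key : ∀ w : V, ‖J k (A w)‖ ≤ (L + D) * ‖(w : Completion V) - v‖ := by
      intro w
      obtain ⟨ψ, hψ⟩ := hadj k (J k (A w))
      have hψ' : ∀ u, inner ℂ (A ψ) u = inner ℂ (J k (A w)) (J k (A u)) := fun u => by
        rw [hsym, hψ]
      have hbound : ∀ x : Completion V, ‖inner ℂ ((A ψ : V) : Completion V) x‖ ≤
          ‖J k (A w)‖ * (L + D) * ‖x‖ := by
        intro x
        induction x using Completion.induction_on with
        | hp => exact isClosed_le (by fun_prop) (by fun_prop)
        | ih u =>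
          rw [Completion.inner_coe, Completion.norm_coe, hψ', mul_assoc]
          exact (norm_inner_le_norm _ _).trans
            (mul_le_mul_of_nonneg_left (hM u) (norm_nonneg _))
      have h3 := hbound ((w : Completion V) - v)
      rw [inner_sub_right, hv, sub_zero, Completion.inner_coe, hψ', inner_self_eq_norm_sq_to_K,
        norm_pow, RCLike.norm_ofReal, abs_norm, sq, mul_assoc] at h3
      rcases (norm_nonneg (J k (A w))).eq_or_lt with h0 | h0
      · rw [← h0]
        positivity
      · exact le_of_mul_le_mul_left h3 h0
    obtain ⟨w, hw⟩ := happrox (min ε (ε / (L + D + 1))) (by positivity)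
    have hwε := hw.le.trans (min_le_left _ _)
    have hwM : ‖J k (A w)‖ ≤ ε := by
      refine (key w).trans ?_
      calc (L + D) * ‖(w : Completion V) - v‖ ≤ (L + D + 1) * (ε / (L + D + 1)) :=
            mul_le_mul (by linarith) (hw.le.trans (min_le_right _ _)) (norm_nonneg _)
              (by positivity)
        _ = ε := by field_simp
    have hww₀ : ‖w - w₀‖ ≤ 2 * ε := by
      rw [← Completion.norm_coe (w - w₀), Completion.coe_sub]
      have e : (w : Completion V) - w₀ = (w - v) - (w₀ - v) := by abel
      rw [e]
      exact (norm_sub_le _ _).trans (by linarith [hw₀.le])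
    -- The uniform bound `D` controls the commutator on `w - w₀`, the strong convergence controls it
    -- on `w₀`.
    have hc : ‖A (J k w) - J k (A w)‖ ≤ D * (2 * ε) + ε := by
      have e : A (J k w) - J k (A w) = (A (J k (w - w₀)) - J k (A (w - w₀))) +
          (A (J k w₀) - J k (A w₀)) := by
        simp only [map_sub]
        abel
      rw [e]
      exact (norm_add_le _ _).trans (add_le_add ((hJA k _).trans
        (mul_le_mul_of_nonneg_left hww₀ hD)) hk2.le)
    have hJw : ‖J k w - w‖ ≤ B * (2 * ε) + ε + 2 * ε := by
      have e : J k w - w = J k (w - w₀) + (J k w₀ - w₀) - (w - w₀) := by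
        simp only [map_sub]
        abel
      rw [e]
      exact (norm_sub_le _ _).trans (add_le_add ((norm_add_le _ _).trans (add_le_add ((hJ k _).trans
        (mul_le_mul_of_nonneg_left hww₀ hB)) hk1.le)) hww₀)
    -- The lower bound of `A` converts smallness of `A (J k w)` into smallness of `J k w`.
    have hJw' : ‖J k w‖ ≤ D * (2 * ε) + ε + ε := by
      refine (hlow _).trans ?_
      have e : A (J k w) = (A (J k w) - J k (A w)) + J k (A w) := by abel
      rw [e]
      exact (norm_add_le _ _).trans (add_le_add hc hwM)
    have hwn : ‖w‖ ≤ ‖J k w‖ + ‖J k w - w‖ := by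
      have e : w = J k w - (J k w - w) := by abel
      conv_lhs => rw [e]
      exact norm_sub_le _ _
    have hvn : ‖v‖ ≤ ‖w‖ + ε := by
      have e : v = (w : Completion V) - (w - v) := by abel
      conv_lhs => rw [e]
      refine (norm_sub_le _ _).trans ?_
      rw [Completion.norm_coe]
      linarith
    linarith
  refine norm_le_zero_iff.1 (le_of_forall_pos_le_add fun ε hε => ?_)
  have hc : 0 < 2 * B + 2 * D + 6 := by positivity
  refine (main (ε / (2 * B + 2 * D + 6)) (by positivity)).trans (le_of_eq ?_)
  field_simp
  ring

/-- A bounded operator which is bounded below and has dense range extends to an isomorphism of the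
completions. -/
theorem exists_completion_equiv {V W : Type*} [SeminormedAddCommGroup V] [NormedSpace ℂ V]
    [SeminormedAddCommGroup W] [InnerProductSpace ℂ W] (A : V →ₗ[ℂ] W) {C C' : ℝ}
    (hC' : 0 ≤ C') (hA : ∀ u, ‖A u‖ ≤ C * ‖u‖) (hA' : ∀ u, ‖u‖ ≤ C' * ‖A u‖)
    (hdense : ∀ v : Completion W, (∀ u, inner ℂ ((A u : W) : Completion W) v = 0) → v = 0) :
    ∃ T : Completion V ≃L[ℂ] Completion W, ∀ u : V, T u = (A u : W) := by
  let f : V →L[ℂ] Completion W := Completion.toComplL.comp (A.mkContinuous C hA)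
  let T : Completion V →L[ℂ] Completion W := f.extend Completion.toComplL
  have hT : ∀ u : V, T u = (A u : W) := fun u =>
    ContinuousLinearMap.extend_eq f Completion.denseRange_coe
      (Completion.isUniformInducing_coe V) u
  -- The lower bound passes from the dense subspace to the completion; it gives injectivity and
  -- closedness of the range.
  have hlow : ∀ x, ‖x‖ ≤ C' * ‖T x‖ := fun x => by
    induction x using Completion.induction_on with
    | hp => exact isClosed_le (by fun_prop) (by fun_prop)
    | ih u =>
      rw [hT, Completion.norm_coe, Completion.norm_coe]
      exact hA' u
  have hanti : AntilipschitzWith ⟨C', hC'⟩ T := T.antilipschitz_of_bound hlow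
  have hclosed : IsClosed (T.range : Set (Completion W)) := by
    rw [LinearMap.coe_range]
    exact hanti.isClosed_range T.uniformContinuous
  -- A closed subspace of a Hilbert space with trivial orthogonal complement is everything.
  have hrange : T.range = ⊤ := by
    have := hclosed.completeSpace_coe
    rw [← Submodule.orthogonal_eq_bot_iff, Submodule.eq_bot_iff]
    intro v hv
    refine hdense v fun u => ?_
    rw [← hT]
    exact hv _ (LinearMap.mem_range_self _ _)
  exact ⟨ContinuousLinearEquiv.ofBijective T (LinearMap.ker_eq_bot.2 hanti.injective) hrange, hT⟩

end Completion

/-! ### Density of the range and the isomorphism for symmetric elliptic operators -/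

section Isomorphism

open Filter Topology

variable {n : ℕ} {X : Type*} [TopologicalSpace X] [ChartedSpace (EuclideanSpace ℝ (Fin n)) X]
  [CompactSpace X] [MeasurableSpace X] [BorelSpace X]
  {F : Type*} [NormedAddCommGroup F] [NormedSpace ℂ F]
  {E : X → Type*} [TopologicalSpace (TotalSpace F E)] [∀ x, TopologicalSpace (E x)]
  [∀ x, AddCommGroup (E x)] [∀ x, Module ℂ (E x)] [FiberBundle F E]
  [VectorBundle ℝ F E] [VectorBundle ℂ F E]
  {h : HermitianMetric n F E} {μ : Measure X} [IsSmoothDensity n μ]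
  [T2Space X] [FiniteDimensional ℂ F]
  [IsManifold (𝓡 n) ∞ X] [ContMDiffVectorBundle ∞ F E (𝓡 n)] (𝒜 : SobolevAtlas n F E)

/-- The range of a formally self-adjoint first-order operator which is bounded below by one is
dense. -/
theorem eq_zero_of_forall_inner_ofSmooth_eq_zero (𝒜 : SobolevAtlas n F E)
    {P : SmoothSection n F E →ₗ[ℂ] SmoothSection n F E} (hP : IsFirstOrderDifferentialOperator P)
    (hsa : IsFormallySelfAdjoint h μ P) (hlow : ∀ u, sectionNorm h μ u ≤ sectionNorm h μ (P u))
    {v : SobolevH0 h μ} (hv : ∀ u, inner ℂ (SobolevH0.ofSmooth h μ (P u)) v = 0) : v = 0 := by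
  obtain ⟨r, hr0, hr⟩ := 𝒜.exists_isMargin
  obtain ⟨C, hC, hCm⟩ := exists_mollifier n
  -- Radii tending to zero: below `r` the mollified pieces stay inside the charts, below `1` the
  -- approximation estimates apply.
  let δ : ℕ → ℝ := fun k => min r 1 / (k + 1)
  have hδ0 : ∀ k, 0 < δ k := fun k => div_pos (lt_min hr0 one_pos) (by positivity)
  have hδle : ∀ k, δ k ≤ min r 1 := fun k =>
    div_le_self (lt_min hr0 one_pos).le (by have : (0 : ℝ) ≤ k := k.cast_nonneg; linarith)
  have hδr : ∀ k, δ k ≤ r := fun k => (hδle k).trans (min_le_left _ _)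
  have hδ1 : ∀ k, δ k ≤ 1 := fun k => (hδle k).trans (min_le_right _ _)
  have hlim : ∀ B, Tendsto (fun k => B * δ k) atTop (𝓝 0) := fun B => by
    have h1 : Tendsto δ atTop (𝓝 0) :=
      tendsto_const_nhds.div_atTop (tendsto_natCast_atTop_atTop.atTop_add tendsto_const_nhds)
    simpa using h1.const_mul B
  choose m hm using fun k => hCm (δ k) (hδ0 k)
  let J : ℕ → SmoothSection n F E →ₗ[ℂ] SmoothSection n F E := fun k =>
    hr.smoothing (hm k) (hδr k)
  obtain ⟨B, hB, hBb⟩ := hr.exists_sectionNorm_smoothing_le h μ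
  obtain ⟨D, hD, hDb⟩ := hr.exists_sectionNorm_commutator_le h μ hP hC
  have h1 : ∀ u, Tendsto (fun k => sectionNorm h μ (J k u - u)) atTop (𝓝 0) := fun u => by
    obtain ⟨S, -, hSb⟩ := hr.exists_sectionNorm_smoothing_sub_le h μ u
    exact squeeze_zero (fun k => sectionNorm_nonneg h μ _)
      (fun k => hSb C (δ k) (m k) (hm k) (hδr k) (hδ0 k).le (hδ1 k)) (hlim S)
  -- Both `P (J k u)` and `J k (P u)` converge to `P u`, so the commutator tends to zero on each
  -- smooth section.
  have h2 : ∀ u, Tendsto (fun k => sectionNorm h μ (P (J k u) - J k (P u))) atTop (𝓝 0) :=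
      fun u => by
    obtain ⟨S, -, hSb⟩ := hr.exists_sectionNorm_apply_smoothing_sub_le h μ hP u
    refine squeeze_zero (fun k => sectionNorm_nonneg h μ _) (fun k => ?_)
      (by simpa using (hlim S).add (h1 (P u)))
    have e : P (J k u) - J k (P u) = (P (J k u) - P u) - (J k (P u) - P u) := by abel
    rw [e]
    exact (sectionNorm_sub_le h μ _ _).trans (add_le_add
      (hSb C (δ k) (m k) (hm k) (hδr k) (hδ0 k).le (hδ1 k)) le_rfl)
  exact eq_zero_of_forall_inner_eq_zero (V := L2SmoothSection h μ) (A := P) (J := J) hsa hlow hB hD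
    (fun k u => hBb C (δ k) (m k) (hm k) (hδr k) u)
    (fun k u => hDb (δ k) (m k) (hm k) (hδr k) u)
    (fun k => hr.exists_sectionNorm_apply_smoothing_le h μ hP (hm k) (hδr k)) h1 h2
    (fun k φ => hr.exists_l2Inner_smoothing_eq h μ (hm k) (hδr k) φ) hv

/-- A formally self-adjoint elliptic operator of first order which is bounded below by one is an
isomorphism from `H₁` to `H₀`. -/
theorem exists_equiv_of_sectionNorm_le {P : SmoothSection n F E →ₗ[ℂ] SmoothSection n F E}
    (hP : IsFirstOrderDifferentialOperator P) (hell : IsElliptic P)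
    (hsa : IsFormallySelfAdjoint h μ P) (hlow : ∀ u, sectionNorm h μ u ≤ sectionNorm h μ (P u)) :
    ∃ T : SobolevH1 𝒜 ≃L[ℂ] SobolevH0 h μ, ∀ u : SmoothSection n F E,
      T (SobolevH1.ofSmooth 𝒜 u) = SobolevH0.ofSmooth h μ (P u) := by
  obtain ⟨C, hC, hCb⟩ := 𝒜.exists_sectionNorm_apply_le h μ hP
  obtain ⟨D, hD, hDb⟩ := 𝒜.exists_sobolevNorm_le h μ hP hell
  -- The factor `2` comes from `‖P u‖ + ‖u‖ ≤ 2 ‖P u‖`, which removes the lower-order term of the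
  -- elliptic estimate.
  refine exists_completion_equiv (V := H1SmoothSection 𝒜) (W := L2SmoothSection h μ) P
    (C' := D * 2) (by positivity) hCb (fun u => ?_)
    fun v hv => eq_zero_of_forall_inner_ofSmooth_eq_zero 𝒜 hP hsa hlow hv
  refine (hDb u).trans ?_
  rw [mul_assoc]
  refine mul_le_mul_of_nonneg_left ?_ hD
  change _ ≤ 2 * sectionNorm h μ (P u)
  linarith [hlow u]

end Isomorphism

/-! ### Odd operators -/

section Odd

variable {n : ℕ} {X : Type*} [TopologicalSpace X] [ChartedSpace (EuclideanSpace ℝ (Fin n)) X]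
  {F : Type*} [NormedAddCommGroup F] [NormedSpace ℂ F]
  {G : X → Type*} [TopologicalSpace (TotalSpace F G)] [∀ x, TopologicalSpace (G x)]
  [∀ x, AddCommGroup (G x)] [∀ x, Module ℂ (G x)] [FiberBundle F G]
  [VectorBundle ℝ F G] [VectorBundle ℂ F G]

variable (F) in
/-- The map `(v, w) ↦ (v, -w)`. -/
def gradingMap : F × F →L[ℂ] F × F :=
  (ContinuousLinearMap.fst ℂ F F).prod (-ContinuousLinearMap.snd ℂ F F)

theorem localRep_gradingOperator (x₀ : X) (u : SmoothSection n (F × F) (G ×ᵇ G))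
    {y : EuclideanSpace ℝ (Fin n)} (hy : y ∈ localDomain n (F × F) (G ×ᵇ G) x₀) :
    localRep n (F × F) (G ×ᵇ G) x₀ (gradingOperator u) y =
      gradingMap F (localRep n (F × F) (G ×ᵇ G) x₀ u y) :=
  Prod.ext rfl (((trivializationAt F G x₀).linear ℂ hy.2.2).map_neg _)

variable {P : SmoothSection n (F × F) (G ×ᵇ G) →ₗ[ℂ] SmoothSection n (F × F) (G ×ᵇ G)}
  {x₀ : X} {a : Fin n → EuclideanSpace ℝ (Fin n) → (F × F →L[ℂ] F × F)}
  {b : EuclideanSpace ℝ (Fin n) → (F × F →L[ℂ] F × F)}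

theorem IsLocalForm.sub_gradingOperator (hab : IsLocalForm P x₀ a b) :
    IsLocalForm (P - gradingOperator) x₀ a (fun y => b y - gradingMap F) where
  smooth_coeff := hab.smooth_coeff
  smooth_zeroth := hab.smooth_zeroth.sub contDiffOn_const
  eq u y hy := by
    refine (localRep_sub x₀ (P u) (gradingOperator u) hy).trans ?_
    rw [hab.eq u y hy, localRep_gradingOperator x₀ u hy, sub_apply, add_sub_assoc]

/-- Ellipticity concerns every local form of an operator; a local form of the difference comes from
one of `P` with the same leading coefficients, hence with the same principal symbol. -/
theorem IsLocalForm.of_sub_gradingOperator (hab : IsLocalForm (P - gradingOperator) x₀ a b) :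
    IsLocalForm P x₀ a (fun y => b y + gradingMap F) where
  smooth_coeff := hab.smooth_coeff
  smooth_zeroth := hab.smooth_zeroth.add contDiffOn_const
  eq u y hy := by
    have h1 := (localRep_sub x₀ (P u) (gradingOperator u) hy).symm.trans (hab.eq u y hy)
    rw [sub_eq_iff_eq_add, localRep_gradingOperator x₀ u hy] at h1
    rw [h1, add_apply, add_assoc]

/-- The grading is `1` on the first summand and `-1` on the second, and `P` exchanges the summands.
-/
theorem gradingOperator_apply_of_isOdd (hodd : IsOdd P) (u : SmoothSection n (F × F) (G ×ᵇ G)) :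
    gradingOperator (P u) = -P (gradingOperator u) := by
  set p := SmoothSection.pair (SmoothSection.fst u) 0
  set q := SmoothSection.pair 0 (SmoothSection.snd u)
  have e1 : u = p + q := by
    ext x
    · exact (add_zero _).symm
    · exact (zero_add _).symm
  have e2 : gradingOperator u = p - q := by
    ext x
    · exact (sub_zero _).symm
    · exact (zero_sub _).symm
  have e3 : gradingOperator (P p) = -P p := by
    have h0 : ∀ x, ((P p : ∀ x, (G ×ᵇ G) x) x).1 = 0 := fun x =>
      congrFun (congrArg Subtype.val (hodd (SmoothSection.fst u)).1) x
    ext x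
    · exact (h0 x).trans (neg_eq_zero.2 (h0 x)).symm
    · rfl
  have e4 : gradingOperator (P q) = P q := by
    have h0 : ∀ x, ((P q : ∀ x, (G ×ᵇ G) x) x).2 = 0 := fun x =>
      congrFun (congrArg Subtype.val (hodd (SmoothSection.snd u)).2) x
    ext x
    · rfl
    · exact (neg_eq_zero.2 (h0 x)).trans (h0 x).symm
  rw [e2]
  conv_lhs => rw [e1]
  rw [map_add, map_add, map_sub, e3, e4]
  abel

variable [CompactSpace X] [MeasurableSpace X] [BorelSpace X] [FiniteDimensional ℂ F]
  (h : HermitianMetric n F G) (μ : Measure X)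

theorem l2Inner_gradingOperator (u v : SmoothSection n (F × F) (G ×ᵇ G)) :
    l2Inner h.directSum μ (gradingOperator u) v = l2Inner h.directSum μ u (gradingOperator v) := by
  refine integral_congr_ae (Filter.Eventually.of_forall fun x => ?_)
  change h.form x _ _ + h.form x (-_) _ = h.form x _ _ + h.form x _ (-_)
  rw [map_neg, map_neg]
  rfl

theorem gradingOperator_gradingOperator (u : SmoothSection n (F × F) (G ×ᵇ G)) :
    gradingOperator (gradingOperator u) = u := by
  ext x
  · rfl
  · exact neg_neg _

variable {h μ} [IsSmoothDensity n μ]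

/-- The cross term vanishes and the grading is isometric, so `‖P u - ε u‖² = ‖P u‖² + ‖u‖²`. -/
theorem sectionNorm_le_sub_gradingOperator (hsa : IsFormallySelfAdjoint h.directSum μ P)
    (hodd : IsOdd P) (u : SmoothSection n (F × F) (G ×ᵇ G)) :
    sectionNorm h.directSum μ u ≤ sectionNorm h.directSum μ (P u - gradingOperator u) := by
  set N := sectionNorm h.directSum μ with hN
  have h1 : (l2Inner h.directSum μ (P u) (gradingOperator u)).re = 0 := by
    -- `⟨P u, ε u⟩ = ⟨u, P ε u⟩ = -⟨u, ε P u⟩ = -⟨ε u, P u⟩`, by symmetry of `P`, anticommutation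
    -- and symmetry of `ε`.
    have e : l2Inner h.directSum μ (P u) (gradingOperator u) =
        -starRingEnd ℂ (l2Inner h.directSum μ (P u) (gradingOperator u)) := by
      rw [l2Inner_conj]
      conv_lhs => rw [hsa, ← neg_neg (P (gradingOperator u)), ← gradingOperator_apply_of_isOdd hodd]
      rw [l2Inner_gradingOperator]
      exact inner_neg_right (𝕜 := ℂ) (E := L2SmoothSection h.directSum μ) u (gradingOperator (P u))
    have := congrArg Complex.re e
    rw [Complex.neg_re, Complex.conj_re] at this
    linarith
  have h2 : N (gradingOperator u) ^ 2 = N u ^ 2 := by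
    rw [hN, sectionNorm_sq, sectionNorm_sq, l2Inner_gradingOperator,
      gradingOperator_gradingOperator]
  have h3 : N (P u - gradingOperator u) ^ 2 =
      N (P u) ^ 2 - 2 * (l2Inner h.directSum μ (P u) (gradingOperator u)).re +
        N (gradingOperator u) ^ 2 :=
    norm_sub_sq (𝕜 := ℂ) (E := L2SmoothSection h.directSum μ) (P u) (gradingOperator u)
  refine le_of_sq_le_sq ?_ (sectionNorm_nonneg _ _ _)
  rw [h3, h1, h2]
  nlinarith [sq_nonneg (N (P u))]

end Odd

end

/-! ### The isomorphism for odd operators -/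

theorem mainTheorem11 {n : ℕ} {X : Type*} [TopologicalSpace X]
    [ChartedSpace (EuclideanSpace ℝ (Fin n)) X] [IsManifold (𝓡 n) ∞ X]
    [CompactSpace X] [T2Space X] [MeasurableSpace X] [BorelSpace X]
    {F : Type*} [NormedAddCommGroup F] [NormedSpace ℂ F] [FiniteDimensional ℂ F]
    {G : X → Type*} [TopologicalSpace (TotalSpace F G)] [∀ x, TopologicalSpace (G x)]
    [∀ x, AddCommGroup (G x)] [∀ x, Module ℂ (G x)] [FiberBundle F G]
    [VectorBundle ℝ F G] [VectorBundle ℂ F G] [ContMDiffVectorBundle ∞ F G (𝓡 n)]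
    (h : HermitianMetric n F G) (μ : Measure X) [IsSmoothDensity n μ]
    (𝒜 : SobolevAtlas n (F × F) (G ×ᵇ G))
    (P : SmoothSection n (F × F) (G ×ᵇ G) →ₗ[ℂ] SmoothSection n (F × F) (G ×ᵇ G))
    (hP : IsFirstOrderDifferentialOperator P) (hell : IsElliptic P)
    (hsa : IsFormallySelfAdjoint h.directSum μ P) (hodd : IsOdd P) :
    ∃ T : SobolevH1 𝒜 ≃L[ℂ] SobolevH0 h.directSum μ,
      ∀ u : SmoothSection n (F × F) (G ×ᵇ G),
        T (SobolevH1.ofSmooth 𝒜 u) =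
          SobolevH0.ofSmooth h.directSum μ (P u - gradingOperator u) := by
  refine exists_equiv_of_sectionNorm_le 𝒜 (P := P - gradingOperator) (fun x₀ => ?_)
    (fun x₀ a b hab => hell x₀ a _ hab.of_sub_gradingOperator) (fun u v => ?_)
    (sectionNorm_le_sub_gradingOperator hsa hodd)
  · obtain ⟨a, b, hab⟩ := hP x₀
    exact ⟨a, _, hab.sub_gradingOperator⟩
  · have e1 : l2Inner h.directSum μ (P u - gradingOperator u) v =
        l2Inner h.directSum μ (P u) v - l2Inner h.directSum μ (gradingOperator u) v :=
      inner_sub_left (𝕜 := ℂ) (E := L2SmoothSection h.directSum μ) (P u) (gradingOperator u) v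
    have e2 : l2Inner h.directSum μ u (P v - gradingOperator v) =
        l2Inner h.directSum μ u (P v) - l2Inner h.directSum μ u (gradingOperator v) :=
      inner_sub_right (𝕜 := ℂ) (E := L2SmoothSection h.directSum μ) u (P v) (gradingOperator v)
    exact e1.trans (by rw [hsa, l2Inner_gradingOperator, ← e2]; rfl)
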